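/- **Setting.** Let $n\ge 2$ and $N\ge 1$ be integers and let $A=(A_{ij})_{0\le i,j\le n}$ be the Cartan matrix of affine type $A_n^{(1)}$ ($A_{ii}=2$, $A_{ij}=-1$ if $i-j\equiv\pm1 \bmod (n+1)$, and $A_{ij}=0$ otherwise). The toroidal Lie algebra $\tau(A_n)$ is the complex Lie algebra with generators $K_{\mathbf m,l}$, $H_i(\mathbf m)$, $E_i(\mathbf m)$, $F_i(\mathbf m)$ ($0\le i\le n$, $0\le l\le N$, $\mathbf m\in\mathbb Z^{N+1}$) and relations, for all indices: $K_{\mathbf m,l}$ is central; $\sum_{l} m_lK_{\mathbf m,l}=0$; $$[H_i(\mathbf m),H_j(\mathbf k)]=A_{ij}\sum_{l} m_lK_{\mathbf m+\mathbf k,l},\quad [H_i(\mathbf m),E_j(\mathbf k)]=A_{ij}E_j(\mathbf m+\mathbf k),\quad [H_i(\mathbf m),F_j(\mathbf k)]=-A_{ij}F_j(\mathbf m+\mathbf k),$$ $$[E_i(\mathbf m),F_j(\mathbf k)]=-\delta_{ij}\Big(H_i(\mathbf m+\mathbf k)+\tfrac{2}{A_{ii}}\sum_{l} m_lK_{\mathbf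 m+\mathbf k,l}\Big),\quad [E_i(\mathbf m),E_i(\mathbf k)]=0=[F_i(\mathbf m),F_i(\mathbf k)],$$ $$(\mathrm{ad}\,E_i(\mathbf m))^{1-A_{ij}}E_j(\mathbf k)=0=(\mathrm{ad}\,F_i(\mathbf m))^{1-A_{ij}}F_j(\mathbf k)\qquad(i\ne j).$$ Fix a decomposition $\mathbb Z^{N+1}=\mathbb Z^{N+1}_-\sqcup\{\mathbf 0\}\sqcup\mathbb Z^{N+1}_+$ with $\mathbb Z^{N+1}_\pm$ closed under addition; write $\mathbf m>0$ if $\mathbf m\in\mathbb Z^{N+1}_+$, and let $\theta(\mathbf m)=1$ if $\mathbf m>0$ and $\theta(\mathbf m)=0$ otherwise. Let $$\mathbb C[\mathbf x]=\mathbb C[x_{ij}(\mathbf m):0<i<j\le n+1,\ \mathbf m\in\mathbb Z^{N+1}],\qquad \mathbb C[\mathbf y]=\mathbb C[y_i(\mathbf k):1\le i\le n,\ \mathbf k>0].$$ Let $\kappa_{\mathbf m,p}\in\mathbb C$ ($\mathbf m\in\mathbb Z^{N+1}$, $0\le p\le N$) and $\lambda_i\in\mathbb C$ be given. On $\mathbb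 C[\mathbf y]$ put, for $1\le i\le n$, $$\Phi(b_i)(\mathbf m)=\theta(-\mathbf m)\sum_{\mathbf s>0}\sum_p m_p\kappa_{-\mathbf m+\mathbf s,p}\big(\partial_{y_{i-1}(\mathbf s)}-\partial_{y_i(\mathbf s)}\big)+\theta(\mathbf m)\sum_{\mathbf s>0}\sum_p m_p\kappa_{-\mathbf m+\mathbf s,p}\big(\partial_{y_{i-1}(\mathbf s)}-2\partial_{y_i(\mathbf s)}+\partial_{y_{i+1}(\mathbf s)}\big)+\theta(-\mathbf m)y_i(-\mathbf m)-\delta_{\mathbf m,\mathbf 0}\lambda_i$$ (with $\partial_{y_0(\mathbf s)}=\partial_{y_{n+1}(\mathbf s)}=0$) and $\Phi(b_0)(\mathbf m)=-\sum_{i=1}^n\Phi(b_i)(\mathbf m)$. On $\mathbb C[\mathbf x]\otimes\mathbb C[\mathbf y]$ let $a_{ij,\mathbf m}=-x_{ij}(\mathbf m)$ and $a^*_{ij,\mathbf m}=\partial/\partial x_{ij}(-\mathbf m)$ act on the first factor and $\Phi(b_i)(\mathbf m)$ on the second, and let $a_{ij}(\mathbf z)=\sum_{\mathbf m} a_{ij,\mathbf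 m}\mathbf z^{-\mathbf m}$, $a^*_{ij}(\mathbf z)=\sum_{\mathbf m} a^*_{ij,\mathbf m}\mathbf z^{-\mathbf m}$, $\Phi(b_i)(\mathbf z)=\sum_{\mathbf m}\Phi(b_i)(\mathbf m)\mathbf z^{-\mathbf m}$, $$\kappa\cdot D\,a^*_{ij}(\mathbf z)=\sum_{p=0}^N\Big(\sum_{\mathbf m}\kappa_{\mathbf m,p}\mathbf z^{\mathbf m}\Big)z_p\frac{\partial}{\partial z_p}a^*_{ij}(\mathbf z).$$ All products below, with the $a_{ij}$ to the left of the $a^*_{kl}$, have coefficients that are finite sums on every vector. **Theorem (Realization).** Assume $$\sum_{p=0}^N m_p\kappa_{\mathbf m,p}=0\ \text{ for all }\mathbf m,\qquad \sum_{p=0}^N m_p\kappa_{-\mathbf m-\mathbf k,p}=0\ \text{ for all }\mathbf m>0,\ \mathbf k>0.$$ Define, suppressing $\mathbf z$, for $1\le r\le n$, $$\rho(F_r)=a_{r,r+1}-\sum_{j=1}^{r-1}a_{j,r+1}a^*_{jr},$$ $$\rho(H_r)=2a_{r,r+1}a^*_{r,r+1}+\sum_{i=1}^{r-1}(a_{i,r+1}a^*_{i,r+1}-a_{ir}a^*_{ir})+\sum_{j=r+2}^{n+1}(a_{rj}a^*_{rj}-a_{r+1,j}a^*_{r+1,j})+\Phi(b_r),$$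 $$\rho(E_r)=a_{r,r+1}a^*_{r,r+1}a^*_{r,r+1}-\sum_{j=r+2}^{n+1}a_{r+1,j}a^*_{rj}+\sum_{j=1}^{r-1}a_{jr}a^*_{j,r+1}+\sum_{j=r+2}^{n+1}(a_{rj}a^*_{rj}-a_{r+1,j}a^*_{r+1,j})a^*_{r,r+1}+a^*_{r,r+1}\Phi(b_r)+\kappa\cdot Da^*_{r,r+1},$$ and $$\rho(E_0)=-a_{1,n+1},\qquad \rho(H_0)=-\sum_{r=1}^{n}a_{r,n+1}a^*_{r,n+1}-\sum_{r=2}^{n+1}a_{1r}a^*_{1r}+\Phi(b_0),$$ $$\rho(F_0)=-\sum_{1\le r<j\le n+1}a_{rj}\sum_{\substack{\mathbf q:\ q_i=j\\ q_{i-1}\le r}}\Big(\prod_{l=1}^{i-1}a^*_{q_lq_{l+1}}\Big)a^*_{r,n+1}-\sum_{r=1}^n\ \sum_{\mathbf q:\ q_i\le r}\Big(\prod_{l=1}^{i}a^*_{q_lq_{l+1}}\Big)\Phi(b_r)-\sum_{r=1}^n\ \sum_{\mathbf q:\ q_i=r}\Big(\prod_{l=1}^{i-1}a^*_{q_lq_{l+1}}\Big)\kappa\cdot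 Da^*_{r,n+1},$$ where $\mathbf q$ runs over all finite sequences $1=q_1<q_2<\dots<q_i$ of integers (any length $i\ge1$) with the stated restrictions, and $q_{i+1}:=n+1$. Then there is a unique representation $\rho$ of $\tau(A_n)$ on $\mathbb C[\mathbf x]\otimes\mathbb C[\mathbf y]$ in which $E_r(\mathbf m)$, $F_r(\mathbf m)$, $H_r(\mathbf m)$ ($0\le r\le n$) act as the coefficients of $\mathbf z^{-\mathbf m}$ in $\rho(E_r)$, $\rho(F_r)$, $\rho(H_r)$, and $K_{\mathbf m,l}$ acts as the scalar $-\kappa_{-\mathbf m,l}$. Moreover $\rho(H_0)=-\sum_{r=1}^n\rho(H_r)$. -/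

import Mathlib

open scoped TensorProduct

attribute [local instance 100] LieRing.ofAssociativeRing

namespace Toroidal

/-- The lattice of multi-indices `ℤ^{N+1}`. -/
abbrev Idx (N : ℕ) : Type := Fin (N + 1) → ℤ

/-- A decomposition of `ℤ^{N+1}` into disjoint sets `neg`, `{0}`, `pos`, with `pos` and `neg`
closed under addition. -/
structure SignDecomposition (N : ℕ) where
  pos : Set (Idx N)
  neg : Set (Idx N)
  zero_notMem_pos : (0 : Idx N) ∉ pos
  zero_notMem_neg : (0 : Idx N) ∉ neg
  disjoint : Disjoint neg pos
  union_eq : neg ∪ {0} ∪ pos = Set.univ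
  add_mem_pos : ∀ {j k : Idx N}, j ∈ pos → k ∈ pos → j + k ∈ pos
  add_mem_neg : ∀ {j k : Idx N}, j ∈ neg → k ∈ neg → j + k ∈ neg

/-! ### The toroidal Lie algebra by generators and relations -/

/-- The Cartan matrix of affine type `A_n^{(1)}`, `n ≥ 2`, with rows and columns `0, …, n`
(addition in `Fin (n + 1)` is cyclic). -/
def affineCartan (n : ℕ) (i j : Fin (n + 1)) : ℤ :=
  if i = j then 2 else if i + 1 = j ∨ j + 1 = i then -1 else 0

/-- The generators. -/
inductive Gen (n N : ℕ) : Type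
  | K (m : Idx N) (l : Fin (N + 1)) : Gen n N
  | H (i : Fin (n + 1)) (m : Idx N) : Gen n N
  | E (i : Fin (n + 1)) (m : Idx N) : Gen n N
  | F (i : Fin (n + 1)) (m : Idx N) : Gen n N

noncomputable section

/-- A generator as an element of the free Lie algebra. -/
abbrev gen {n N : ℕ} (g : Gen n N) : FreeLieAlgebra ℂ (Gen n N) := FreeLieAlgebra.of ℂ g

/-- `∑_l m_l K_{r,l}` in the free Lie algebra. -/
def sumK {n N : ℕ} (m r : Idx N) : FreeLieAlgebra ℂ (Gen n N) :=
  ∑ l, (m l : ℂ) • gen (Gen.K r l)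

open LieAlgebra in
/-- The relators: `Relator x` means that `x = 0` is one of the defining relations. -/
inductive Relator (n N : ℕ) : FreeLieAlgebra ℂ (Gen n N) → Prop
  | central (m : Idx N) (l : Fin (N + 1)) (g : Gen n N) :
      Relator n N ⁅gen (n := n) (Gen.K m l), gen g⁆
  | sumK (m : Idx N) : Relator n N (sumK m m)
  | HH (i j : Fin (n + 1)) (m k : Idx N) :
      Relator n N (⁅gen (n := n) (Gen.H i m), gen (Gen.H j k)⁆
        - (affineCartan n i j : ℂ) • Toroidal.sumK m (m + k))
  | HE (i j : Fin (n + 1)) (m k : Idx N) :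
      Relator n N (⁅gen (n := n) (Gen.H i m), gen (Gen.E j k)⁆
        - (affineCartan n i j : ℂ) • gen (Gen.E j (m + k)))
  | HF (i j : Fin (n + 1)) (m k : Idx N) :
      Relator n N (⁅gen (n := n) (Gen.H i m), gen (Gen.F j k)⁆
        + (affineCartan n i j : ℂ) • gen (Gen.F j (m + k)))
  | EF_same (i : Fin (n + 1)) (m k : Idx N) :
      Relator n N (⁅gen (n := n) (Gen.E i m), gen (Gen.F i k)⁆
        + (gen (Gen.H i (m + k))
          + (2 / (affineCartan n i i : ℂ)) • Toroidal.sumK m (m + k)))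
  | EF_ne (i j : Fin (n + 1)) (hij : i ≠ j) (m k : Idx N) :
      Relator n N ⁅gen (n := n) (Gen.E i m), gen (Gen.F j k)⁆
  | EE (i : Fin (n + 1)) (m k : Idx N) : Relator n N ⁅gen (n := n) (Gen.E i m), gen (Gen.E i k)⁆
  | FF (i : Fin (n + 1)) (m k : Idx N) : Relator n N ⁅gen (n := n) (Gen.F i m), gen (Gen.F i k)⁆
  | serreE (i j : Fin (n + 1)) (hij : i ≠ j) (m k : Idx N) :
      Relator n N (((ad ℂ (FreeLieAlgebra ℂ (Gen n N)) (gen (Gen.E i m)))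
        ^ (-affineCartan n i j + 1).toNat) (gen (Gen.E j k)))
  | serreF (i j : Fin (n + 1)) (hij : i ≠ j) (m k : Idx N) :
      Relator n N (((ad ℂ (FreeLieAlgebra ℂ (Gen n N)) (gen (Gen.F i m)))
        ^ (-affineCartan n i j + 1).toNat) (gen (Gen.F j k)))

/-- The ideal of the free Lie algebra generated by the relators. -/
abbrev relatorIdeal (n N : ℕ) : LieIdeal ℂ (FreeLieAlgebra ℂ (Gen n N)) :=
  LieSubmodule.lieSpan ℂ (FreeLieAlgebra ℂ (Gen n N)) {x | Relator n N x}

/-- The toroidal Lie algebra `τ(A_n)`. -/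
abbrev ToroidalLieAlgebra (n N : ℕ) : Type :=
  FreeLieAlgebra ℂ (Gen n N) ⧸ relatorIdeal n N

/-- The image of a generator in `τ(A_n)`. -/
def ToroidalLieAlgebra.of {n N : ℕ} (g : Gen n N) : ToroidalLieAlgebra n N :=
  LieSubmodule.Quotient.mk (gen g)

/-! ### Formal series of operators -/

section Series

variable {V : Type*} [AddCommGroup V] [Module ℂ V] {N : ℕ}

/-- A formal series `A(z) = ∑_m A_m z^{-m}` with coefficients in `End V`; `A m` is `A_m`. -/
abbrev OpSeries (N : ℕ) (V : Type*) [AddCommGroup V] [Module ℂ V] : Type _ :=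
  Idx N → Module.End ℂ V

/-- A family of operators `(B_k)_{k ∈ ι}` such that for every vector `v` only finitely many
`B_k v` are nonzero, encoded by the linear map `v ↦ (k ↦ B_k v)`. -/
abbrev SummableFamily (ι : Type*) (V : Type*) [AddCommGroup V] [Module ℂ V] : Type _ :=
  V →ₗ[ℂ] (ι →₀ V)

/-- A pointwise finite family of operators as a `SummableFamily`. -/
def SummableFamily.ofFinite {ι : Type*} (B : ι → Module.End ℂ V)
    (h : ∀ v, (Function.support fun k => B k v).Finite) : SummableFamily ι V where
  toFun v := Finsupp.ofSupportFinite (fun k => B k v) (h v)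
  map_add' v w := Finsupp.ext fun k => map_add (B k) v w
  map_smul' c v := Finsupp.ext fun k => map_smul (B k) c v

/-- The operator `∑_k A_k ∘ B_k`, where `B` is summable and `A` is any family. -/
def SummableFamily.sumComp {ι : Type*} (A : ι → Module.End ℂ V) (B : SummableFamily ι V) :
    Module.End ℂ V :=
  Finsupp.lsum ℂ A ∘ₗ B

/-- The product `A(z) B(z)` of a formal series with a summable series:
`(A B)_m = ∑_k A_{m-k} ∘ B_k`. -/
def OpSeries.mul (A : OpSeries N V) (B : SummableFamily (Idx N) V) : OpSeries N V :=
  fun m => SummableFamily.sumComp (fun k => A (m - k)) B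

/-- The product `A(z) B(z)` of two summable series; it is again summable. -/
def SummableFamily.mul (A B : SummableFamily (Idx N) V) : SummableFamily (Idx N) V :=
  Finsupp.lsum ℂ (fun k => Finsupp.lmapDomain V ℂ (fun l => l + k) ∘ₗ A) ∘ₗ B

/-- The constant series `1`. -/
def SummableFamily.one : SummableFamily (Idx N) V := Finsupp.lsingle 0

/-- The Euler derivative `z_p ∂/∂z_p` of a summable series `∑_q B_q z^{-q}`. -/
def SummableFamily.euler (p : Fin (N + 1)) (B : SummableFamily (Idx N) V) :
    SummableFamily (Idx N) V :=
  Finsupp.lsum ℂ (fun q => (-(q p : ℂ)) • Finsupp.lsingle q) ∘ₗ B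

/-- The scalar series `∑_m κ_{m,p} z^m`; the coefficient of `z^{-m}` is `κ_{-m,p}`. -/
def kappaSeries (κ : Idx N → Fin (N + 1) → ℂ) (p : Fin (N + 1)) : OpSeries N V :=
  fun m => κ (-m) p • LinearMap.id

/-- `κ · D B (z) = ∑_p (∑_m κ_{m,p} z^m) z_p ∂B(z)/∂z_p`. -/
def kappaD (κ : Idx N → Fin (N + 1) → ℂ) (B : SummableFamily (Idx N) V) : OpSeries N V :=
  ∑ p, (kappaSeries κ p).mul (B.euler p)

end Series

/-! ### The polynomial rings and the elementary operators -/

/-- Index set of the variables `x_{ij}(m)`, `0 < i < j ≤ n + 1`. -/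
abbrev XVar (n N : ℕ) : Type :=
  {p : ℕ × ℕ // 0 < p.1 ∧ p.1 < p.2 ∧ p.2 ≤ n + 1} × Idx N

/-- Index set of the variables `y_i(k)`, `1 ≤ i ≤ n`, `k > 0`. -/
abbrev YVar (n : ℕ) {N : ℕ} (S : SignDecomposition N) : Type :=
  {p : ℕ × Idx N // (1 ≤ p.1 ∧ p.1 ≤ n) ∧ p.2 ∈ S.pos}

/-- The ring `ℂ[x]`. -/
abbrev CX (n N : ℕ) : Type := MvPolynomial (XVar n N) ℂ

/-- The ring `ℂ[y]`. -/
abbrev CY (n : ℕ) {N : ℕ} (S : SignDecomposition N) : Type := MvPolynomial (YVar n S) ℂ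

/-- The Fock space `ℂ[x] ⊗ ℂ[y]`. -/
abbrev Fock (n : ℕ) {N : ℕ} (S : SignDecomposition N) : Type := CX n N ⊗[ℂ] CY n S

/-- Multiplication by `x_{ij}(m)` on `ℂ[x]` (`0` unless `0 < i < j ≤ n + 1`). -/
def mulX (n : ℕ) {N : ℕ} (i j : ℕ) (m : Idx N) : Module.End ℂ (CX n N) :=
  if h : 0 < i ∧ i < j ∧ j ≤ n + 1 then
    LinearMap.mulLeft ℂ (MvPolynomial.X (⟨(i, j), h⟩, m))
  else 0

/-- `∂/∂x_{ij}(m)` on `ℂ[x]` (`0` unless `0 < i < j ≤ n + 1`). -/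
def derivX (n : ℕ) {N : ℕ} (i j : ℕ) (m : Idx N) : Module.End ℂ (CX n N) :=
  if h : 0 < i ∧ i < j ∧ j ≤ n + 1 then
    (MvPolynomial.pderiv (R := ℂ) ((⟨(i, j), h⟩, m) : XVar n N)).toLinearMap
  else 0

open Classical in
/-- Multiplication by `y_i(k)` on `ℂ[y]` (`0` unless `1 ≤ i ≤ n` and `k > 0`). -/
def mulY {n N : ℕ} (S : SignDecomposition N) (i : ℕ) (k : Idx N) : Module.End ℂ (CY n S) :=
  if h : (1 ≤ i ∧ i ≤ n) ∧ k ∈ S.pos then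
    LinearMap.mulLeft ℂ (MvPolynomial.X ⟨(i, k), h⟩)
  else 0

open Classical in
/-- `∂/∂y_i(k)` on `ℂ[y]` (`0` unless `1 ≤ i ≤ n` and `k > 0`). -/
def derivY {n N : ℕ} (S : SignDecomposition N) (i : ℕ) (k : Idx N) : Module.End ℂ (CY n S) :=
  if h : (1 ≤ i ∧ i ≤ n) ∧ k ∈ S.pos then
    (MvPolynomial.pderiv (R := ℂ) (⟨(i, k), h⟩ : YVar n S)).toLinearMap
  else 0

theorem derivX_finite {n N : ℕ} (i j : ℕ) (p : CX n N) :
    (Function.support fun m : Idx N => derivX n i j m p).Finite := by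
  by_cases h : 0 < i ∧ i < j ∧ j ≤ n + 1
  · refine Set.Finite.subset (p.vars.finite_toSet.image Prod.snd) fun m hm => ?_
    by_contra hmem
    refine hm ?_
    simp only [derivX, dif_pos h]
    refine MvPolynomial.pderiv_eq_zero_of_notMem_vars fun hv => hmem ⟨_, hv, rfl⟩
  · simp [derivX, dif_neg h]

theorem derivY_finite {n N : ℕ} (S : SignDecomposition N) (i : ℕ) (p : CY n S) :
    (Function.support fun k : Idx N => derivY S i k p).Finite := by
  refine Set.Finite.subset (p.vars.finite_toSet.image fun v => v.1.2) fun k hk => ?_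
  by_contra hmem
  refine hk ?_
  by_cases h : (1 ≤ i ∧ i ≤ n) ∧ k ∈ S.pos
  · simp only [derivY, dif_pos h]
    refine MvPolynomial.pderiv_eq_zero_of_notMem_vars fun hv => hmem ⟨_, hv, rfl⟩
  · simp [derivY, dif_neg h]

/-! ### The toroidal Heisenberg algebra acting on `ℂ[y]` -/

/-- `θ(m)`, equal to `1` if `m > 0` and to `0` otherwise. -/
def theta {N : ℕ} (S : SignDecomposition N) (m : Idx N) : ℂ := S.pos.indicator 1 m

/-- The operator `∑_{s > 0} ∑_p m_p κ_{-m+s,p} ∂/∂y_i(s)` on `ℂ[y]`. -/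
def kappaDerivY {n N : ℕ} (S : SignDecomposition N) (κ : Idx N → Fin (N + 1) → ℂ)
    (i : ℕ) (m : Idx N) : Module.End ℂ (CY n S) :=
  SummableFamily.sumComp (fun s => (∑ p, (m p : ℂ) * κ (-m + s) p) • LinearMap.id)
    (SummableFamily.ofFinite (derivY S i) (derivY_finite S i))

/-- `Φ(b_i(m))` for `1 ≤ i ≤ n`. -/
def heis {n N : ℕ} (S : SignDecomposition N) (κ : Idx N → Fin (N + 1) → ℂ) (lam : ℕ → ℂ)
    (i : ℕ) (m : Idx N) : Module.End ℂ (CY n S) :=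
  theta S (-m) • (kappaDerivY S κ (i - 1) m - kappaDerivY S κ i m)
  + theta S m • (kappaDerivY S κ (i - 1) m - (2 : ℂ) • kappaDerivY S κ i m
      + kappaDerivY S κ (i + 1) m)
  + theta S (-m) • mulY S i (-m)
  - (if m = 0 then lam i else 0) • LinearMap.id

/-- `Φ(b_i(m))` for `0 ≤ i ≤ n`, where `b_0(m) = -∑_{i=1}^n b_i(m)`. -/
def heisAll {n N : ℕ} (S : SignDecomposition N) (κ : Idx N → Fin (N + 1) → ℂ) (lam : ℕ → ℂ)
    (i : ℕ) (m : Idx N) : Module.End ℂ (CY n S) :=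
  if i = 0 then -∑ j ∈ Finset.Icc 1 n, heis S κ lam j m else heis S κ lam i m

/-! ### Fields on the Fock space -/

section Fields

variable (n : ℕ) {N : ℕ} (S : SignDecomposition N)

/-- The series `a_{ij}(z)`, with `a_{ij,m} = -x_{ij}(m)`. -/
def aF (i j : ℕ) : OpSeries N (Fock n S) :=
  fun m => LinearMap.rTensor (CY n S) (-mulX n i j m)

/-- The operators `a^*_{ij,m} = ∂/∂x_{ij}(-m)`. -/
def aStarMode (i j : ℕ) (m : Idx N) : Module.End ℂ (Fock n S) :=
  LinearMap.rTensor (CY n S) (derivX n i j (-m))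

theorem aStarMode_finite (i j : ℕ) (v : Fock n S) :
    (Function.support fun m : Idx N => aStarMode n S i j m v).Finite := by
  induction v using TensorProduct.induction_on with
  | zero => simp
  | tmul p q =>
    refine Set.Finite.subset ((derivX_finite i j p).image Neg.neg) fun m hm => ?_
    refine ⟨-m, fun h0 => hm ?_, neg_neg m⟩
    simp only [aStarMode, LinearMap.rTensor_tmul]
    simp only at h0
    rw [h0, TensorProduct.zero_tmul]
  | add v w hv hw =>
    refine (hv.union hw).subset ?_
    simp only [map_add]
    exact Function.support_add _ _

/-- The summable series `a^*_{ij}(z)`. -/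
def aS (i j : ℕ) : SummableFamily (Idx N) (Fock n S) :=
  SummableFamily.ofFinite (aStarMode n S i j) (aStarMode_finite n S i j)

/-- The series `Φ(b_r)(z)` acting on the Fock space as `1 ⊗ Φ(b_r)`. -/
def PhiF (κ : Idx N → Fin (N + 1) → ℂ) (lam : ℕ → ℂ) (r : ℕ) : OpSeries N (Fock n S) :=
  fun m => LinearMap.lTensor (CX n N) (heisAll S κ lam r m)

/-- `∏_l a^*_{q_l q_{l+1}}(z)` over consecutive entries of a list `q`. -/
def chainProd : List ℕ → SummableFamily (Idx N) (Fock n S)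
  | a :: b :: l => (aS n S a b).mul (chainProd (b :: l))
  | _ => SummableFamily.one

/-- The sequences `1 = q_1 < q_2 < ⋯ < q_i = j`, each given by its set of entries. -/
def chains (j : ℕ) : Finset (Finset ℕ) :=
  (Finset.Icc 1 j).powerset.filter fun s => 1 ∈ s ∧ j ∈ s

/-- `ρ(F_r)(z)` for `1 ≤ r ≤ n`. -/
def rhoFpos (r : ℕ) : OpSeries N (Fock n S) :=
  aF n S r (r + 1) - ∑ j ∈ Finset.Icc 1 (r - 1), (aF n S j (r + 1)).mul (aS n S j r)

variable (κ : Idx N → Fin (N + 1) → ℂ) (lam : ℕ → ℂ)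

/-- `ρ(H_r)(z)` for `1 ≤ r ≤ n`. -/
def rhoHpos (r : ℕ) : OpSeries N (Fock n S) :=
  (2 : ℂ) • (aF n S r (r + 1)).mul (aS n S r (r + 1))
  + ∑ i ∈ Finset.Icc 1 (r - 1),
      ((aF n S i (r + 1)).mul (aS n S i (r + 1)) - (aF n S i r).mul (aS n S i r))
  + ∑ j ∈ Finset.Icc (r + 2) (n + 1),
      ((aF n S r j).mul (aS n S r j) - (aF n S (r + 1) j).mul (aS n S (r + 1) j))
  + PhiF n S κ lam r

/-- `ρ(E_r)(z)` for `1 ≤ r ≤ n`. The factors `a^*` and `Φ(b_r)` commute. -/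
def rhoEpos (r : ℕ) : OpSeries N (Fock n S) :=
  (aF n S r (r + 1)).mul ((aS n S r (r + 1)).mul (aS n S r (r + 1)))
  - ∑ j ∈ Finset.Icc (r + 2) (n + 1), (aF n S (r + 1) j).mul (aS n S r j)
  + ∑ j ∈ Finset.Icc 1 (r - 1), (aF n S j r).mul (aS n S j (r + 1))
  + ∑ j ∈ Finset.Icc (r + 2) (n + 1),
      ((aF n S r j).mul (aS n S r j)
        - (aF n S (r + 1) j).mul (aS n S (r + 1) j)).mul (aS n S r (r + 1))
  + (PhiF n S κ lam r).mul (aS n S r (r + 1))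
  + kappaD κ (aS n S r (r + 1))

/-- `ρ(E_0)(z)`. -/
def rhoE0 : OpSeries N (Fock n S) := -aF n S 1 (n + 1)

/-- `ρ(H_0)(z)`. -/
def rhoH0 : OpSeries N (Fock n S) :=
  -∑ r ∈ Finset.Icc 1 n, (aF n S r (n + 1)).mul (aS n S r (n + 1))
  - ∑ r ∈ Finset.Icc 2 (n + 1), (aF n S 1 r).mul (aS n S 1 r)
  + PhiF n S κ lam 0

/-- `ρ(F_0)(z)`. The sums run over sequences `1 = q_1 < ⋯ < q_i` with `q_{i+1} = n + 1`:
in the first line `q_i = j` and `q_{i-1} ≤ r`, in the second `q_i ≤ r`, in the third `q_i = r`.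
The factors `a^*`, `Φ(b_r)` and `κ·D a^*` commute with each other. -/
def rhoF0 : OpSeries N (Fock n S) :=
  ∑ r ∈ Finset.Icc 1 n, ∑ j ∈ Finset.Icc (r + 1) (n + 1),
      ∑ q ∈ (chains j).filter (fun q => ∀ k ∈ q, k ≠ j → k ≤ r),
        (-aF n S r j).mul ((chainProd n S (q.sort (· ≤ ·))).mul (aS n S r (n + 1)))
  - ∑ r ∈ Finset.Icc 1 n, ∑ t ∈ Finset.Icc 1 r, ∑ q ∈ chains t,
      (PhiF n S κ lam r).mul (chainProd n S (q.sort (· ≤ ·) ++ [n + 1]))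
  - ∑ r ∈ Finset.Icc 1 n, ∑ q ∈ chains r,
      (kappaD κ (aS n S r (n + 1))).mul (chainProd n S (q.sort (· ≤ ·)))

/-- `ρ(E_r)(z)`, `0 ≤ r ≤ n`. -/
def rhoE (r : Fin (n + 1)) : OpSeries N (Fock n S) :=
  if r = 0 then rhoE0 n S else rhoEpos n S κ lam r

/-- `ρ(F_r)(z)`, `0 ≤ r ≤ n`. -/
def rhoF (r : Fin (n + 1)) : OpSeries N (Fock n S) :=
  if r = 0 then rhoF0 n S κ lam else rhoFpos n S r

/-- `ρ(H_r)(z)`, `0 ≤ r ≤ n`. -/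
def rhoH (r : Fin (n + 1)) : OpSeries N (Fock n S) :=
  if r = 0 then rhoH0 n S κ lam else rhoHpos n S κ lam r

end Fields

end

end Toroidal

/-!
`ρ` is a free field realization of the affinization of `sl_{n+1}` on the big cell of the flag
variety `B₋ \ GL_{n+1}`, that is on the group of upper unitriangular matrices `U`, whose entry
`(i, j)` is the field `-a^*_{ij}(z)`. A matrix `M` acts there by the vector field
`P_M U = (U M U⁻¹)_+ U`, where `_+` is the strictly upper triangular part. Its current is `P_M` with
`∂/∂a^*_{ij}` replaced by `a_{ij}`, plus the diagonal entries of `-U M U⁻¹` times Heisenberg fields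
`Ψ_b` with `Ψ_r - Ψ_{r+1} = Φ(b_r)`, plus the one-form `-tr(M U⁻¹ dU)` with `d` replaced by `κ · D`.

The products `f(a^*) a_{ij}` are normally ordered, so the bracket of two currents consists of the
Lie bracket of vector fields and, from `κ · D`, of the Dorfman bracket on one-forms together with a
term in `∑_p m_p κ_{·,p}`. The first is an infinitesimal group action. In the others, the
contributions of the strictly upper triangular and of the diagonal part of `U M U⁻¹` add up to the
invariant form `tr(X Y)`; this is why the Gram matrix of the `Ψ_b` has to be the identity up to
terms that depend on one index only and so vanish on traceless matrices.

The relations of `τ(A_n)` then hold because they hold for the matrix units next to the diagonal,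
taken cyclically. The sums over sequences `q` in `ρ(F_0)` are entries of `U⁻¹`, expanded as a
geometric series in the strictly upper triangular matrix `1 - U`.
-/

namespace Toroidal

open MvPolynomial

noncomputable section

/-! ### Formal series of operators -/

section Series

variable {V : Type*} [AddCommGroup V] [Module ℂ V] {N : ℕ}

theorem lsum_comp_lmapDomain_add (A : OpSeries N V) (m k : Idx N) :
    Finsupp.lsum ℂ (fun l => A (m - l)) ∘ₗ Finsupp.lmapDomain V ℂ (fun l => l + k)
      = Finsupp.lsum ℂ (fun l => A (m - k - l)) := by
  refine Finsupp.lhom_ext fun l v => ?_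
  simp [sub_sub, add_comm]

theorem OpSeries.mul_assoc (A : OpSeries N V) (B C : SummableFamily (Idx N) V) :
    (A.mul B).mul C = A.mul (B.mul C) := by
  funext m
  have h : Finsupp.lsum ℂ (fun k => (A.mul B) (m - k)) = Finsupp.lsum ℂ (fun l => A (m - l)) ∘ₗ
      Finsupp.lsum ℂ fun k => Finsupp.lmapDomain V ℂ (fun l => l + k) ∘ₗ B := by
    refine Finsupp.lhom_ext fun k v => ?_
    rw [LinearMap.comp_apply, Finsupp.lsum_single, Finsupp.lsum_single, OpSeries.mul,
      SummableFamily.sumComp, ← lsum_comp_lmapDomain_add]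
    rfl
  exact congrArg (fun f : (Idx N →₀ V) →ₗ[ℂ] V => f ∘ₗ C) h

theorem OpSeries.mul_one (A : OpSeries N V) : A.mul SummableFamily.one = A := by
  funext m
  ext v
  simp [OpSeries.mul, SummableFamily.sumComp, SummableFamily.one]

theorem OpSeries.mul_zero (A : OpSeries N V) : A.mul 0 = 0 := by
  funext m
  exact LinearMap.comp_zero _

theorem OpSeries.mul_add (A : OpSeries N V) (B C : SummableFamily (Idx N) V) :
    A.mul (B + C) = A.mul B + A.mul C := by
  funext m
  exact LinearMap.comp_add _ _ _

theorem OpSeries.mul_smul (A : OpSeries N V) (c : ℂ) (B : SummableFamily (Idx N) V) :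
    A.mul (c • B) = c • A.mul B := by
  funext m
  exact LinearMap.comp_smul _ _ _

theorem SummableFamily.mul_apply_apply (A B : SummableFamily (Idx N) V) (v : V) (m : Idx N) :
    A.mul B v m = ∑ᶠ k, A (B v k) (m - k) := by
  rw [finsum_eq_sum_of_support_subset (s := (B v).support)]
  · simp only [SummableFamily.mul, LinearMap.comp_apply, Finsupp.lsum_apply, Finsupp.sum,
      Finsupp.finsetSum_apply, Finsupp.lmapDomain_apply]
    refine Finset.sum_congr rfl fun k _ => ?_
    simpa using Finsupp.mapDomain_apply (add_left_injective k) (A (B v k)) (m - k)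
  · intro k hk
    contrapose! hk
    simp [Finsupp.notMem_support_iff.1 hk]

theorem SummableFamily.mul_comm_of_commute {A B : SummableFamily (Idx N) V}
    (h : ∀ k l v, A (B v l) k = B (A v k) l) : A.mul B = B.mul A := by
  ext v m
  rw [mul_apply_apply, mul_apply_apply, ← finsum_comp_equiv (Equiv.subLeft m)]
  simp [h]

theorem SummableFamily.euler_apply_apply (p : Fin (N + 1)) (B : SummableFamily (Idx N) V) (v : V)
    (k : Idx N) : B.euler p v k = -(k p : ℂ) • B v k := by
  have h (w : Idx N →₀ V) :
      (Finsupp.lsum ℂ (fun q : Idx N => -(q p : ℂ) • Finsupp.lsingle q) : Module.End ℂ _) w k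
        = -(k p : ℂ) • w k := by
    induction w using Finsupp.induction_linear with
    | zero => simp
    | add a b ha hb => rw [map_add, Finsupp.add_apply, ha, hb, Finsupp.add_apply, smul_add]
    | single s x =>
      rcases eq_or_ne s k with rfl | hs
      · simp
      · simp [hs]
  exact h (B v)

/-- The operator `A ↦ A B` on formal series. -/
def OpSeries.mulRight (B : SummableFamily (Idx N) V) : Module.End ℂ (OpSeries N V) where
  toFun A := A.mul B
  map_add' A A' := by
    funext m
    exact (congrArg (fun f : (Idx N →₀ V) →ₗ[ℂ] V => f ∘ₗ B) (map_add (Finsupp.lsum ℂ)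
      (fun k => A (m - k)) fun k => A' (m - k))).trans (LinearMap.add_comp _ _ _)
  map_smul' c A := by
    funext m
    exact (congrArg (fun f : (Idx N →₀ V) →ₗ[ℂ] V => f ∘ₗ B) (map_smul (Finsupp.lsum ℂ) c
      fun k => A (m - k))).trans (LinearMap.smul_comp _ _ _)

theorem OpSeries.mulRight_apply (B : SummableFamily (Idx N) V) (A : OpSeries N V) :
    mulRight B A = A.mul B := rfl

theorem OpSeries.mulRight_commute {B C : SummableFamily (Idx N) V}
    (h : ∀ k l v, B (C v l) k = C (B v k) l) : Commute (mulRight B) (mulRight C) :=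
  LinearMap.ext fun A =>
    (A.mul_assoc C B).trans ((congrArg A.mul (SummableFamily.mul_comm_of_commute h)).symm.trans
      (A.mul_assoc B C).symm)

/-- `z_p ∂/∂z_p` on formal series. -/
def eulerSeries (p : Fin (N + 1)) : Module.End ℂ (OpSeries N V) where
  toFun A := fun m => -(m p : ℂ) • A m
  map_add' A B := by funext m; simp
  map_smul' c A := by funext m; simp [smul_comm c]

theorem eulerSeries_apply (p : Fin (N + 1)) (A : OpSeries N V) (m : Idx N) :
    eulerSeries p A m = -(m p : ℂ) • A m := rfl

theorem eulerSeries_mul (p : Fin (N + 1)) (A : OpSeries N V) (B : SummableFamily (Idx N) V) :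
    eulerSeries p (A.mul B) = (eulerSeries p A).mul B + A.mul (B.euler p) := by
  funext m
  have h : -(m p : ℂ) • Finsupp.lsum ℂ (fun k => A (m - k))
      = Finsupp.lsum ℂ (fun k => eulerSeries p A (m - k))
        + Finsupp.lsum ℂ (fun k => A (m - k)) ∘ₗ
          Finsupp.lsum ℂ (fun q : Idx N => -(q p : ℂ) • Finsupp.lsingle (M := V) q) := by
    refine Finsupp.lhom_ext fun k v => ?_
    simp only [eulerSeries_apply, LinearMap.smul_apply, LinearMap.add_apply, LinearMap.comp_apply,
      Finsupp.lsum_single, Finsupp.lsingle_apply, map_smul, ← add_smul]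
    congr 1
    push_cast [Pi.sub_apply]
    ring
  exact congrArg (· ∘ₗ B) h

/-- The operator `A(z) ↦ z^{-k} [T, A(z)]` on formal series, `A ↦ (m ↦ [T, A_{m-k}])`. -/
def adShift (T : Module.End ℂ V) (k : Idx N) : Module.End ℂ (OpSeries N V) where
  toFun A := fun m => ⁅T, A (m - k)⁆
  map_add' A B := by funext m; simp
  map_smul' c A := by funext m; simp

theorem adShift_apply (T : Module.End ℂ V) (k m : Idx N) (A : OpSeries N V) :
    adShift T k A m = ⁅T, A (m - k)⁆ := rfl

theorem adShift_eulerSeries (T : Module.End ℂ V) (k : Idx N) (p : Fin (N + 1))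
    (A : OpSeries N V) :
    adShift T k (eulerSeries p A) = eulerSeries p (adShift T k A) + (k p : ℂ) • adShift T k A := by
  funext m
  simp only [adShift_apply, eulerSeries_apply, Pi.add_apply, Pi.smul_apply, lie_smul, ← add_smul]
  congr 1
  simp [neg_add_eq_sub]

theorem lie_sumComp {ι : Type*} (T : Module.End ℂ V) (A : ι → Module.End ℂ V)
    (B : SummableFamily ι V) :
    ⁅T, SummableFamily.sumComp A B⁆ = SummableFamily.sumComp (fun k => ⁅T, A k⁆) B
      + SummableFamily.sumComp A (Finsupp.mapRange.linearMap T ∘ₗ B - B ∘ₗ T) := by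
  have h : T ∘ₗ Finsupp.lsum ℂ A = Finsupp.lsum ℂ (fun k => ⁅T, A k⁆)
      + Finsupp.lsum ℂ A ∘ₗ Finsupp.mapRange.linearMap T := by
    refine Finsupp.lhom_ext fun k v => ?_
    simp [LieRing.of_associative_ring_bracket]
  simp only [SummableFamily.sumComp, LieRing.of_associative_ring_bracket, Module.End.mul_eq_comp,
    LinearMap.comp_sub, ← LinearMap.comp_assoc, h, LinearMap.add_comp] at h ⊢
  abel

theorem adShift_mul {T : Module.End ℂ V} {k : Idx N} {B C : SummableFamily (Idx N) V}
    (h : ∀ v m, C v m = T (B v (m - k)) - B (T v) (m - k)) (A : OpSeries N V) :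
    adShift T k (A.mul B) = (adShift T k A).mul B + A.mul C := by
  have hC : C = Finsupp.lmapDomain V ℂ (fun l => l + k) ∘ₗ
      (Finsupp.mapRange.linearMap T ∘ₗ B - B ∘ₗ T) := by
    ext v m
    have := Finsupp.mapDomain_apply (add_left_injective k)
      (Finsupp.mapRange.linearMap T (B v) - B (T v)) (m - k)
    rw [sub_add_cancel] at this
    simpa [h] using this.symm
  funext m
  rw [adShift_apply, OpSeries.mul, lie_sumComp, hC, Pi.add_apply]
  refine congrArg₂ _ (congrArg (· ∘ₗ B) (congrArg _ (funext fun l => ?_))) ?_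
  · rw [adShift_apply, sub_right_comm]
  · simp only [OpSeries.mul, SummableFamily.sumComp, ← LinearMap.comp_assoc,
      lsum_comp_lmapDomain_add]

end Series

section EvalComm

variable {R σ A : Type*} [CommRing R] [Ring A] [Algebra R A]

open scoped IsMulCommutative in
/-- Evaluation of polynomials at a family `s` of pairwise commuting elements of an algebra. -/
def aevalOfCommute (s : σ → A) (h : ∀ i j, Commute (s i) (s j)) : MvPolynomial σ R →ₐ[R] A :=
  have : IsMulCommutative (Algebra.adjoin R (Set.range s)) :=
    Algebra.isMulCommutative_adjoin R (by rintro _ ⟨i, rfl⟩ _ ⟨j, rfl⟩; exact h i j)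
  (Algebra.adjoin R (Set.range s)).val.comp
    (aeval fun i => ⟨s i, Algebra.subset_adjoin ⟨i, rfl⟩⟩)

theorem aevalOfCommute_X (s : σ → A) (h : ∀ i j, Commute (s i) (s j)) (i : σ) :
    aevalOfCommute (R := R) s h (X i) = s i := by
  simp [aevalOfCommute]

end EvalComm

/-- A family of summable series with commuting modes. -/
class CommutingFields (σ : outParam Type*) (N : ℕ) (V : Type*) [AddCommGroup V] [Module ℂ V] where
  field : σ → SummableFamily (Idx N) V
  commute : ∀ (α β : σ) (k l : Idx N) (v : V),
    field α (field β v l) k = field β (field α v k) l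

section Currents

variable {σ V : Type*} [AddCommGroup V] [Module ℂ V] {N : ℕ} [CommutingFields σ N V]

/-- The action on formal series of polynomials in the commuting fields, by multiplication on the
right. -/
def fieldAction : MvPolynomial σ ℂ →ₐ[ℂ] Module.End ℂ (OpSeries N V) :=
  aevalOfCommute (fun α => OpSeries.mulRight (CommutingFields.field α))
    fun α β => OpSeries.mulRight_commute (CommutingFields.commute α β)

instance : Module (MvPolynomial σ ℂ) (OpSeries N V) :=
  Module.compHom _ (fieldAction (σ := σ) (N := N) (V := V)).toRingHom

instance : IsScalarTower ℂ (MvPolynomial σ ℂ) (OpSeries N V) where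
  smul_assoc c f A := LinearMap.congr_fun (map_smul (fieldAction (N := N) (V := V)) c f) A

theorem X_smul (α : σ) (A : OpSeries N V) :
    (X α : MvPolynomial σ ℂ) • A = A.mul (CommutingFields.field α) :=
  LinearMap.congr_fun (aevalOfCommute_X _
    (fun α β => OpSeries.mulRight_commute (CommutingFields.commute α β)) α) A

theorem exists_smul_eq_mul (f : MvPolynomial σ ℂ) :
    ∃ B : SummableFamily (Idx N) V, ∀ A : OpSeries N V, f • A = A.mul B := by
  induction f using MvPolynomial.induction_on with
  | C c =>
    refine ⟨c • SummableFamily.one, fun A => ?_⟩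
    rw [OpSeries.mul_smul, OpSeries.mul_one, C_eq_smul_one, smul_assoc, one_smul]
  | add f g hf hg =>
    obtain ⟨B, hB⟩ := hf
    obtain ⟨C, hC⟩ := hg
    exact ⟨B + C, fun A => by rw [add_smul, hB, hC, OpSeries.mul_add]⟩
  | mul_X f α hf =>
    obtain ⟨B, hB⟩ := hf
    exact ⟨(CommutingFields.field α).mul B, fun A => by
      rw [mul_smul, X_smul, hB, OpSeries.mul_assoc]⟩

/-- The constant series `1`. -/
def OpSeries.one : OpSeries N V := Pi.single 0 LinearMap.id

/-- The series of operators represented by a polynomial in the fields. -/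
def modes (f : MvPolynomial σ ℂ) : OpSeries N V := f • OpSeries.one

theorem OpSeries.one_mul_apply (B : SummableFamily (Idx N) V) (s : Idx N) (v : V) :
    OpSeries.one.mul B s v = B v s := by
  change (B v).sum (fun k w => OpSeries.one (s - k) w) = B v s
  rw [Finsupp.sum_eq_single s]
  · simp [OpSeries.one]
  · intro k _ hk
    simp [OpSeries.one, sub_eq_zero, hk.symm]
  · simp

theorem modes_apply {f : MvPolynomial σ ℂ} {B : SummableFamily (Idx N) V}
    (hB : ∀ A : OpSeries N V, f • A = A.mul B) (s : Idx N) (v : V) :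
    modes f s v = B v s := by
  rw [modes, hB, OpSeries.one_mul_apply]

theorem smul_modes (f g : MvPolynomial σ ℂ) : f • modes (N := N) (V := V) g = modes (g * f) := by
  rw [modes, modes, smul_smul, mul_comm]

theorem modes_add (f g : MvPolynomial σ ℂ) :
    modes (N := N) (V := V) (f + g) = modes f + modes g := add_smul f g _

theorem modes_zero : modes (N := N) (V := V) (0 : MvPolynomial σ ℂ) = 0 := zero_smul _ _

theorem modes_sum {ι : Type*} (s : Finset ι) (f : ι → MvPolynomial σ ℂ) :
    modes (N := N) (V := V) (∑ i ∈ s, f i) = ∑ i ∈ s, modes (f i) := Finset.sum_smul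

theorem modes_X (α : σ) (s : Idx N) (v : V) :
    modes (X α : MvPolynomial σ ℂ) s v = CommutingFields.field α v s :=
  modes_apply (X_smul α) s v

theorem modes_C (c : ℂ) (s : Idx N) :
    modes (V := V) (C c : MvPolynomial σ ℂ) s = if s = 0 then c • LinearMap.id else 0 := by
  rw [modes, C_eq_smul_one, smul_assoc, one_smul, Pi.smul_apply, OpSeries.one, Pi.single_apply,
    smul_ite, smul_zero]

/-- `T` acts on polynomials in the fields as the derivation `δ` with degree shift `k`:
`[T, f_s] = (δ f)_{s+k}`. -/
def Implements (T : Module.End ℂ V) (k : Idx N)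
    (δ : Derivation ℂ (MvPolynomial σ ℂ) (MvPolynomial σ ℂ)) : Prop :=
  ∀ (f : MvPolynomial σ ℂ) (s : Idx N), ⁅T, modes (V := V) f s⁆ = modes (δ f) (s + k)

theorem adShift_smul_of_lie_modes {T : Module.End ℂ V} {k : Idx N} {f g : MvPolynomial σ ℂ}
    (h : ∀ s : Idx N, ⁅T, modes (V := V) f s⁆ = modes g (s + k)) (A : OpSeries N V) :
    adShift T k (f • A) = f • adShift T k A + g • A := by
  obtain ⟨B, hB⟩ := exists_smul_eq_mul (N := N) (V := V) f
  obtain ⟨C, hC⟩ := exists_smul_eq_mul (N := N) (V := V) g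
  rw [hB, hB, hC]
  refine adShift_mul (fun v m => ?_) A
  rw [← modes_apply hC, ← modes_apply hB, ← modes_apply hB, ← sub_add_cancel m k, ← h,
    sub_add_cancel]
  rfl

theorem adShift_smul {T : Module.End ℂ V} {k : Idx N}
    {δ : Derivation ℂ (MvPolynomial σ ℂ) (MvPolynomial σ ℂ)} (h : Implements T k δ)
    (f : MvPolynomial σ ℂ) (A : OpSeries N V) :
    adShift T k (f • A) = f • adShift T k A + δ f • A :=
  adShift_smul_of_lie_modes (h f) A

theorem implements_of_X {T : Module.End ℂ V} {k : Idx N}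
    {δ : Derivation ℂ (MvPolynomial σ ℂ) (MvPolynomial σ ℂ)}
    (h : ∀ (α : σ) (s : Idx N), ⁅T, modes (V := V) (X α) s⁆ = modes (δ (X α)) (s + k)) :
    Implements T k δ := by
  suffices h' : ∀ f, adShift T k (modes (V := V) f) = modes (δ f) from fun f s => by
    rw [← h', adShift_apply, add_sub_cancel_right]
  intro f
  induction f using MvPolynomial.induction_on with
  | C c =>
    funext m
    rw [adShift_apply, modes_C, derivation_C, modes_zero]
    split_ifs <;> simp [LieRing.of_associative_ring_bracket, Module.End.mul_eq_comp]
  | add f g hf hg => rw [modes_add, map_add, hf, hg, map_add, modes_add]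
  | mul_X f α hf =>
    rw [← smul_modes, adShift_smul_of_lie_modes (h α), hf, smul_modes, smul_modes, ← modes_add,
      Derivation.leibniz, smul_eq_mul, smul_eq_mul, add_comm, mul_comm (δ f)]

theorem modes_lie_modes (f g : MvPolynomial σ ℂ) (s t : Idx N) :
    ⁅modes (V := V) f s, modes (V := V) g t⁆ = 0 := by
  have h_of_X (f : MvPolynomial σ ℂ) (s : Idx N)
      (h : ∀ (α : σ) (t : Idx N), ⁅modes (V := V) f s, modes (V := V) (X α) t⁆ = 0)
      (g : MvPolynomial σ ℂ) (t : Idx N) :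
      ⁅modes (V := V) f s, modes (V := V) g t⁆ = 0 := by
    have himp : Implements (V := V) (modes f s) s 0 := implements_of_X fun α t => by
      rw [h, Derivation.coe_zero, Pi.zero_apply, modes_zero, Pi.zero_apply]
    rw [himp g t, Derivation.coe_zero, Pi.zero_apply, modes_zero, Pi.zero_apply]
  have h_X (α β : σ) (s t : Idx N) :
      ⁅modes (V := V) (X α) s, modes (V := V) (X β) t⁆ = 0 := by
    ext v
    simp [LieRing.of_associative_ring_bracket, modes_X, CommutingFields.commute α β]
  refine h_of_X f s (fun α t => ?_) g t
  rw [← lie_skew, h_of_X _ _ (h_X α · t), neg_zero]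

theorem implements_modes (f : MvPolynomial σ ℂ) (s : Idx N) :
    Implements (V := V) (modes f s) s 0 := fun g t => by
  rw [modes_lie_modes, Derivation.coe_zero, Pi.zero_apply, modes_zero, Pi.zero_apply]

theorem eulerSeries_smul_smul (p : Fin (N + 1)) (f g : MvPolynomial σ ℂ) (A : OpSeries N V) :
    eulerSeries p ((f * g) • A) + (f * g) • eulerSeries p A
      = f • eulerSeries p (g • A) + g • eulerSeries p (f • A) := by
  obtain ⟨B, hB⟩ := exists_smul_eq_mul (N := N) (V := V) f
  obtain ⟨C, hC⟩ := exists_smul_eq_mul (N := N) (V := V) g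
  have hcomm (k l : Idx N) (v : V) : B (C v l) k = C (B v k) l := by
    have := LinearMap.congr_fun (modes_lie_modes (V := V) f g k l) v
    rw [LieRing.of_associative_ring_bracket, LinearMap.sub_apply, Module.End.mul_apply,
      Module.End.mul_apply] at this
    simpa only [modes_apply hB, modes_apply hC, LinearMap.zero_apply, sub_eq_zero] using this
  have hswap : (A.mul C).mul (B.euler p) = (A.mul (B.euler p)).mul C := by
    rw [OpSeries.mul_assoc, OpSeries.mul_assoc, SummableFamily.mul_comm_of_commute]
    intro k l v
    rw [SummableFamily.euler_apply_apply, SummableFamily.euler_apply_apply, map_smul, hcomm,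
      Finsupp.smul_apply]
  rw [mul_smul, mul_comm f g, mul_smul]
  simp only [hB, hC, eulerSeries_mul]
  rw [hswap]
  simp only [← OpSeries.mulRight_apply, map_add]
  abel

end Currents

section KappaDerivation

variable {σ V : Type*} [AddCommGroup V] [Module ℂ V] {N : ℕ} [CommutingFields σ N V]
  {κ : Idx N → Fin (N + 1) → ℂ}

/-- The scalar series `∑_p k_p ∑_m κ_{m,p} z^m`. -/
def kappaDot (κ : Idx N → Fin (N + 1) → ℂ) (k : Idx N) : OpSeries N V :=
  ∑ p, (k p : ℂ) • kappaSeries κ p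

theorem kappaDot_apply (κ : Idx N → Fin (N + 1) → ℂ) (k m : Idx N) :
    kappaDot (V := V) κ k m = (∑ p, (k p : ℂ) * κ (-m) p) • LinearMap.id := by
  simp [kappaDot, kappaSeries, Finset.sum_apply, Finset.sum_smul, mul_smul]

theorem kappaDot_add (κ : Idx N → Fin (N + 1) → ℂ) (k l : Idx N) :
    kappaDot (V := V) κ (k + l) = kappaDot κ k + kappaDot κ l := by
  simp [kappaDot, add_smul, Finset.sum_add_distrib]

theorem kappaDot_sub (κ : Idx N → Fin (N + 1) → ℂ) (k l : Idx N) :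
    kappaDot (V := V) κ (k - l) = kappaDot κ k - kappaDot κ l := by
  rw [eq_sub_iff_add_eq, ← kappaDot_add, sub_add_cancel]

theorem sum_eulerSeries_kappaSeries (hκ : ∀ m : Idx N, ∑ p, (m p : ℂ) * κ m p = 0) :
    ∑ p, eulerSeries p (kappaSeries (V := V) κ p) = 0 := by
  funext m
  have h := hκ (-m)
  simp only [Pi.neg_apply, Int.cast_neg] at h
  simp only [Finset.sum_apply, eulerSeries_apply, kappaSeries, smul_smul, ← Finset.sum_smul, h,
    zero_smul, Pi.zero_apply]

/-- The derivation `f ↦ κ · D f` from polynomials in the fields to formal series: the sum over `p`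
of the commutators of `z_p ∂/∂z_p` with `f`, applied to `∑_m κ_{m,p} z^m`. -/
def kappaDerivation (κ : Idx N → Fin (N + 1) → ℂ) :
    Derivation ℂ (MvPolynomial σ ℂ) (OpSeries N V) :=
  Derivation.mk'
    { toFun := fun f =>
        ∑ p, (eulerSeries p (f • kappaSeries κ p) - f • eulerSeries p (kappaSeries κ p))
      map_add' := fun f g => by
        simp only [add_smul, map_add, ← Finset.sum_add_distrib]
        exact Finset.sum_congr rfl fun p _ => by abel
      map_smul' := fun c f => by
        simp only [smul_assoc, map_smul, Finset.smul_sum, smul_sub, RingHom.id_apply] }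
    fun f g => by
      simp only [LinearMap.coe_mk, AddHom.coe_mk, Finset.smul_sum, ← Finset.sum_add_distrib]
      refine Finset.sum_congr rfl fun p _ => ?_
      rw [eq_sub_of_add_eq (eulerSeries_smul_smul p f g (kappaSeries κ p)), smul_sub, smul_sub,
        smul_smul, smul_smul, mul_comm g f]
      abel

theorem kappaDerivation_apply (f : MvPolynomial σ ℂ) :
    kappaDerivation (V := V) κ f
      = ∑ p, (eulerSeries p (f • kappaSeries κ p) - f • eulerSeries p (kappaSeries κ p)) := rfl

theorem smul_kappaDot_apply (hκ : ∀ m : Idx N, ∑ p, (m p : ℂ) * κ m p = 0)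
    (f : MvPolynomial σ ℂ) (m : Idx N) :
    (f • kappaDot (V := V) κ m) m = -kappaDerivation κ f m := by
  rw [kappaDerivation_apply, Finset.sum_sub_distrib, ← Finset.smul_sum,
    sum_eulerSeries_kappaSeries hκ, smul_zero, sub_zero, kappaDot, Finset.smul_sum]
  simp only [Finset.sum_apply, eulerSeries_apply, ← Finset.sum_neg_distrib, neg_smul, neg_neg,
    smul_comm f, Pi.smul_apply]

theorem adShift_kappaSeries (T : Module.End ℂ V) (k : Idx N) (p : Fin (N + 1)) :
    adShift T k (kappaSeries κ p) = 0 := by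
  funext m
  rw [adShift_apply, kappaSeries, lie_smul, LieRing.of_associative_ring_bracket]
  exact (congrArg _ (sub_self T)).trans (smul_zero _)

theorem adShift_kappaDerivation {T : Module.End ℂ V} {k : Idx N}
    {δ : Derivation ℂ (MvPolynomial σ ℂ) (MvPolynomial σ ℂ)} (h : Implements T k δ)
    (f : MvPolynomial σ ℂ) :
    adShift T k (kappaDerivation κ f) = kappaDerivation κ (δ f) + δ f • kappaDot κ k := by
  simp only [kappaDerivation_apply, map_sum, map_sub, adShift_eulerSeries, adShift_smul h,
    adShift_kappaSeries, smul_zero, zero_add, map_zero, kappaDot, Finset.smul_sum,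
    ← Finset.sum_add_distrib]
  refine Finset.sum_congr rfl fun p _ => ?_
  rw [smul_comm (δ f)]
  abel

end KappaDerivation

/-! ### Free fields and currents -/

section Dorfman

theorem derivation_eq_sum_pderiv_smul {σ R M : Type*} [CommRing R] [AddCommGroup M] [Module R M]
    [Module (MvPolynomial σ R) M] [Fintype σ] (P : Derivation R (MvPolynomial σ R) M)
    (f : MvPolynomial σ R) : P f = ∑ α, pderiv α f • P (X α) := by
  classical
  induction f using MvPolynomial.induction_on with
  | C c => simp
  | add f g hf hg => simp only [map_add, hf, hg, add_smul, Finset.sum_add_distrib]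
  | mul_X f β hf =>
    simp [hf, Derivation.leibniz, pderiv_X, add_smul, Finset.sum_add_distrib, Finset.smul_sum,
      mul_smul, Pi.single_apply, ite_smul]

/-- Free fields: `a_α` conjugate to the commuting fields, and Heisenberg fields `Ψ_b` with Gram
matrix `-B` and level `κ`. -/
structure FreeFields {σ V : Type*} [AddCommGroup V] [Module ℂ V] {N : ℕ} [CommutingFields σ N V]
    (κ : Idx N → Fin (N + 1) → ℂ) {I : Type*} (a : σ → OpSeries N V) (Ψ : I → OpSeries N V)
    (B : I → I → ℂ) : Prop where
  kappa : ∀ m : Idx N, ∑ p, (m p : ℂ) * κ m p = 0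
  implements_a : ∀ α m, Implements (a α m) m (pderiv α)
  a_a : ∀ α β m k, ⁅a α m, a β k⁆ = 0
  a_psi : ∀ α b m k, ⁅a α m, Ψ b k⁆ = 0
  implements_psi : ∀ b m, Implements (Ψ b m) m 0
  psi_psi : ∀ b c m k, ⁅Ψ b m, Ψ c k⁆ = (-B b c) • kappaDot κ m (m + k)

variable {σ V : Type*} [AddCommGroup V] [Module ℂ V] {N : ℕ} [CommutingFields σ N V]

theorem adShift_swap_apply (A B : OpSeries N V) (k m : Idx N) :
    adShift (A k) k B m = -adShift (B (m - k)) (m - k) A m := by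
  rw [adShift_apply, adShift_apply, sub_sub_cancel, lie_skew]

variable {κ : Idx N → Fin (N + 1) → ℂ} {I : Type*} {a : σ → OpSeries N V} {Ψ : I → OpSeries N V}
  {B : I → I → ℂ}

namespace FreeFields

theorem adShift_modes_a (h : FreeFields κ a Ψ B) (p : MvPolynomial σ ℂ) (s : Idx N) (α : σ) :
    adShift (modes p s) s (a α) = -modes (pderiv α p) := by
  funext m
  rw [adShift_apply, ← lie_skew, h.implements_a α (m - s) p s, add_sub_cancel, Pi.neg_apply]

theorem adShift_modes_psi (h : FreeFields κ a Ψ B) (p : MvPolynomial σ ℂ) (s : Idx N) (b : I) :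
    adShift (modes p s) s (Ψ b) = 0 := by
  funext m
  rw [adShift_apply, ← lie_skew, h.implements_psi b (m - s) p s, Derivation.coe_zero,
    Pi.zero_apply, modes_zero, Pi.zero_apply, neg_zero, Pi.zero_apply]

theorem adShift_a_a (h : FreeFields κ a Ψ B) (α β : σ) (k : Idx N) :
    adShift (a α k) k (a β) = 0 :=
  funext fun _ => h.a_a _ _ _ _

theorem adShift_a_psi (h : FreeFields κ a Ψ B) (α : σ) (b : I) (k : Idx N) :
    adShift (a α k) k (Ψ b) = 0 :=
  funext fun _ => h.a_psi _ _ _ _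

theorem adShift_psi_a (h : FreeFields κ a Ψ B) (b : I) (α : σ) (k : Idx N) :
    adShift (Ψ b k) k (a α) = 0 := by
  funext m
  rw [adShift_swap_apply, h.adShift_a_psi, Pi.zero_apply, neg_zero]

theorem adShift_psi_psi (h : FreeFields κ a Ψ B) (b c : I) (k : Idx N) :
    adShift (Ψ b k) k (Ψ c) = (-B b c) • kappaDot κ k := by
  funext m
  rw [adShift_apply, h.psi_psi, add_sub_cancel, Pi.smul_apply]

end FreeFields

variable [Fintype σ] [Fintype I] {ι : Type*} [Fintype ι]
  (P P' : Derivation ℂ (MvPolynomial σ ℂ) (MvPolynomial σ ℂ)) (ζ ζ' : I → MvPolynomial σ ℂ)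
  (f g f' g' : ι → MvPolynomial σ ℂ)

/-- The current `∑ P(u_α) a_α + ∑ ζ_b Ψ_b + ∑ f_i κ·D g_i` with vector field part `P`, Heisenberg
part `ζ` and one-form part `∑ f_i dg_i`. -/
def current (κ : Idx N → Fin (N + 1) → ℂ) (a : σ → OpSeries N V) (Ψ : I → OpSeries N V)
    (P : Derivation ℂ (MvPolynomial σ ℂ) (MvPolynomial σ ℂ)) (ζ : I → MvPolynomial σ ℂ)
    (f g : ι → MvPolynomial σ ℂ) : OpSeries N V :=
  ∑ α, P (X α) • a α + ∑ b, ζ b • Ψ b + ∑ i, f i • kappaDerivation κ (g i)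

theorem Implements.adShift_current {T : Module.End ℂ V} {k : Idx N}
    {δ : Derivation ℂ (MvPolynomial σ ℂ) (MvPolynomial σ ℂ)} (hT : Implements T k δ) :
    adShift T k (current κ a Ψ P ζ f g)
      = ∑ α, (P (X α) • adShift T k (a α) + δ (P (X α)) • a α)
        + ∑ b, (ζ b • adShift T k (Ψ b) + δ (ζ b) • Ψ b)
        + ∑ i, (f i • (kappaDerivation κ (δ (g i)) + δ (g i) • kappaDot κ k)
          + δ (f i) • kappaDerivation κ (g i)) := by
  simp only [current, map_add, map_sum, adShift_smul hT, adShift_kappaDerivation hT]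

namespace FreeFields

variable (h : FreeFields κ a Ψ B)
include h

theorem implements_current (k : Idx N) : Implements (current κ a Ψ P ζ f g k) k P := by
  intro p s
  have hp : adShift (modes p s) s (current κ a Ψ P ζ f g) = -modes (P p) := by
    rw [(implements_modes p s).adShift_current, derivation_eq_sum_pderiv_smul P, modes_sum]
    simp [h.adShift_modes_a, h.adShift_modes_psi, smul_modes]
  have hpk := congrFun hp (k + s)
  rw [adShift_apply, add_sub_cancel_right, Pi.neg_apply] at hpk
  rw [← lie_skew, hpk, neg_neg, add_comm]

theorem adShift_current_psi (k : Idx N) (c : I) :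
    adShift (current κ a Ψ P ζ f g k) k (Ψ c)
      = -∑ b, B c b • (ζ b • kappaDot κ k + kappaDerivation κ (ζ b)) := by
  funext m
  have hζ (b : I) : (ζ b • (-B c b) • kappaDot κ (m - k) : OpSeries N V) m
      = (B c b • (ζ b • kappaDot κ k + kappaDerivation κ (ζ b)) : OpSeries N V) m := by
    rw [smul_comm, kappaDot_sub, smul_sub, Pi.smul_apply, Pi.sub_apply,
      smul_kappaDot_apply h.kappa, Pi.smul_apply, Pi.add_apply, neg_smul, ← smul_neg]
    congr 1
    abel
  rw [adShift_swap_apply, (h.implements_psi c (m - k)).adShift_current]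
  simp only [h.adShift_psi_a, h.adShift_psi_psi, Derivation.coe_zero, Pi.zero_apply, map_zero,
    zero_smul, smul_zero, add_zero, zero_add, Finset.sum_const_zero, Finset.sum_apply, hζ,
    Pi.neg_apply]

theorem adShift_current_a (k : Idx N) (α : σ) :
    adShift (current κ a Ψ P ζ f g k) k (a α)
      = -(∑ β, pderiv α (P (X β)) • a β + ∑ b, pderiv α (ζ b) • Ψ b
        + ∑ i, (pderiv α (f i) • kappaDerivation κ (g i)
          - pderiv α (g i) • kappaDerivation κ (f i)
          - (f i * pderiv α (g i)) • kappaDot κ k)) := by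
  funext m
  have hfg (i : ι) :
      (f i • (kappaDerivation κ (pderiv α (g i)) + pderiv α (g i) • kappaDot κ (m - k))
          + pderiv α (f i) • kappaDerivation κ (g i) : OpSeries N V) m
        = (pderiv α (f i) • kappaDerivation κ (g i) - pderiv α (g i) • kappaDerivation κ (f i)
          - (f i * pderiv α (g i)) • kappaDot κ k : OpSeries N V) m := by
    have hm := smul_kappaDot_apply (V := V) h.kappa (f i * pderiv α (g i)) m
    rw [Derivation.leibniz] at hm
    simp only [Pi.add_apply, Pi.sub_apply, smul_add, smul_smul, kappaDot_sub, smul_sub, hm]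
    abel
  rw [adShift_swap_apply, (h.implements_a α (m - k)).adShift_current]
  simp only [h.adShift_a_a, h.adShift_a_psi, smul_zero, zero_add, Pi.neg_apply, Pi.add_apply,
    Finset.sum_apply, hfg]

theorem sum_smul_adShift_current_a (k : Idx N) :
    ∑ α, P' (X α) • adShift (current κ a Ψ P ζ f g k) k (a α)
      = -(∑ β, P' (P (X β)) • a β + ∑ b, P' (ζ b) • Ψ b
        + ∑ i, (P' (f i) • kappaDerivation κ (g i) - P' (g i) • kappaDerivation κ (f i)
          - (f i * P' (g i)) • kappaDot κ k)) := by
  have hP' (p q : MvPolynomial σ ℂ) (A : OpSeries N V) :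
      ∑ α, (P' (X α) * (q * pderiv α p)) • A = (q * P' p) • A := by
    rw [← Finset.sum_smul, derivation_eq_sum_pderiv_smul P' p, Finset.mul_sum]
    simp only [smul_eq_mul, mul_left_comm, mul_comm]
  have hP'_one (p : MvPolynomial σ ℂ) (A : OpSeries N V) :
      ∑ α, (P' (X α) * pderiv α p) • A = P' p • A := by
    simpa only [one_mul] using hP' p 1 A
  simp only [h.adShift_current_a, smul_neg, Finset.sum_neg_distrib, smul_add, Finset.smul_sum,
    smul_sub, smul_smul, Finset.sum_add_distrib]
  rw [Finset.sum_comm (t := (Finset.univ : Finset σ)),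
    Finset.sum_comm (t := (Finset.univ : Finset I)),
    Finset.sum_comm (t := (Finset.univ : Finset ι))]
  simp only [Finset.sum_sub_distrib, hP', hP'_one]

theorem sum_smul_adShift_current_psi (k : Idx N) :
    ∑ c, ζ' c • adShift (current κ a Ψ P ζ f g k) k (Ψ c)
      = -∑ c, ∑ b, B c b • ((ζ' c * ζ b) • kappaDot κ k
          + ζ' c • kappaDerivation κ (ζ b)) := by
  simp only [h.adShift_current_psi, smul_neg, Finset.sum_neg_distrib, Finset.smul_sum,
    smul_comm (_ : MvPolynomial σ ℂ) (_ : ℂ), smul_add, smul_smul]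

/-- The first two lines are the Lie bracket of vector fields with functions, the rest is the
Dorfman bracket on one-forms. -/
theorem adShift_current (k : Idx N) :
    adShift (current κ a Ψ P ζ f g k) k (current κ a Ψ P' ζ' f' g')
      = ∑ α, ⁅P, P'⁆ (X α) • a α + ∑ b, (P (ζ' b) - P' (ζ b)) • Ψ b
        - ∑ c, ∑ b, B c b • ((ζ' c * ζ b) • kappaDot κ k + ζ' c • kappaDerivation κ (ζ b))
        + ∑ i, (P (f' i) • kappaDerivation κ (g' i) + f' i • kappaDerivation κ (P (g' i))
            + (f' i * P (g' i)) • kappaDot κ k)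
        - ∑ i, (P' (f i) • kappaDerivation κ (g i) - P' (g i) • kappaDerivation κ (f i)
            - (f i * P' (g i)) • kappaDot κ k) := by
  rw [(h.implements_current P ζ f g k).adShift_current, Finset.sum_add_distrib,
    h.sum_smul_adShift_current_a, Finset.sum_add_distrib, h.sum_smul_adShift_current_psi]
  simp only [Derivation.commutator_apply, sub_smul, Finset.sum_sub_distrib, smul_add, smul_smul,
    Finset.sum_add_distrib]
  abel

end FreeFields

end Dorfman

/-! ### Matrix calculus -/

section StrictlyUpperTriangular

variable {R I : Type*} [LinearOrder I]

/-- The strictly upper triangular part of a matrix. -/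
def upper [AddCommMonoid R] : Matrix I I R →+ Matrix I I R where
  toFun M := Matrix.of fun i j => if i < j then M i j else 0
  map_zero' := by ext i j; simp
  map_add' M N := by
    ext i j
    by_cases h : i < j <;> simp [h]

theorem upper_apply [AddCommMonoid R] (M : Matrix I I R) (i j : I) :
    upper M i j = if i < j then M i j else 0 := rfl

theorem upper_map {S F : Type*} [AddCommMonoid R] [AddCommMonoid S] [FunLike F R S]
    [ZeroHomClass F R S] (f : F) (M : Matrix I I R) : (upper M).map f = upper (M.map f) := by
  ext i j
  by_cases h : i < j <;> simp [upper_apply, h]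

theorem sum_eq_sum_upper {S O : Type*} [AddCommMonoid R] [AddCommMonoid S] [AddCommMonoid O]
    [Fintype I] (φ : R →+ S →+ O) (M : Matrix I I R) (N : Matrix I I S) :
    ∑ i, ∑ j, φ (M i j) (N j i) = ∑ i, ∑ j, φ (M i j) (upper N j i)
      + ∑ i, ∑ j, φ (upper M i j) (N j i) + ∑ i, φ (M i i) (N i i) := by
  have hdiag (i : I) : φ (M i i) (N i i) = ∑ j, if i = j then φ (M i j) (N j i) else 0 := by simp
  simp only [hdiag, ← Finset.sum_add_distrib]
  refine Finset.sum_congr rfl fun i _ => Finset.sum_congr rfl fun j _ => ?_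
  rcases lt_trichotomy i j with h | rfl | h
  · simp [upper_apply, h, h.not_gt, h.ne]
  · simp [upper_apply]
  · simp [upper_apply, h, h.not_gt, h.ne']

variable [Fintype I]

section Ring

variable [Ring R]

theorem upper_upper_mul_upper (M N : Matrix I I R) :
    upper (upper M * upper N) = upper M * upper N := by
  ext i j
  rw [upper_apply, ite_eq_left_iff, Matrix.mul_apply, eq_comm]
  intro hij
  refine Finset.sum_eq_zero fun s _ => ?_
  by_cases his : i < s
  · have hsj : ¬s < j := fun hsj => hij (his.trans hsj)
    simp [upper_apply, hsj]
  · simp [upper_apply, his]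

theorem upper_lower_mul_lower (M N : Matrix I I R) :
    upper ((M - upper M) * (N - upper N)) = 0 := by
  ext i j
  rw [upper_apply, Matrix.zero_apply, ite_eq_right_iff, Matrix.mul_apply]
  intro hij
  refine Finset.sum_eq_zero fun s _ => ?_
  rcases lt_or_ge i s with his | hsi
  · simp [upper_apply, his]
  · simp [upper_apply, hsi.trans_lt hij]

theorem upper_mul_upper_diag (M N : Matrix I I R) (b : I) : (upper M * upper N) b b = 0 := by
  rw [← upper_upper_mul_upper, upper_apply, if_neg (lt_irrefl b)]

theorem lower_mul_lower_diag (M N : Matrix I I R) (b : I) :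
    ((M - upper M) * (N - upper N)) b b = M b b * N b b := by
  rw [Matrix.mul_apply, Finset.sum_eq_single b]
  · simp [upper_apply]
  · intro s _ hs
    rcases lt_or_gt_of_ne hs with h | h <;> simp [upper_apply, h]
  · simp

theorem upper_bracket (x y : Matrix I I R) :
    upper (upper x * y - y * upper x) + upper y * upper x
      - upper (upper y * x - x * upper y) - upper x * upper y = upper (x * y - y * x) := by
  have hxy := upper_lower_mul_lower x y
  have hyx := upper_lower_mul_lower y x
  simp only [sub_mul, mul_sub, map_sub, upper_upper_mul_upper] at hxy hyx ⊢
  linear_combination (norm := abel) hyx - hxy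

end Ring

theorem diag_bracket [CommRing R] (x y : Matrix I I R) (b : I) :
    (upper x * y - y * upper x) b b - (upper y * x - x * upper y) b b = (x * y - y * x) b b := by
  have hxy := lower_mul_lower_diag x y b
  have hyx := lower_mul_lower_diag y x b
  simp only [sub_mul, mul_sub, Matrix.sub_apply, upper_mul_upper_diag] at hxy hyx ⊢
  linear_combination hyx - hxy

theorem trace_mul_eq_trace_upper [Ring R] (M N : Matrix I I R) :
    (M * N).trace = (M * upper N).trace + (upper M * N).trace + ∑ i, M i i * N i i :=
  sum_eq_sum_upper AddMonoidHom.mul M N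

end StrictlyUpperTriangular

section MatrixCalculus

variable {k J I : Type*} [CommRing k] [CommRing J] [Algebra k J]

/-- The matrix over the `k`-algebra `J` with entries the scalars `X i j`. -/
abbrev constMat (J : Type*) [CommRing J] [Algebra k J] (X : Matrix I I k) : Matrix I I J :=
  X.map (algebraMap k J)

theorem constMat_sub (X Y : Matrix I I k) :
    constMat J (X - Y) = constMat J X - constMat J Y :=
  Matrix.map_sub _ (map_sub _) X Y

theorem constMat_map_derivation {M : Type*} [AddCommGroup M] [Module k M] [Module J M]
    (P : Derivation k J M) (X : Matrix I I k) : (constMat J X).map P = 0 := by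
  ext i j
  simp

variable [Fintype I]

theorem constMat_mul (X Y : Matrix I I k) : constMat J (X * Y) = constMat J X * constMat J Y :=
  Matrix.map_mul

theorem trace_constMat (X : Matrix I I k) : (constMat J X).trace = algebraMap k J X.trace := by
  simp [Matrix.trace]

theorem map_derivation_mul (P : Derivation k J J) (M N : Matrix I I J) :
    (M * N).map P = M.map P * N + M * N.map P := by
  ext i j
  simp only [Matrix.map_apply, Matrix.mul_apply, Matrix.add_apply, map_sum, Derivation.leibniz,
    smul_eq_mul, Finset.sum_add_distrib]
  rw [add_comm]
  simp only [mul_comm]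

section TraceD

variable {O : Type*} [AddCommGroup O] [Module k O] [Module J O] (D : Derivation k J O)

/-- The one-form `tr(M dN)`. -/
def traceD (M N : Matrix I I J) : O := ∑ i, ∑ j, M i j • D (N j i)

theorem traceD_sub_left (M M' N : Matrix I I J) :
    traceD D (M - M') N = traceD D M N - traceD D M' N := by
  simp [traceD, sub_smul]

theorem traceD_mul_right (M N N' : Matrix I I J) :
    traceD D M (N * N') = traceD D (N' * M) N + traceD D (M * N) N' := by
  simp only [traceD, Matrix.mul_apply, map_sum, Derivation.leibniz, Finset.smul_sum, smul_add,
    smul_smul, Finset.sum_smul, Finset.sum_add_distrib]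
  rw [add_comm]
  congr 1
  · rw [Finset.sum_comm_cycle]
    refine Finset.sum_congr rfl fun s _ => ?_
    rw [Finset.sum_comm]
    simp only [mul_comm]
  · exact Finset.sum_congr rfl fun i _ => Finset.sum_comm

theorem traceD_constMat_right (M : Matrix I I J) (X : Matrix I I k) :
    traceD D M (constMat J X) = 0 := by
  simp [traceD]

theorem traceD_one_right [DecidableEq I] (M : Matrix I I J) : traceD D M 1 = 0 := by
  simpa using traceD_constMat_right D M (1 : Matrix I I k)

theorem traceD_eq_traceD_upper [LinearOrder I] (M N : Matrix I I J) :
    traceD D M N = traceD D M (upper N) + traceD D (upper M) N + ∑ i, M i i • D (N i i) :=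
  sum_eq_sum_upper ((smulAddHom J O).compl₂ (D : J →ₗ[k] O).toAddMonoidHom) M N

end TraceD

/-- `U X V` for a scalar matrix `X`: the conjugate of `X` by `U` when `V = U⁻¹`. -/
def conj (U V : Matrix I I J) (X : Matrix I I k) : Matrix I I J := U * constMat J X * V

variable {U V : Matrix I I J}

theorem map_inverse [DecidableEq I] (hUV : U * V = 1) (hVU : V * U = 1) {P : Derivation k J J}
    {x : Matrix I I J} (hP : U.map P = x * U) : V.map P = -(V * x) := by
  have hone : (1 : Matrix I I J).map P = 0 := by
    simpa using constMat_map_derivation P (1 : Matrix I I k)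
  have hleibniz := map_derivation_mul P U V
  rw [hUV, hone, hP, mul_assoc, hUV, mul_one] at hleibniz
  calc V.map P = V * U * V.map P := by rw [hVU, one_mul]
    _ = V * (x + U * V.map P) - V * x := by rw [mul_add, mul_assoc]; abel
    _ = _ := by rw [← hleibniz, mul_zero, zero_sub]

theorem map_conj [DecidableEq I] (hUV : U * V = 1) (hVU : V * U = 1) {P : Derivation k J J}
    {x : Matrix I I J} (hP : U.map P = x * U) (Y : Matrix I I k) :
    (conj U V Y).map P = x * conj U V Y - conj U V Y * x := by
  rw [conj, map_derivation_mul, map_derivation_mul, constMat_map_derivation, hP,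
    map_inverse hUV hVU hP]
  simp only [mul_zero, add_zero, mul_neg, mul_assoc, sub_eq_add_neg]

theorem conj_sub (X Y : Matrix I I k) : conj U V (X - Y) = conj U V X - conj U V Y := by
  rw [conj, constMat_sub, mul_sub, sub_mul, conj, conj]

variable [DecidableEq I]

omit [Fintype I] in
theorem constMat_single (p q : I) (c : k) :
    constMat J (Matrix.single p q c) = Matrix.single p q (algebraMap k J c) :=
  Matrix.map_single p q c (algebraMap k J)

theorem conj_single (p q : I) (c : k) (i j : I) :
    conj U V (Matrix.single p q c) i j = c • (U i p * V q j) := by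
  rw [conj, constMat_single, mul_assoc, Matrix.mul_apply, Finset.sum_eq_single p,
    Matrix.single_mul_apply_same, Algebra.smul_def, mul_left_comm]
  · intro s _ hs
    rw [Matrix.single_mul_apply_of_ne _ _ _ _ _ hs, mul_zero]
  · exact fun hp => absurd (Finset.mem_univ p) hp

theorem traceD_constMat_single_mul {O : Type*} [AddCommGroup O] [Module k O] [Module J O]
    [IsScalarTower k J O] (D : Derivation k J O) (p q : I) (c : k) :
    traceD D (constMat J (Matrix.single p q c) * V) U = c • ∑ j, V q j • D (U j p) := by
  rw [traceD, Finset.sum_eq_single p, Finset.smul_sum]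
  · refine Finset.sum_congr rfl fun j _ => ?_
    rw [constMat_single, Matrix.single_mul_apply_same, ← Algebra.smul_def, smul_assoc]
  · intro s _ hs
    refine Finset.sum_eq_zero fun j _ => ?_
    rw [constMat_single, Matrix.single_mul_apply_of_ne _ _ _ _ _ hs, zero_smul]
  · exact fun hp => absurd (Finset.mem_univ p) hp

variable (hVU : V * U = 1)
include hVU

theorem conj_mul_left (X : Matrix I I k) : conj U V X * U = U * constMat J X := by
  rw [conj, mul_assoc, hVU, mul_one]

theorem mul_conj_right (X : Matrix I I k) : V * conj U V X = constMat J X * V := by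
  rw [conj, mul_assoc, ← mul_assoc, hVU, one_mul]

theorem conj_mul_conj (X Y : Matrix I I k) : conj U V X * conj U V Y = conj U V (X * Y) := by
  rw [conj.eq_1 U V Y, ← mul_assoc, ← mul_assoc, conj_mul_left hVU, conj, constMat_mul,
    mul_assoc U]

theorem conj_mul_sub_mul (X Y : Matrix I I k) :
    conj U V (X * Y - Y * X) = conj U V X * conj U V Y - conj U V Y * conj U V X := by
  rw [conj_mul_conj hVU, conj_mul_conj hVU, conj_sub]

theorem trace_conj (X : Matrix I I k) : (conj U V X).trace = algebraMap k J X.trace := by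
  rw [conj, Matrix.trace_mul_comm, ← mul_assoc, hVU, one_mul, trace_constMat]

end MatrixCalculus

section CellCalculus

variable {k J I : Type*} [CommRing k] [CommRing J] [Algebra k J] [LinearOrder I] [Fintype I]
  {U V : Matrix I I J}

theorem traceD_conj_conj {O : Type*} [AddCommGroup O] [Module k O] [Module J O]
    (D : Derivation k J O) (hVU : V * U = 1) (X Y : Matrix I I k) :
    traceD D (conj U V Y) (conj U V X) = traceD D (constMat J (X * Y - Y * X) * V) U := by
  have hconj := traceD_mul_right D (conj U V Y) U (constMat J X * V)
  have hconst := traceD_mul_right D (U * constMat J Y) (constMat J X) V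
  have hinv := traceD_mul_right D (constMat J Y * constMat J X) V U
  rw [← mul_assoc U, ← conj, mul_assoc (constMat J X), mul_conj_right hVU, conj_mul_left hVU,
    hconst, traceD_constMat_right, zero_add] at hconj
  rw [hVU, traceD_one_right, ← mul_assoc U] at hinv
  rw [constMat_sub, constMat_mul, constMat_mul, sub_mul, traceD_sub_left,
    mul_assoc (constMat J X)]
  linear_combination (norm := abel) hconj - hinv

/-- The one-form part of the bracket of two matrix currents. -/
theorem traceD_bracket {O : Type*} [AddCommGroup O] [Module k O] [Module J O]
    (D : Derivation k J O) (hVU : V * U = 1) (X Y : Matrix I I k) :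
    traceD D (constMat J Y * V * upper (conj U V X)) U
      - traceD D (constMat J Y * V) (upper (conj U V X) * U)
      - traceD D (constMat J X * V * upper (conj U V Y)) U
      - traceD D (upper (conj U V Y) * U) (constMat J X * V)
      - ∑ b, conj U V Y b b • D (conj U V X b b)
    = -traceD D (constMat J (X * Y - Y * X) * V) U := by
  have hx := traceD_mul_right D (constMat J Y * V) (upper (conj U V X)) U
  have hy := traceD_mul_right D (upper (conj U V Y)) U (constMat J X * V)
  have hsplit := traceD_eq_traceD_upper D (conj U V Y) (conj U V X)
  rw [← mul_assoc U, ← conj] at hx hy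
  rw [traceD_conj_conj D hVU] at hsplit
  linear_combination (norm := abel) hsplit - hx + hy

theorem trace_bracket (hVU : V * U = 1) (X Y : Matrix I I k) :
    (constMat J Y * V * (upper (conj U V X) * U)).trace
      + (constMat J X * V * (upper (conj U V Y) * U)).trace
      + ∑ b, conj U V Y b b * conj U V X b b = algebraMap k J (X * Y).trace := by
  have hcycle (Z : Matrix I I k) (M : Matrix I I J) :
      (constMat J Z * V * (M * U)).trace = (conj U V Z * M).trace := by
    rw [conj, ← mul_assoc, Matrix.trace_mul_comm, ← mul_assoc, ← mul_assoc]
  rw [hcycle, hcycle, Matrix.trace_mul_comm (conj U V X), ← trace_mul_eq_trace_upper,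
    conj_mul_conj hVU, trace_conj hVU, Matrix.trace_mul_comm]

theorem map_commutator (hUV : U * V = 1) (hVU : V * U = 1) {P P' : Derivation k J J}
    (X Y : Matrix I I k) (hP : U.map P = upper (conj U V X) * U)
    (hP' : U.map P' = upper (conj U V Y) * U) :
    U.map (⁅P, P'⁆ : Derivation k J J) = upper (conj U V (X * Y - Y * X)) * U := by
  have hmap : U.map (⁅P, P'⁆ : Derivation k J J) = (U.map P').map P - (U.map P).map P' := by
    ext i j
    simp only [Derivation.commutator_apply, Matrix.sub_apply, Matrix.map_apply]
  rw [hmap, conj_mul_sub_mul hVU, ← upper_bracket, hP, hP', map_derivation_mul,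
    map_derivation_mul, upper_map, upper_map, map_conj hUV hVU hP, map_conj hUV hVU hP', hP, hP']
  simp only [add_mul, sub_mul, mul_assoc]
  abel

end CellCalculus

theorem sum_gram_smul {k J I O : Type*} [CommRing k] [CommRing J] [Fintype I] [DecidableEq I]
    [AddCommGroup O] [Module k O] [Module J O] {B : I → I → k} {β γ : I → k}
    (hB : ∀ i j, B i j = (if i = j then 1 else 0) + β i + γ j) (F : J →+ O)
    {u v : I → J} (hu : ∑ i, u i = 0) (hv : ∑ i, v i = 0) :
    ∑ i, ∑ j, B i j • (v i • F (u j)) = ∑ i, v i • F (u i) := by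
  have hβ : ∑ i, ∑ j, β i • (v i • F (u j)) = 0 := by
    simp only [← Finset.smul_sum, ← map_sum, hu, map_zero, smul_zero, Finset.sum_const_zero]
  have hγ : ∑ i, ∑ j, γ j • (v i • F (u j)) = 0 := by
    rw [Finset.sum_comm]
    simp only [← Finset.smul_sum, ← Finset.sum_smul, hv, zero_smul, smul_zero,
      Finset.sum_const_zero]
  simp only [hB, add_smul, ite_smul, one_smul, zero_smul, Finset.sum_add_distrib, hβ, hγ,
    Finset.sum_ite_eq, Finset.mem_univ, if_true, add_zero]

section BigCell

variable {σ I : Type*} [Fintype I] [LinearOrder I]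

/-- Coordinates on the big cell: a unipotent matrix `U` with inverse `V` whose entries are the
polynomial generators up to sign, and the infinitesimal action `P` of matrices,
`P_M U = (U M U⁻¹)_+ U`. -/
structure BigCell (I σ : Type*) [Fintype I] [LinearOrder I] where
  U : Matrix I I (MvPolynomial σ ℂ)
  V : Matrix I I (MvPolynomial σ ℂ)
  U_mul_V : U * V = 1
  V_mul_U : V * U = 1
  row : σ → I
  col : σ → I
  X_eq : ∀ α, X α = -U (row α) (col α)
  P : Matrix I I ℂ → Derivation ℂ (MvPolynomial σ ℂ) (MvPolynomial σ ℂ)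
  map_P : ∀ M, U.map (P M) = upper (conj U V M) * U

namespace BigCell

variable (b : BigCell I σ) (M M' : Matrix I I ℂ)

theorem P_U (i j : I) : b.P M (b.U i j) = (upper (conj b.U b.V M) * b.U) i j :=
  congrFun (congrFun (b.map_P M) i) j

theorem P_X (α : σ) :
    b.P M (X α) = -(upper (conj b.U b.V M) * b.U) (b.row α) (b.col α) := by
  rw [b.X_eq, map_neg, P_U]

theorem P_constMat_mul_V (i j : I) :
    b.P M ((constMat (MvPolynomial σ ℂ) M' * b.V) i j)
      = -(constMat (MvPolynomial σ ℂ) M' * b.V * upper (conj b.U b.V M)) i j := by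
  have hmap : (constMat _ M' * b.V).map (b.P M)
      = -(constMat _ M' * b.V * upper (conj b.U b.V M)) := by
    rw [map_derivation_mul, constMat_map_derivation, map_inverse b.U_mul_V b.V_mul_U (b.map_P M),
      zero_mul, zero_add, mul_neg, mul_assoc]
  exact congrFun (congrFun hmap i) j

theorem P_conj_diag_sub (i : I) :
    b.P M (conj b.U b.V M' i i) - b.P M' (conj b.U b.V M i i)
      = conj b.U b.V (M * M' - M' * M) i i := by
  have hM := congrFun (congrFun (map_conj b.U_mul_V b.V_mul_U (b.map_P M) M') i) i
  have hM' := congrFun (congrFun (map_conj b.U_mul_V b.V_mul_U (b.map_P M') M) i) i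
  rw [Matrix.map_apply] at hM hM'
  rw [hM, hM', diag_bracket, conj_mul_sub_mul b.V_mul_U]

theorem P_commutator (α : σ) : ⁅b.P M, b.P M'⁆ (X α) = b.P (M * M' - M' * M) (X α) := by
  rw [b.X_eq, map_neg, map_neg, P_U,
    ← map_commutator b.U_mul_V b.V_mul_U M M' (b.map_P M) (b.map_P M'), Matrix.map_apply]

variable {M} in
theorem sum_conj_diag (hM : M.trace = 0) : ∑ i, conj b.U b.V M i i = 0 := by
  have htrace := trace_conj b.V_mul_U M
  rwa [hM, map_zero] at htrace

end BigCell

end BigCell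

section MatrixCurrent

variable {σ W : Type*} [AddCommGroup W] [Module ℂ W] {N : ℕ} [CommutingFields σ N W]
  {κ : Idx N → Fin (N + 1) → ℂ} {I : Type*} [Fintype I] [LinearOrder I]

theorem trace_bracket_smul_kappaDot (b : BigCell I σ) (X Y : Matrix I I ℂ) (k : Idx N) :
    ∑ i, ∑ j, ((constMat (MvPolynomial σ ℂ) Y * b.V) i j * (upper (conj b.U b.V X) * b.U) j i) •
        kappaDot κ k
      + ∑ i, ∑ j, ((constMat (MvPolynomial σ ℂ) X * b.V) i j * (upper (conj b.U b.V Y) * b.U) j i) •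
        kappaDot κ k
      + ∑ i, (conj b.U b.V Y i i * conj b.U b.V X i i) • kappaDot κ k
      = (X * Y).trace • kappaDot (V := W) κ k := by
  have htrace (A A' : Matrix I I (MvPolynomial σ ℂ)) :
      (A * A').trace = ∑ i, ∑ j, A i j * A' j i := rfl
  rw [← algebraMap_smul (MvPolynomial σ ℂ) (X * Y).trace, ← trace_bracket b.V_mul_U X Y]
  simp only [htrace (constMat (MvPolynomial σ ℂ) _ * b.V), add_smul, Finset.sum_smul]

variable [Fintype σ] {a : σ → OpSeries N W} {Ψ : I → OpSeries N W} {B : I → I → ℂ}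

/-- The current by which the matrix `M` acts: its vector field part is `P_M`, its Heisenberg part
the diagonal of `-U M U⁻¹`, and its one-form part `-tr(M U⁻¹ dU)`. -/
def matrixCurrent (κ : Idx N → Fin (N + 1) → ℂ) (a : σ → OpSeries N W) (Ψ : I → OpSeries N W)
    (b : BigCell I σ) (M : Matrix I I ℂ) : OpSeries N W :=
  current κ a Ψ (b.P M) (fun i => -conj b.U b.V M i i)
    (fun ij : I × I => -(constMat (MvPolynomial σ ℂ) M * b.V) ij.1 ij.2)
    (fun ij => b.U ij.2 ij.1)

theorem matrixCurrent_eq (b : BigCell I σ) (M : Matrix I I ℂ) :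
    matrixCurrent κ a Ψ b M = ∑ α, b.P M (X α) • a α - ∑ i, conj b.U b.V M i i • Ψ i
      - traceD (kappaDerivation κ) (constMat _ M * b.V) b.U := by
  rw [matrixCurrent, current, Fintype.sum_prod_type, traceD]
  simp only [neg_smul, Finset.sum_neg_distrib, sub_eq_add_neg]

theorem matrixCurrent_sub (b : BigCell I σ) (M M' : Matrix I I ℂ) :
    matrixCurrent κ a Ψ b (M - M') = matrixCurrent κ a Ψ b M - matrixCurrent κ a Ψ b M' := by
  simp only [matrixCurrent_eq, b.P_X, conj_sub, map_sub, sub_mul, neg_sub, constMat_sub,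
    traceD_sub_left, Matrix.sub_apply, sub_smul, neg_smul, Finset.sum_sub_distrib,
    Finset.sum_neg_distrib]
  abel

namespace FreeFields

theorem adShift_matrixCurrent (h : FreeFields κ a Ψ B) (b : BigCell I σ) {β γ : I → ℂ}
    (hB : ∀ i j, B i j = (if i = j then 1 else 0) + β i + γ j) (X Y : Matrix I I ℂ)
    (hX : X.trace = 0) (hY : Y.trace = 0) (k : Idx N) :
    adShift (matrixCurrent κ a Ψ b X k) k (matrixCurrent κ a Ψ b Y)
      = matrixCurrent κ a Ψ b (X * Y - Y * X) - (X * Y).trace • kappaDot κ k := by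
  have hform := traceD_bracket (kappaDerivation (V := W) κ) b.V_mul_U X Y
  have htrace := trace_bracket_smul_kappaDot (W := W) (κ := κ) b X Y k
  have hgramK := sum_gram_smul (O := OpSeries N W) hB
    (LinearMap.toSpanSingleton (MvPolynomial σ ℂ) (OpSeries N W) (kappaDot κ k)).toAddMonoidHom
    (b.sum_conj_diag hX) (b.sum_conj_diag hY)
  have hgramD := sum_gram_smul (O := OpSeries N W) hB
    (kappaDerivation (V := W) κ).toLinearMap.toAddMonoidHom
    (b.sum_conj_diag hX) (b.sum_conj_diag hY)
  have htranspose : traceD (kappaDerivation (V := W) κ) (upper (conj b.U b.V Y) * b.U)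
        (constMat _ X * b.V)
      = ∑ i, ∑ j, (upper (conj b.U b.V Y) * b.U) j i •
        kappaDerivation κ ((constMat (MvPolynomial σ ℂ) X * b.V) i j) := Finset.sum_comm
  rw [htranspose] at hform
  have hdiag (i : I) : b.P X (-conj b.U b.V Y i i) - b.P Y (-conj b.U b.V X i i)
      = -conj b.U b.V (X * Y - Y * X) i i := by
    rw [← b.P_conj_diag_sub, map_neg, map_neg]
    ring
  rw [matrixCurrent_eq b (X * Y - Y * X), matrixCurrent, matrixCurrent, h.adShift_current]
  simp only [LinearMap.toAddMonoidHom_coe, LinearMap.toSpanSingleton_apply,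
    Derivation.coeFn_coe] at hgramK hgramD
  simp only [hdiag]
  simp only [traceD, b.P_constMat_mul_V, b.P_U, b.P_commutator, Fintype.sum_prod_type,
    Finset.sum_add_distrib, Finset.sum_sub_distrib, neg_smul, neg_mul, mul_neg, neg_neg,
    map_neg, smul_neg, smul_add, Finset.sum_neg_distrib, hgramD, mul_smul, hgramK]
    at htrace hform ⊢
  linear_combination (norm := abel) hform - htrace

end FreeFields

end MatrixCurrent

/-! ### The Fock space -/

section TensorProductOperators

variable {R M P : Type*} [CommRing R] [AddCommGroup M] [Module R M] [AddCommGroup P] [Module R P]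

theorem lie_rTensor (f g : Module.End R M) : ⁅f.rTensor P, g.rTensor P⁆ = ⁅f, g⁆.rTensor P := by
  simp only [LieRing.of_associative_ring_bracket, Module.End.mul_eq_comp, LinearMap.rTensor_sub,
    LinearMap.rTensor_comp]

theorem lie_lTensor (f g : Module.End R P) : ⁅f.lTensor M, g.lTensor M⁆ = ⁅f, g⁆.lTensor M := by
  simp only [LieRing.of_associative_ring_bracket, Module.End.mul_eq_comp, LinearMap.lTensor_sub,
    LinearMap.lTensor_comp]

theorem lie_rTensor_lTensor (f : Module.End R M) (g : Module.End R P) :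
    ⁅f.rTensor P, g.lTensor M⁆ = 0 := by
  rw [LieRing.of_associative_ring_bracket, Module.End.mul_eq_comp, Module.End.mul_eq_comp,
    LinearMap.rTensor_comp_lTensor, LinearMap.lTensor_comp_rTensor, sub_self]

theorem lie_lTensor_rTensor (f : Module.End R P) (g : Module.End R M) :
    ⁅f.lTensor M, g.rTensor P⁆ = 0 := by
  rw [← lie_skew, lie_rTensor_lTensor, neg_zero]

end TensorProductOperators

section ConstantCoefficients

variable {R A τ : Type*} [CommRing R] [CommRing A] [Algebra R A]

theorem lie_derivation_mulLeft (D : Derivation R A A) (p : A) :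
    ⁅D.toLinearMap, LinearMap.mulLeft R p⁆ = LinearMap.mulLeft R (D p) := by
  ext f
  simp [LieRing.of_associative_ring_bracket, mul_comm]

theorem lie_mulLeft_mulLeft (p q : A) : ⁅LinearMap.mulLeft R p, LinearMap.mulLeft R q⁆ = 0 := by
  ext f
  simp [LieRing.of_associative_ring_bracket, mul_left_comm]

theorem lie_derivation_add_mulLeft {D D' : Derivation R A A} (h : ⁅D, D'⁆ = 0) (p q : A) :
    ⁅D.toLinearMap + LinearMap.mulLeft R p, D'.toLinearMap + LinearMap.mulLeft R q⁆
      = LinearMap.mulLeft R (D q - D' p) := by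
  rw [lie_add, add_lie, add_lie, ← Derivation.commutator_coe_linear_map, h, lie_mulLeft_mulLeft,
    lie_derivation_mulLeft, ← lie_skew, lie_derivation_mulLeft, Derivation.coe_zero_linearMap]
  ext f
  simp [sub_mul, ← sub_eq_neg_add]

theorem lie_mkDerivation_C (c d : τ → R) :
    ⁅mkDerivation R fun v => (C (c v) : MvPolynomial τ R),
      mkDerivation R fun v => (C (d v) : MvPolynomial τ R)⁆ = 0 :=
  derivation_ext fun v => by
    rw [Derivation.commutator_apply, mkDerivation_X, mkDerivation_X, derivation_C, derivation_C,
      sub_zero, Derivation.coe_zero, Pi.zero_apply]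

theorem lie_pderiv_pderiv (v w : τ) : ⁅pderiv (R := R) v, pderiv (R := R) w⁆ = 0 := by
  classical
  refine derivation_ext fun u => ?_
  rw [Derivation.commutator_apply, pderiv_X, pderiv_X, Pi.single_apply, Pi.single_apply]
  split_ifs <;> simp

end ConstantCoefficients

/-- Pairs `0 < i < j ≤ n + 1`. -/
abbrev Pair (n : ℕ) : Type := {p : ℕ × ℕ // 0 < p.1 ∧ p.1 < p.2 ∧ p.2 ≤ n + 1}

section FockFields

variable {n N : ℕ} (S : SignDecomposition N)

theorem derivX_of_pair (α : Pair n) (m : Idx N) :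
    derivX n α.1.1 α.1.2 m = (pderiv (R := ℂ) ((α, m) : XVar n N)).toLinearMap := by
  rw [derivX, dif_pos α.2]

theorem mulX_of_pair (α : Pair n) (m : Idx N) :
    mulX n α.1.1 α.1.2 m = LinearMap.mulLeft ℂ (X ((α, m) : XVar n N)) := by
  rw [mulX, dif_pos α.2]

theorem commute_derivX (α β : Pair n) (m k : Idx N) :
    Commute (derivX n α.1.1 α.1.2 m) (derivX n β.1.1 β.1.2 k) := by
  rw [commute_iff_lie_eq, derivX_of_pair, derivX_of_pair, ← Derivation.commutator_coe_linear_map,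
    lie_pderiv_pderiv, Derivation.coe_zero_linearMap]

theorem lie_mulX_mulX (α β : Pair n) (m k : Idx N) :
    ⁅mulX n α.1.1 α.1.2 m, mulX n β.1.1 β.1.2 k⁆ = 0 := by
  rw [mulX_of_pair, mulX_of_pair, lie_mulLeft_mulLeft]

open Classical in
theorem lie_derivX_mulX (α β : Pair n) (m k : Idx N) :
    ⁅derivX n α.1.1 α.1.2 m, mulX n β.1.1 β.1.2 k⁆ = if α = β ∧ m = k then 1 else 0 := by
  rw [derivX_of_pair, mulX_of_pair, lie_derivation_mulLeft, pderiv_X, Pi.single_apply]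
  simp only [Prod.mk.injEq, eq_comm (a := β), eq_comm (a := k)]
  split_ifs
  · exact LinearMap.mulLeft_one _ _
  · exact LinearMap.mulLeft_zero_eq_zero _ _

instance : CommutingFields (Pair n) N (Fock n S) where
  field α := aS n S α.1.1 α.1.2
  commute α β k l v := by
    have h : Commute (aStarMode n S α.1.1 α.1.2 k) (aStarMode n S β.1.1 β.1.2 l) :=
      (commute_derivX α β (-k) (-l)).map (Module.End.rTensorAlgHom ℂ (CX n N) (CY n S))
    exact LinearMap.congr_fun h v

/-- The fields `a_α`. -/
def aFields (α : Pair n) : OpSeries N (Fock n S) := aF n S α.1.1 α.1.2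

theorem modes_X_eq_rTensor (α : Pair n) (s : Idx N) :
    modes (V := Fock n S) (X α : MvPolynomial (Pair n) ℂ) s
      = (derivX n α.1.1 α.1.2 (-s)).rTensor (CY n S) :=
  LinearMap.ext fun v => modes_X α s v

theorem implements_aFields (α : Pair n) (m : Idx N) : Implements (aFields S α m) m (pderiv α) := by
  classical
  refine implements_of_X fun β s => ?_
  have hδ : (pderiv α (X β) : MvPolynomial (Pair n) ℂ) = C (if β = α then 1 else 0) := by
    rw [pderiv_X, Pi.single_apply]
    split_ifs <;> simp
  rw [modes_X_eq_rTensor, aFields, aF, lie_rTensor, neg_lie, lie_skew, lie_derivX_mulX, hδ,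
    modes_C]
  simp only [neg_eq_iff_add_eq_zero]
  by_cases hα : β = α <;> by_cases hs : s + m = 0 <;> simp [hα, hs, Module.End.one_eq_id]

theorem lie_aFields (α β : Pair n) (m k : Idx N) : ⁅aFields S α m, aFields S β k⁆ = 0 := by
  rw [aFields, aFields, aF, aF, lie_rTensor, neg_lie, lie_neg, lie_mulX_mulX, neg_zero, neg_zero,
    LinearMap.rTensor_zero]

end FockFields

section SignDecomposition

variable {N : ℕ} {S : SignDecomposition N}

theorem SignDecomposition.trichotomy (S : SignDecomposition N) (m : Idx N) :
    m = 0 ∨ m ∈ S.pos ∨ -m ∈ S.pos := by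
  have hcases (m : Idx N) : (m ∈ S.neg ∨ m = 0) ∨ m ∈ S.pos := S.union_eq.ge (Set.mem_univ m)
  rcases hcases m with (hm | hm) | hm
  · rcases hcases (-m) with (hm' | hm') | hm'
    · exact absurd (add_neg_cancel m ▸ S.add_mem_neg hm hm') S.zero_notMem_neg
    · exact Or.inl (neg_eq_zero.1 hm')
    · exact Or.inr (Or.inr hm')
  · exact Or.inl hm
  · exact Or.inr (Or.inl hm)

theorem SignDecomposition.neg_notMem_pos {m : Idx N} (hm : m ∈ S.pos) : -m ∉ S.pos :=
  fun hm' => S.zero_notMem_pos (add_neg_cancel m ▸ S.add_mem_pos hm hm')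

theorem theta_of_mem {m : Idx N} (hm : m ∈ S.pos) : theta S m = 1 :=
  Set.indicator_of_mem hm _

theorem theta_of_notMem {m : Idx N} (hm : m ∉ S.pos) : theta S m = 0 :=
  Set.indicator_of_notMem hm _

theorem theta_add_theta_neg {m : Idx N} (hm : m ≠ 0) : theta S m + theta S (-m) = 1 := by
  rcases (S.trichotomy m).resolve_left hm with h | h
  · rw [theta_of_mem h, theta_of_notMem (SignDecomposition.neg_notMem_pos h), add_zero]
  · rw [theta_of_mem h, theta_of_notMem (neg_neg m ▸ SignDecomposition.neg_notMem_pos h), zero_add]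

/-- `∑_p m_p κ_{-m+s,p}`. -/
def kappaCoeff (κ : Idx N → Fin (N + 1) → ℂ) (m s : Idx N) : ℂ := ∑ p, (m p : ℂ) * κ (-m + s) p

variable {κ : Idx N → Fin (N + 1) → ℂ}

theorem kappaCoeff_neg_swap (eqn1 : ∀ m : Idx N, ∑ p, (m p : ℂ) * κ m p = 0) (m k : Idx N) :
    kappaCoeff κ k (-m) = -kappaCoeff κ m (-k) := by
  have h := eqn1 (-m + -k)
  simp only [Pi.neg_apply, Pi.add_apply, Int.cast_neg, Int.cast_add, neg_mul, add_mul,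
    Finset.sum_neg_distrib, Finset.sum_add_distrib] at h
  rw [kappaCoeff, kappaCoeff, add_comm (-k)]
  linear_combination -h

theorem theta_mul_kappaCoeff (eqn1 : ∀ m : Idx N, ∑ p, (m p : ℂ) * κ m p = 0)
    (eqn2 : ∀ m k : Idx N, m ∈ S.pos → k ∈ S.pos → ∑ p, (m p : ℂ) * κ (-m - k) p = 0)
    (m k : Idx N) :
    (theta S (-m) * theta S (-k) + theta S m * theta S (-k) + theta S (-m) * theta S k)
      * kappaCoeff κ m (-k) = kappaCoeff κ m (-k) := by
  have h_zero_left (k : Idx N) : kappaCoeff κ 0 k = 0 := by simp [kappaCoeff]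
  rcases eq_or_ne m 0 with rfl | hm
  · rw [h_zero_left, mul_zero]
  rcases eq_or_ne k 0 with rfl | hk
  · rw [← neg_neg (kappaCoeff κ m (-0)), ← kappaCoeff_neg_swap eqn1, h_zero_left]
    simp only [neg_zero, mul_zero]
  have h_pos : theta S m * theta S k * kappaCoeff κ m (-k) = 0 := by
    by_cases hm : m ∈ S.pos
    · by_cases hk : k ∈ S.pos
      · rw [kappaCoeff, ← sub_eq_add_neg, eqn2 m k hm hk, mul_zero]
      · rw [theta_of_notMem hk, mul_zero, zero_mul]
    · rw [theta_of_notMem hm, zero_mul, zero_mul]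
  linear_combination (exp := 1) kappaCoeff κ m (-k) * (theta S k + theta S (-k))
    * theta_add_theta_neg (S := S) hm + kappaCoeff κ m (-k) * theta_add_theta_neg (S := S) hk
    - h_pos

end SignDecomposition

section Heisenberg

variable {n N : ℕ} {S : SignDecomposition N}

theorem sumComp_smul_id_apply {ι A : Type*} [CommRing A] [Algebra ℂ A] (c : ι → ℂ)
    (B : SummableFamily ι A) (f : A) :
    SummableFamily.sumComp (fun s => c s • LinearMap.id) B f
      = Finsupp.linearCombination A (fun s => algebraMap ℂ A (c s)) (B f) := by
  rw [Finsupp.linearCombination_apply]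
  exact Finsupp.sum_congr fun s _ => (Algebra.smul_def _ _).trans (mul_comm _ _)

theorem derivY_X (i : ℕ) (s : Idx N) (v : YVar n S) :
    derivY S i s (X v) = if v.1 = (i, s) then 1 else 0 := by
  classical
  by_cases h : (1 ≤ i ∧ i ≤ n) ∧ s ∈ S.pos
  · simp only [derivY, dif_pos h, Derivation.coeFn_coe, pderiv_X, Pi.single_apply, Subtype.ext_iff]
  · rw [derivY, dif_neg h, if_neg fun hv => h (by simpa only [hv] using v.2), LinearMap.zero_apply]

theorem derivY_mul (i : ℕ) (s : Idx N) (p q : CY n S) :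
    derivY S i s (p * q) = p * derivY S i s q + q * derivY S i s p := by
  by_cases h : (1 ≤ i ∧ i ≤ n) ∧ s ∈ S.pos
  · simp [derivY, dif_pos h]
  · simp [derivY, dif_neg h]

theorem kappaDerivY_mul (κ : Idx N → Fin (N + 1) → ℂ) (i : ℕ) (m : Idx N) (p q : CY n S) :
    kappaDerivY S κ i m (p * q) = p • kappaDerivY S κ i m q + q • kappaDerivY S κ i m p := by
  have hleibniz : SummableFamily.ofFinite (derivY S i) (derivY_finite S i) (p * q)
      = p • SummableFamily.ofFinite (derivY S i) (derivY_finite S i) q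
        + q • SummableFamily.ofFinite (derivY S i) (derivY_finite S i) p :=
    Finsupp.ext fun s => derivY_mul i s p q
  simp only [kappaDerivY, sumComp_smul_id_apply, hleibniz, map_add, map_smul]

theorem kappaDerivY_X (κ : Idx N → Fin (N + 1) → ℂ) (i : ℕ) (m : Idx N) (v : YVar n S) :
    kappaDerivY S κ i m (X v) = C (if v.1.1 = i then kappaCoeff κ m v.1.2 else 0) := by
  classical
  have hsingle : SummableFamily.ofFinite (derivY S i) (derivY_finite S i) (X v)
      = Finsupp.single v.1.2 (if v.1.1 = i then (1 : CY n S) else 0) := by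
    ext s : 1
    refine (derivY_X i s v).trans ?_
    rw [Finsupp.single_apply]
    by_cases hi : v.1.1 = i <;> by_cases hs : v.1.2 = s <;> simp [hi, hs, Prod.ext_iff]
  rw [kappaDerivY, sumComp_smul_id_apply, hsingle, Finsupp.linearCombination_single]
  split_ifs
  · rw [one_smul]; rfl
  · rw [zero_smul, map_zero]

theorem kappaDerivY_eq_mkDerivation (κ : Idx N → Fin (N + 1) → ℂ) (i : ℕ) (m : Idx N) :
    kappaDerivY (n := n) S κ i m = (mkDerivation ℂ fun v : YVar n S =>
      (C (if v.1.1 = i then kappaCoeff κ m v.1.2 else 0) : CY n S)).toLinearMap :=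
  congrArg Derivation.toLinearMap <| derivation_ext
    (D₁ := Derivation.mk' (kappaDerivY S κ i m) (kappaDerivY_mul κ i m))
    fun v => by rw [mkDerivation_X]; exact kappaDerivY_X κ i m v

/-- The entries of the Cartan matrix of finite type `A`, for rows and columns in `ℕ`. -/
def cartanA (i j : ℕ) : ℂ := if i = j then 2 else if i + 1 = j ∨ j + 1 = i then -1 else 0

/-- The coefficients of the derivation part of `Φ(b_i(m))`. -/
def heisCoeff (S : SignDecomposition N) (κ : Idx N → Fin (N + 1) → ℂ) (i : ℕ) (m : Idx N) (j : ℕ)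
    (s : Idx N) : ℂ :=
  (theta S (-m) * ((if j + 1 = i then 1 else 0) - (if i = j then 1 else 0))
    - theta S m * cartanA i j) * kappaCoeff κ m s

/-- The derivation part of `Φ(b_i(m))`. -/
def heisDerivation (n : ℕ) (S : SignDecomposition N) (κ : Idx N → Fin (N + 1) → ℂ) (i : ℕ)
    (m : Idx N) : Derivation ℂ (CY n S) (CY n S) :=
  mkDerivation ℂ fun v => C (heisCoeff S κ i m v.1.1 v.1.2)

/-- The polynomial by which the part of `Φ(b_i(m))` of order zero multiplies. -/
def heisPoly (n : ℕ) (S : SignDecomposition N) (lam : ℕ → ℂ) (i : ℕ) (m : Idx N) : CY n S :=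
  theta S (-m) • mulY S i (-m) 1 - C (if m = 0 then lam i else 0)

theorem mulLeft_mulY_one (i : ℕ) (k : Idx N) :
    LinearMap.mulLeft ℂ (mulY (n := n) S i k 1) = mulY S i k := by
  rw [mulY]
  split_ifs
  · rw [LinearMap.mulLeft_apply, mul_one]
  · exact LinearMap.mulLeft_zero_eq_zero _ _

theorem heis_eq (κ : Idx N → Fin (N + 1) → ℂ) (lam : ℕ → ℂ) (i : ℕ) (m : Idx N) :
    heis (n := n) S κ lam i m
      = (heisDerivation n S κ i m).toLinearMap + LinearMap.mulLeft ℂ (heisPoly n S lam i m) := by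
  have hD : theta S (-m) • (kappaDerivY S κ (i - 1) m - kappaDerivY S κ i m)
      + theta S m • (kappaDerivY S κ (i - 1) m - (2 : ℂ) • kappaDerivY S κ i m
        + kappaDerivY S κ (i + 1) m) = (heisDerivation n S κ i m).toLinearMap := by
    let K (j : ℕ) : Derivation ℂ (CY n S) (CY n S) :=
      mkDerivation ℂ fun v => C (if v.1.1 = j then kappaCoeff κ m v.1.2 else 0)
    simp only [kappaDerivY_eq_mkDerivation]
    refine congrArg Derivation.toLinearMap (derivation_ext
      (D₁ := theta S (-m) • (K (i - 1) - K i)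
        + theta S m • (K (i - 1) - (2 : ℂ) • K i + K (i + 1)))
      fun v => ?_)
    simp only [K, heisDerivation, Derivation.add_apply, Derivation.smul_apply, Derivation.sub_apply,
      mkDerivation_X, smul_eq_C_mul, ← C_mul, ← C_sub, ← C_add, heisCoeff, cartanA]
    have := v.2.1
    congr 1
    split_ifs <;> first | omega | ring
  have hmul : theta S (-m) • mulY S i (-m) - (if m = 0 then lam i else 0) • LinearMap.id
      = LinearMap.mulLeft ℂ (heisPoly n S lam i m) := by
    rw [← mulLeft_mulY_one]
    refine LinearMap.ext fun f => ?_
    rw [heisPoly]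
    split_ifs <;> simp [sub_mul, ← smul_eq_C_mul]
  rw [heis, add_sub_assoc, hD, hmul]

theorem heisDerivation_heisPoly (κ : Idx N → Fin (N + 1) → ℂ) (lam : ℕ → ℂ) (i : ℕ) {j : ℕ}
    (hj : 1 ≤ j ∧ j ≤ n) (m k : Idx N) :
    heisDerivation n S κ i m (heisPoly n S lam j k)
      = C (theta S (-k) * heisCoeff S κ i m j (-k)) := by
  rw [heisPoly, heisDerivation, map_sub, derivation_C, sub_zero, Derivation.map_smul]
  by_cases hk : -k ∈ S.pos
  · rw [mulY, dif_pos ⟨hj, hk⟩, LinearMap.mulLeft_apply, mul_one, mkDerivation_X, smul_eq_C_mul,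
      ← C_mul]
  · rw [theta_of_notMem hk, zero_smul, zero_mul, C_0]

theorem lie_heis {κ : Idx N → Fin (N + 1) → ℂ} (lam : ℕ → ℂ)
    (eqn1 : ∀ m : Idx N, ∑ p, (m p : ℂ) * κ m p = 0)
    (eqn2 : ∀ m k : Idx N, m ∈ S.pos → k ∈ S.pos → ∑ p, (m p : ℂ) * κ (-m - k) p = 0)
    {i j : ℕ} (hi : 1 ≤ i ∧ i ≤ n) (hj : 1 ≤ j ∧ j ≤ n) (m k : Idx N) :
    ⁅heis (n := n) S κ lam i m, heis (n := n) S κ lam j k⁆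
      = (-cartanA i j * kappaCoeff κ m (-k)) • LinearMap.id := by
  have hcoeff : theta S (-k) * heisCoeff S κ i m j (-k) - theta S (-m) * heisCoeff S κ j k i (-m)
      = -cartanA i j * kappaCoeff κ m (-k) := by
    have hsymm : cartanA j i = cartanA i j := by
      simp only [cartanA, eq_comm (a := j), or_comm]
    have hcartan : cartanA i j = 2 * (if i = j then 1 else 0) - (if i + 1 = j then 1 else 0)
        - (if j + 1 = i then 1 else 0) := by
      rw [cartanA]
      split_ifs <;> first | omega | norm_num
    rw [heisCoeff, heisCoeff, kappaCoeff_neg_swap eqn1 m k, hsymm]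
    simp only [eq_comm (a := j) (b := i)]
    linear_combination -cartanA i j * theta_mul_kappaCoeff eqn1 eqn2 m k
      + theta S (-m) * theta S (-k) * kappaCoeff κ m (-k) * hcartan
  rw [heis_eq, heis_eq, lie_derivation_add_mulLeft
      (D := heisDerivation n S κ i m) (D' := heisDerivation n S κ j k) (lie_mkDerivation_C _ _),
    heisDerivation_heisPoly κ lam i hj, heisDerivation_heisPoly κ lam j hi, ← C_sub, hcoeff]
  exact LinearMap.ext fun f => (smul_eq_C_mul f _).symm

end Heisenberg

section FreeFieldsFock

variable {n N : ℕ} {S : SignDecomposition N}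

/-- Row and column indices `1, …, n + 1`. -/
abbrev Pos (n : ℕ) : Type := Finset.Icc 1 (n + 1)

/-- The operators `∑_{r ≥ b} Φ(b_r)(m)` on `ℂ[y]`. -/
def heisTail (n : ℕ) {N : ℕ} (S : SignDecomposition N) (κ : Idx N → Fin (N + 1) → ℂ) (lam : ℕ → ℂ)
    (b : Pos n) (m : Idx N) : CY n S →ₗ[ℂ] CY n S :=
  ∑ r ∈ Finset.Icc (b : ℕ) n, heis S κ lam r m

/-- The fields `Ψ_b = ∑_{r ≥ b} Φ(b_r)` attached to the diagonal matrix units; thus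
`Ψ_r - Ψ_{r+1} = Φ(b_r)` and `Ψ_{n+1} = 0`. -/
def psiField (n : ℕ) {N : ℕ} (S : SignDecomposition N) (κ : Idx N → Fin (N + 1) → ℂ) (lam : ℕ → ℂ)
    (b : Pos n) : OpSeries N (Fock n S) :=
  ∑ r ∈ Finset.Icc (b : ℕ) n, PhiF n S κ lam r

theorem psiField_apply (κ : Idx N → Fin (N + 1) → ℂ) (lam : ℕ → ℂ) (b : Pos n) (m : Idx N) :
    psiField n S κ lam b m = (heisTail n S κ lam b m).lTensor (CX n N) := by
  rw [psiField, Finset.sum_apply]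
  refine Eq.trans (Finset.sum_congr rfl fun r hr => ?_)
    (map_sum (LinearMap.lTensorHom (R := ℂ) (CX n N)) _ _).symm
  have hr : r ≠ 0 :=
    (Nat.lt_of_lt_of_le (Finset.mem_Icc.1 b.2).1 (Finset.mem_Icc.1 hr).1).ne'
  rw [PhiF, heisAll, if_neg hr]
  rfl

/-- The Gram matrix of the fields `Ψ_b`, split as the identity, a function of `b` and a function
of `c`. -/
def gram (n : ℕ) (b c : Pos n) : ℂ :=
  (if b = c then 1 else 0) + (1 - if (b : ℕ) = n + 1 then 1 else 0)
    + -(if (c : ℕ) = n + 1 then 1 else 0)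

theorem sum_Icc_sub_succ {G : Type*} [AddCommGroup G] (F : ℕ → G) {c n : ℕ} (h : c ≤ n + 1) :
    ∑ s ∈ Finset.Icc c n, (F s - F (s + 1)) = F c - F (n + 1) := by
  rw [← neg_sub (F (n + 1)), ← Finset.sum_Ico_sub F h, ← Finset.sum_neg_distrib]
  exact Finset.sum_congr (by ext; simp) fun s _ => (neg_sub _ _).symm

theorem sum_cartanA (b c : Pos n) :
    ∑ r ∈ Finset.Icc (b : ℕ) n, ∑ s ∈ Finset.Icc (c : ℕ) n, cartanA r s = gram n b c := by
  let δ : ℕ → ℕ → ℂ := fun r s => if r = s then 1 else 0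
  have h_second_difference (r s : ℕ) :
      cartanA r s = (δ r s - δ r (s + 1)) - (δ (r + 1) s - δ (r + 1) (s + 1)) := by
    simp only [cartanA, δ]
    split_ifs <;> first | omega | norm_num
  have h_row (r : ℕ) : ∑ s ∈ Finset.Icc (c : ℕ) n, cartanA r s
      = (δ r c - δ r (n + 1)) - (δ (r + 1) c - δ (r + 1) (n + 1)) := by
    simp only [h_second_difference]
    rw [Finset.sum_sub_distrib, sum_Icc_sub_succ (δ r) (Finset.mem_Icc.1 c.2).2,
      sum_Icc_sub_succ (δ (r + 1)) (Finset.mem_Icc.1 c.2).2]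
  simp only [h_row]
  rw [sum_Icc_sub_succ (fun r => δ r c - δ r (n + 1)) (Finset.mem_Icc.1 b.2).2]
  simp only [δ, gram, Subtype.ext_iff, eq_comm (a := n + 1) (b := (c : ℕ))]
  split_ifs <;> norm_num at *

theorem lie_heisTail {κ : Idx N → Fin (N + 1) → ℂ} (lam : ℕ → ℂ)
    (eqn1 : ∀ m : Idx N, ∑ p, (m p : ℂ) * κ m p = 0)
    (eqn2 : ∀ m k : Idx N, m ∈ S.pos → k ∈ S.pos → ∑ p, (m p : ℂ) * κ (-m - k) p = 0)
    (b c : Pos n) (m k : Idx N) :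
    ⁅heisTail n S κ lam b m, heisTail n S κ lam c k⁆
      = (-gram n b c * kappaCoeff κ m (-k)) • LinearMap.id := by
  have mem {b : Pos n} {r : ℕ} (hr : r ∈ Finset.Icc (b : ℕ) n) : 1 ≤ r ∧ r ≤ n :=
    ⟨(Finset.mem_Icc.1 b.2).1.trans (Finset.mem_Icc.1 hr).1, (Finset.mem_Icc.1 hr).2⟩
  rw [heisTail, heisTail, LieRing.of_associative_ring_bracket, Finset.sum_mul_sum,
    Finset.sum_mul_sum, Finset.sum_comm (s := Finset.Icc (c : ℕ) n), ← sum_cartanA]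
  simp only [← Finset.sum_sub_distrib, ← Finset.sum_neg_distrib, Finset.sum_mul, Finset.sum_smul]
  exact Finset.sum_congr rfl fun r hr => Finset.sum_congr rfl fun s hs =>
    lie_heis lam eqn1 eqn2 (mem hr) (mem hs) m k

theorem freeFields_fock {κ : Idx N → Fin (N + 1) → ℂ} (lam : ℕ → ℂ)
    (eqn1 : ∀ m : Idx N, ∑ p, (m p : ℂ) * κ m p = 0)
    (eqn2 : ∀ m k : Idx N, m ∈ S.pos → k ∈ S.pos → ∑ p, (m p : ℂ) * κ (-m - k) p = 0) :
    FreeFields κ (aFields S) (psiField n S κ lam) (gram n) where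
  kappa := eqn1
  implements_a := implements_aFields S
  a_a := lie_aFields S
  a_psi α b m k := by
    rw [psiField_apply]
    exact lie_rTensor_lTensor _ _
  implements_psi b m := implements_of_X fun β s => by
    rw [Derivation.coe_zero, Pi.zero_apply, modes_zero, Pi.zero_apply, modes_X_eq_rTensor,
      psiField_apply, lie_lTensor_rTensor]
  psi_psi b c m k := by
    rw [psiField_apply, psiField_apply, lie_lTensor, lie_heisTail lam eqn1 eqn2,
      LinearMap.lTensor_smul, LinearMap.lTensor_id, kappaDot_apply, smul_smul, kappaCoeff,
      neg_add]

end FreeFieldsFock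

/-! ### Currents on the big cell -/

section Cell

variable {n : ℕ}

instance : Fintype (Pair n) :=
  Fintype.subtype ((Finset.Icc 1 (n + 1) ×ˢ Finset.Icc 1 (n + 1)).filter fun p => p.1 < p.2)
    fun p => by
      simp only [Finset.mem_filter, Finset.mem_product, Finset.mem_Icc]
      omega

theorem sum_pair {O : Type*} [AddCommMonoid O] (F : ℕ → ℕ → O) :
    ∑ α : Pair n, F α.1.1 α.1.2
      = ∑ i ∈ Finset.Icc 1 (n + 1), ∑ j ∈ Finset.Icc (i + 1) (n + 1), F i j := by
  rw [Finset.sum_sigma']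
  refine Finset.sum_bij' (fun α _ => ⟨α.1.1, α.1.2⟩)
    (fun ij hij => ⟨(ij.1, ij.2), by simp only [Finset.mem_sigma, Finset.mem_Icc] at hij; omega⟩)
    (fun α _ => ?_) (fun _ _ => Finset.mem_univ _) (fun _ _ => rfl) (fun _ _ => rfl)
    (fun _ _ => rfl)
  have := α.2
  simp only [Finset.mem_sigma, Finset.mem_Icc]
  omega

/-- The variable attached to `a^*_{ij}` (`0` unless `0 < i < j ≤ n + 1`). -/
def uVar (n i j : ℕ) : MvPolynomial (Pair n) ℂ :=
  if h : 0 < i ∧ i < j ∧ j ≤ n + 1 then X ⟨(i, j), h⟩ else 0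

theorem uVar_of_le {i j : ℕ} (h : j ≤ i) : uVar n i j = 0 :=
  dif_neg fun hij => hij.2.1.not_ge h

theorem uVar_pair (α : Pair n) : uVar n α.1.1 α.1.2 = X α :=
  dif_pos α.2

/-- The entries of the generic upper unitriangular matrix, for rows and columns in `ℕ`. -/
def uEnt (n i j : ℕ) : MvPolynomial (Pair n) ℂ := (if i = j then 1 else 0) - uVar n i j

theorem uEnt_self (i : ℕ) : uEnt n i i = 1 := by
  rw [uEnt, if_pos rfl, uVar_of_le le_rfl, sub_zero]

theorem uEnt_of_lt {i j : ℕ} (h : i < j) : uEnt n i j = -uVar n i j := by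
  rw [uEnt, if_neg h.ne, zero_sub]

theorem uEnt_of_gt {i j : ℕ} (h : j < i) : uEnt n i j = 0 := by
  rw [uEnt, if_neg h.ne', uVar_of_le h.le, sub_zero]

/-- The generic upper unitriangular matrix. -/
def uMat (n : ℕ) : Matrix (Pos n) (Pos n) (MvPolynomial (Pair n) ℂ) :=
  Matrix.of fun i j => uEnt n i j

theorem uMat_apply (i j : Pos n) : uMat n i j = uEnt n i j := rfl

theorem det_uMat (n : ℕ) : (uMat n).det = 1 := by
  have h : (uMat n).IsUpperTriangular := fun i j hij => uEnt_of_gt hij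
  rw [Matrix.det_of_isUpperTriangular h]
  exact Finset.prod_eq_one fun i _ => uEnt_self _

theorem uMat_mul_inv (n : ℕ) : uMat n * (uMat n)⁻¹ = 1 :=
  Matrix.mul_nonsing_inv _ (det_uMat n ▸ isUnit_one)

theorem inv_mul_uMat (n : ℕ) : (uMat n)⁻¹ * uMat n = 1 :=
  Matrix.nonsing_inv_mul _ (det_uMat n ▸ isUnit_one)

/-- The row index of a pair. -/
def pairRow (α : Pair n) : Pos n :=
  ⟨α.1.1, Finset.mem_Icc.2 ⟨α.2.1, α.2.2.1.le.trans α.2.2.2⟩⟩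

/-- The column index of a pair. -/
def pairCol (α : Pair n) : Pos n :=
  ⟨α.1.2, Finset.mem_Icc.2 ⟨α.2.1.trans α.2.2.1, α.2.2.2⟩⟩

/-- The infinitesimal action of a matrix on the big cell. -/
def cellAction (n : ℕ) (M : Matrix (Pos n) (Pos n) ℂ) :
    Derivation ℂ (MvPolynomial (Pair n) ℂ) (MvPolynomial (Pair n) ℂ) :=
  mkDerivation ℂ fun α =>
    -(upper (conj (uMat n) (uMat n)⁻¹ M) * uMat n) (pairRow α) (pairCol α)

theorem upper_mul_uMat_of_le (M : Matrix (Pos n) (Pos n) (MvPolynomial (Pair n) ℂ)) {i j : Pos n}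
    (hij : j ≤ i) : (upper M * uMat n) i j = 0 := by
  rw [Matrix.mul_apply]
  refine Finset.sum_eq_zero fun s _ => ?_
  rw [upper_apply]
  split_ifs with his
  · rw [uMat_apply, uEnt_of_gt (show (j : ℕ) < s from hij.trans_lt his), mul_zero]
  · rw [zero_mul]

theorem uMat_map_cellAction (M : Matrix (Pos n) (Pos n) ℂ) :
    (uMat n).map (cellAction n M) = upper (conj (uMat n) (uMat n)⁻¹ M) * uMat n := by
  ext1 i j
  rw [Matrix.map_apply, uMat_apply]
  rcases lt_trichotomy i j with hij | rfl | hij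
  · have hi : 0 < (i : ℕ) := (Finset.mem_Icc.1 i.2).1
    have hj := (Finset.mem_Icc.1 j.2).2
    rw [uEnt_of_lt (show (i : ℕ) < j from hij), uVar, dif_pos ⟨hi, hij, hj⟩, map_neg, cellAction,
      mkDerivation_X, neg_neg]
    rfl
  · rw [upper_mul_uMat_of_le _ le_rfl, uEnt_self, Derivation.map_one_eq_zero]
  · rw [upper_mul_uMat_of_le _ hij.le, uEnt_of_gt (show (j : ℕ) < i from hij), map_zero]

/-- The big cell of upper unitriangular matrices. -/
def cell (n : ℕ) : BigCell (Pos n) (Pair n) where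
  U := uMat n
  V := (uMat n)⁻¹
  U_mul_V := uMat_mul_inv n
  V_mul_U := inv_mul_uMat n
  row := pairRow
  col := pairCol
  X_eq α := by
    rw [uMat_apply, uEnt_of_lt (show (pairRow α : ℕ) < pairCol α from α.2.2.1), neg_neg]
    exact (uVar_pair α).symm
  P := cellAction n
  map_P := uMat_map_cellAction

/-- The entries of the inverse of the generic unitriangular matrix, for rows and columns in `ℕ`. -/
def vEnt (n i j : ℕ) : MvPolynomial (Pair n) ℂ :=
  if h : i ∈ Finset.Icc 1 (n + 1) ∧ j ∈ Finset.Icc 1 (n + 1) then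
    (uMat n)⁻¹ ⟨i, h.1⟩ ⟨j, h.2⟩ else 0

theorem inv_uMat_apply (i j : Pos n) : (uMat n)⁻¹ i j = vEnt n i j := by
  rw [vEnt, dif_pos ⟨i.2, j.2⟩]

theorem sum_vEnt_mul_uEnt (i j : Pos n) :
    ∑ s ∈ Finset.Icc 1 (n + 1), vEnt n i s * uEnt n s j = if (i : ℕ) = j then 1 else 0 := by
  have hij := congrFun (congrFun (inv_mul_uMat n) i) j
  simp only [Matrix.mul_apply, Matrix.one_apply, inv_uMat_apply, uMat_apply, Subtype.ext_iff]
    at hij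
  rw [← hij, Finset.sum_coe_sort (Finset.Icc 1 (n + 1)) fun s => vEnt n i s * uEnt n s j]

theorem sum_vEnt_mul_uEnt_of_le {p r : ℕ} (q : Pos n) (hp : 1 ≤ p ∧ p ≤ r) (hr : r ≤ n + 1) :
    ∑ s ∈ Finset.Icc 1 r, vEnt n q s * uEnt n s p = if (q : ℕ) = p then 1 else 0 := by
  rw [← sum_vEnt_mul_uEnt q ⟨p, Finset.mem_Icc.2 ⟨hp.1, hp.2.trans hr⟩⟩]
  refine Finset.sum_subset (Finset.Icc_subset_Icc_right hr) fun s hs hs' => ?_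
  rw [Finset.mem_Icc] at hs hs'
  rw [uEnt_of_gt (show p < s by omega), mul_zero]

theorem vEnt_rec {i j : ℕ} (hi : i ∈ Finset.Icc 1 (n + 1)) (hj : j ∈ Finset.Icc 1 (n + 1)) :
    vEnt n i j = (if i = j then 1 else 0)
      + ∑ s ∈ Finset.Icc 1 (j - 1), vEnt n i s * uVar n s j := by
  have hsum := sum_vEnt_mul_uEnt ⟨i, hi⟩ ⟨j, hj⟩
  simp only [uEnt, mul_sub, Finset.sum_sub_distrib, mul_ite, mul_one, mul_zero,
    Finset.sum_ite_eq', hj, if_true] at hsum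
  rw [← hsum, Finset.sum_subset (Finset.Icc_subset_Icc_right
    ((Nat.sub_le j 1).trans (Finset.mem_Icc.1 hj).2)), sub_add_cancel]
  intro s hs hs'
  rw [Finset.mem_Icc] at hs hs'
  rw [uVar_of_le (by omega), mul_zero]

theorem vEnt_of_gt {i j : ℕ} (h : j < i) : vEnt n i j = 0 := by
  induction j using Nat.strong_induction_on with
  | _ j ih =>
    by_cases hij : i ∈ Finset.Icc 1 (n + 1) ∧ j ∈ Finset.Icc 1 (n + 1)
    · rw [vEnt_rec hij.1 hij.2, if_neg h.ne', zero_add]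
      refine Finset.sum_eq_zero fun s hs => ?_
      rw [Finset.mem_Icc] at hs
      rw [ih s (by omega) (by omega), zero_mul]
    · rw [vEnt, dif_neg hij]

theorem vEnt_self {i : ℕ} (hi : i ∈ Finset.Icc 1 (n + 1)) : vEnt n i i = 1 := by
  rw [vEnt_rec hi hi, if_pos rfl, add_eq_left]
  refine Finset.sum_eq_zero fun s hs => ?_
  rw [Finset.mem_Icc] at hs
  rw [vEnt_of_gt (by omega), zero_mul]

theorem sum_vEnt_of_lt {q i : ℕ} (hi : i < q) (f : ℕ → MvPolynomial (Pair n) ℂ) :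
    ∑ s ∈ Finset.Icc 1 i, vEnt n q s * f s = 0 := by
  refine Finset.sum_eq_zero fun s hs => ?_
  rw [vEnt_of_gt ((Finset.mem_Icc.1 hs).2.trans_lt hi), zero_mul]

theorem sum_vEnt_self {q : ℕ} (hq : q ∈ Finset.Icc 1 (n + 1)) (f : ℕ → MvPolynomial (Pair n) ℂ) :
    ∑ s ∈ Finset.Icc 1 q, vEnt n q s * f s = f q := by
  obtain ⟨p, rfl⟩ := Nat.exists_eq_add_of_le' (Finset.mem_Icc.1 hq).1
  rw [Finset.sum_Icc_succ_top p.succ_pos, sum_vEnt_of_lt p.lt_succ_self, zero_add, vEnt_self hq,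
    one_mul]

theorem vEnt_succ {i : ℕ} (hi : 1 ≤ i ∧ i ≤ n) : vEnt n i (i + 1) = uVar n i (i + 1) := by
  have hmem : i ∈ Finset.Icc 1 (n + 1) := Finset.mem_Icc.2 ⟨hi.1, hi.2.trans n.le_succ⟩
  have hmem' : i + 1 ∈ Finset.Icc 1 (n + 1) := Finset.mem_Icc.2 ⟨i.succ_pos, by omega⟩
  rw [vEnt_rec hmem hmem', if_neg i.lt_succ_self.ne, zero_add, Nat.add_sub_cancel,
    sum_vEnt_self hmem fun s => uVar n s (i + 1)]

theorem sum_vEnt_succ {q : ℕ} (hq : 1 ≤ q ∧ q ≤ n) (f : ℕ → MvPolynomial (Pair n) ℂ) :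
    ∑ s ∈ Finset.Icc 1 (q + 1), vEnt n q s * f s = f q + uVar n q (q + 1) * f (q + 1) := by
  rw [Finset.sum_Icc_succ_top q.succ_pos,
    sum_vEnt_self (Finset.mem_Icc.2 ⟨hq.1, hq.2.trans n.le_succ⟩), vEnt_succ hq]

/-- Row `q` of `U⁻¹`, cut to its columns beyond `i`, times `U`; it is written as the difference
of row `q` of `U⁻¹ * U = 1` and the complementary sum. -/
def vTail (n q i j : ℕ) : MvPolynomial (Pair n) ℂ :=
  (if q = j then 1 else 0) - ∑ s ∈ Finset.Icc 1 i, vEnt n q s * uEnt n s j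

theorem sum_filter_lt_vEnt_mul_uEnt (i q j : Pos n) :
    ∑ s ∈ Finset.Icc 1 (n + 1) with (i : ℕ) < s, vEnt n q s * uEnt n s j = vTail n q i j := by
  have hi := (Finset.mem_Icc.1 i.2).2
  have hfilter : (Finset.Icc 1 (n + 1)).filter (fun s => ¬ (i : ℕ) < s) = Finset.Icc 1 (i : ℕ) := by
    ext s
    simp only [Finset.mem_filter, Finset.mem_Icc]
    omega
  rw [vTail, ← sum_vEnt_mul_uEnt, ← Finset.sum_filter_add_sum_filter_not (Finset.Icc 1 (n + 1))
    (fun s => (i : ℕ) < s), hfilter, add_sub_cancel_right]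

theorem upper_conj_single_mul (p q : Pos n) (c : ℂ) (i j : Pos n) :
    (upper (conj (uMat n) (uMat n)⁻¹ (Matrix.single p q c)) * uMat n) i j
      = c • (uEnt n i p * vTail n q i j) := by
  have hterm (s : Pos n) :
      upper (conj (uMat n) (uMat n)⁻¹ (Matrix.single p q c)) i s * uMat n s j
        = c • (uEnt n i p * if (i : ℕ) < s then vEnt n q s * uEnt n s j else 0) := by
    rw [upper_apply, conj_single, uMat_apply, uMat_apply, inv_uMat_apply, ite_mul, zero_mul,
      mul_ite, smul_ite, mul_zero, smul_zero, smul_mul_assoc, mul_assoc]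
    rfl
  rw [Matrix.mul_apply, Finset.sum_congr rfl fun s _ => hterm s, ← Finset.smul_sum,
    ← Finset.mul_sum, Finset.sum_coe_sort (Finset.Icc 1 (n + 1))
      fun s => if (i : ℕ) < s then vEnt n q s * uEnt n s j else 0, ← Finset.sum_filter,
    sum_filter_lt_vEnt_mul_uEnt]

theorem vTail_of_lt {q i : ℕ} (h : i < q) (j : ℕ) : vTail n q i j = if q = j then 1 else 0 := by
  rw [vTail, sum_vEnt_of_lt h, sub_zero]

theorem vTail_eq_sum {q i j : ℕ} (hq : q ≠ j) (hij : i < j) :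
    vTail n q i j = ∑ s ∈ Finset.Icc 1 i, vEnt n q s * uVar n s j := by
  rw [vTail, if_neg hq, zero_sub, ← Finset.sum_neg_distrib]
  refine Finset.sum_congr rfl fun s hs => ?_
  rw [uEnt_of_lt ((Finset.mem_Icc.1 hs).2.trans_lt hij), mul_neg, neg_neg]

theorem vTail_self {q j : ℕ} (hq : q ∈ Finset.Icc 1 (n + 1)) (h : q < j) :
    vTail n q q j = uVar n q j := by
  rw [vTail_eq_sum h.ne h, sum_vEnt_self hq fun s => uVar n s j]

theorem vTail_succ {q j : ℕ} (hq : 1 ≤ q ∧ q ≤ n) (h : q + 1 < j) :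
    vTail n q (q + 1) j = uVar n q j + uVar n q (q + 1) * uVar n (q + 1) j := by
  rw [vTail_eq_sum (by omega) h, sum_vEnt_succ hq fun s => uVar n s j]

end Cell

section CellCurrent

variable {n N : ℕ} {W : Type*} [AddCommGroup W] [Module ℂ W] [CommutingFields (Pair n) N W]

/-- The current of a matrix on the big cell. Here `Φ r` is the field of the `r`-th simple coroot,
so that the field of the `b`-th diagonal matrix unit is `∑_{r ≥ b} Φ r`. -/
def cellCurrent (κ : Idx N → Fin (N + 1) → ℂ) (A : ℕ → ℕ → OpSeries N W) (Φ : ℕ → OpSeries N W)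
    (M : Matrix (Pos n) (Pos n) ℂ) : OpSeries N W :=
  matrixCurrent κ (fun α : Pair n => A α.1.1 α.1.2)
    (fun b : Pos n => ∑ r ∈ Finset.Icc (b : ℕ) n, Φ r) (cell n) M

section RowTail

variable {O : Type*} [AddCommGroup O] [Module (MvPolynomial (Pair n) ℂ) O] (A : ℕ → ℕ → O)

/-- The combination of `A i (i + 1), …, A i (n + 1)` whose coefficients form the `i`-th row of
`(U e_{pq} U⁻¹)_+ U`, up to the factor `U_{ip}`. -/
def rowTail (n : ℕ) {O : Type*} [AddCommGroup O] [Module (MvPolynomial (Pair n) ℂ) O]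
    (A : ℕ → ℕ → O) (q i : ℕ) : O :=
  ∑ j ∈ Finset.Icc (i + 1) (n + 1), vTail n q i j • A i j

theorem rowTail_of_lt {q i : ℕ} (hi : i < q) (hq : q ≤ n + 1) : rowTail n A q i = A i q := by
  simp only [rowTail, vTail_of_lt hi, ite_smul, one_smul, zero_smul]
  rw [Finset.sum_ite_eq, if_pos (Finset.mem_Icc.2 ⟨hi, hq⟩)]

theorem rowTail_self {q : ℕ} (hq : q ∈ Finset.Icc 1 (n + 1)) :
    rowTail n A q q = ∑ j ∈ Finset.Icc (q + 1) (n + 1), uVar n q j • A q j :=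
  Finset.sum_congr rfl fun j hj => by rw [vTail_self hq (Finset.mem_Icc.1 hj).1]

theorem rowTail_succ {q : ℕ} (hq : 1 ≤ q ∧ q ≤ n) :
    rowTail n A q (q + 1) = ∑ j ∈ Finset.Icc (q + 2) (n + 1), uVar n q j • A (q + 1) j
      + uVar n q (q + 1) •
        ∑ j ∈ Finset.Icc (q + 2) (n + 1), uVar n (q + 1) j • A (q + 1) j := by
  rw [Finset.smul_sum, ← Finset.sum_add_distrib]
  refine Finset.sum_congr rfl fun j hj => ?_
  rw [vTail_succ hq (Finset.mem_Icc.1 hj).1, add_smul, mul_smul]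

end RowTail

variable {κ : Idx N → Fin (N + 1) → ℂ} {A : ℕ → ℕ → OpSeries N W} {Φ : ℕ → OpSeries N W}

theorem cellCurrent_sub (M M' : Matrix (Pos n) (Pos n) ℂ) :
    cellCurrent κ A Φ (M - M') = cellCurrent κ A Φ M - cellCurrent κ A Φ M' :=
  matrixCurrent_sub _ _ _

theorem kappaDerivation_uEnt (i j : ℕ) :
    kappaDerivation (V := W) κ (uEnt n i j) = -kappaDerivation κ (uVar n i j) := by
  rw [uEnt, map_sub]
  split_ifs
  · rw [Derivation.map_one_eq_zero, zero_sub]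
  · rw [map_zero, zero_sub]

theorem sum_smul_sum_tail {O : Type*} [AddCommGroup O] [Module (MvPolynomial (Pair n) ℂ) O]
    (d : ℕ → MvPolynomial (Pair n) ℂ) (Φ : ℕ → O) :
    ∑ i : Pos n, d i • ∑ r ∈ Finset.Icc (i : ℕ) n, Φ r
      = ∑ r ∈ Finset.Icc 1 n, (∑ b ∈ Finset.Icc 1 r, d b) • Φ r := by
  simp only [Finset.smul_sum, Finset.sum_smul]
  rw [Finset.sum_coe_sort (Finset.Icc 1 (n + 1)) fun i => ∑ r ∈ Finset.Icc i n, d i • Φ r]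
  refine Finset.sum_comm' fun x y => ?_
  simp only [Finset.mem_Icc]
  omega

theorem sum_Icc_uEnt_smul {O : Type*} [AddCommGroup O] [Module (MvPolynomial (Pair n) ℂ) O]
    {p : ℕ} (hp : p ≤ n + 1) (f : ℕ → O) :
    ∑ i ∈ Finset.Icc 1 (n + 1), uEnt n i p • f i = ∑ i ∈ Finset.Icc 1 p, uEnt n i p • f i := by
  symm
  refine Finset.sum_subset (Finset.Icc_subset_Icc_right hp) fun i hi hi' => ?_
  rw [Finset.mem_Icc] at hi hi'
  rw [uEnt_of_gt (show p < i by omega), zero_smul]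

theorem sum_P_single_smul (A : ℕ → ℕ → OpSeries N W) (p q : Pos n) (c : ℂ) :
    ∑ α, (cell n).P (Matrix.single p q c) (X α) • A α.1.1 α.1.2
      = -c • ∑ i ∈ Finset.Icc 1 (p : ℕ), uEnt n i p • rowTail n A q i := by
  have hterm (α : Pair n) : (cell n).P (Matrix.single p q c) (X α) • A α.1.1 α.1.2
      = -c • uEnt n α.1.1 p • vTail n q α.1.1 α.1.2 • A α.1.1 α.1.2 := by
    have hP : (cell n).P (Matrix.single p q c) (X α)
        = -(c • (uEnt n α.1.1 p * vTail n q α.1.1 α.1.2)) := by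
      rw [(cell n).P_X]
      exact congrArg Neg.neg (upper_conj_single_mul p q c (pairRow α) (pairCol α))
    rw [hP, neg_smul, smul_assoc, mul_smul, neg_smul]
  rw [← sum_Icc_uEnt_smul (Finset.mem_Icc.1 p.2).2, Finset.sum_congr rfl fun α _ => hterm α,
    ← Finset.smul_sum, sum_pair fun i j => uEnt n i p • vTail n q i j • A i j]
  simp only [rowTail, Finset.smul_sum]

theorem sum_conj_single_smul (p q : Pos n) (c : ℂ) :
    ∑ i : Pos n, conj (uMat n) (uMat n)⁻¹ (Matrix.single p q c) i i •
        ∑ r ∈ Finset.Icc (i : ℕ) n, Φ r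
      = c • ∑ r ∈ Finset.Icc 1 n, (∑ b ∈ Finset.Icc 1 r, vEnt n q b * uEnt n b p) • Φ r := by
  simp only [← sum_smul_sum_tail, conj_single, uMat_apply, inv_uMat_apply, smul_assoc,
    Finset.smul_sum, mul_comm]

theorem traceD_single_mul_inv_uMat (p q : Pos n) (c : ℂ) :
    traceD (kappaDerivation (V := W) κ) (constMat _ (Matrix.single p q c) * (uMat n)⁻¹) (uMat n)
      = -c • ∑ b ∈ Finset.Icc 1 (n + 1), vEnt n q b • kappaDerivation κ (uVar n b p) := by
  simp only [traceD_constMat_single_mul, inv_uMat_apply, uMat_apply, kappaDerivation_uEnt,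
    smul_neg, Finset.sum_neg_distrib, neg_smul]
  rw [Finset.sum_coe_sort (Finset.Icc 1 (n + 1))
    fun b => vEnt n q b • kappaDerivation (V := W) κ (uVar n b p)]

theorem cellCurrent_single (p q : Pos n) (c : ℂ) :
    cellCurrent κ A Φ (Matrix.single p q c)
      = -c • (∑ i ∈ Finset.Icc 1 (p : ℕ), uEnt n i p • rowTail n A q i
        + ∑ r ∈ Finset.Icc 1 n, (∑ b ∈ Finset.Icc 1 r, vEnt n q b * uEnt n b p) • Φ r
        - ∑ b ∈ Finset.Icc 1 (n + 1), vEnt n q b • kappaDerivation κ (uVar n b p)) := by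
  rw [cellCurrent, matrixCurrent_eq, sum_P_single_smul]
  refine (congrArg₂ (fun F G => _ - F - G) (sum_conj_single_smul p q c)
    (traceD_single_mul_inv_uMat p q c)).trans ?_
  module

theorem sum_vEnt_smul_kappaDerivation_of_le {p q : ℕ} (h : p ≤ q) :
    ∑ b ∈ Finset.Icc 1 (n + 1), vEnt n q b • kappaDerivation (V := W) κ (uVar n b p) = 0 := by
  refine Finset.sum_eq_zero fun b _ => ?_
  rcases lt_or_ge b q with hb | hb
  · rw [vEnt_of_gt hb, zero_smul]
  · rw [uVar_of_le (h.trans hb), map_zero, smul_zero]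

theorem sum_vEnt_smul_kappaDerivation_succ {q : ℕ} (hq : q ∈ Finset.Icc 1 (n + 1)) :
    ∑ b ∈ Finset.Icc 1 (n + 1), vEnt n q b • kappaDerivation (V := W) κ (uVar n b (q + 1))
      = kappaDerivation κ (uVar n q (q + 1)) := by
  rw [Finset.sum_eq_single_of_mem q hq, vEnt_self hq, one_smul]
  intro b _ hb
  rcases lt_or_gt_of_ne hb with hb | hb
  · rw [vEnt_of_gt hb, zero_smul]
  · rw [uVar_of_le hb, map_zero, smul_zero]

theorem cellCurrent_single_of_lt {p q : Pos n} (hpq : p < q) (c : ℂ) :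
    cellCurrent κ A Φ (Matrix.single p q c)
      = -c • ∑ i ∈ Finset.Icc 1 (p : ℕ), uEnt n i p • A i q := by
  have hp := Finset.mem_Icc.1 p.2
  have hpq' : (p : ℕ) < q := hpq
  have hcartan : ∑ r ∈ Finset.Icc 1 n, (∑ b ∈ Finset.Icc 1 r, vEnt n q b * uEnt n b p) • Φ r
      = 0 := by
    refine Finset.sum_eq_zero fun r hr => ?_
    rw [Finset.mem_Icc] at hr
    rcases lt_or_ge r q with hrq | hrq
    · rw [sum_vEnt_of_lt hrq, zero_smul]
    · rw [sum_vEnt_mul_uEnt_of_le q ⟨hp.1, hpq'.le.trans hrq⟩ (hr.2.trans n.le_succ),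
        if_neg hpq'.ne', zero_smul]
  rw [cellCurrent_single, hcartan, sum_vEnt_smul_kappaDerivation_of_le hpq'.le, add_zero, sub_zero]
  congr 1
  refine Finset.sum_congr rfl fun i hi => ?_
  rw [rowTail_of_lt A ((Finset.mem_Icc.1 hi).2.trans_lt hpq') (Finset.mem_Icc.1 q.2).2]

theorem sum_Icc_pred_uEnt_smul {p q : ℕ} (hq : 1 ≤ q) (hpq : q ≤ p) (hp : p ≤ n + 1) :
    ∑ i ∈ Finset.Icc 1 (q - 1), uEnt n i p • rowTail n A q i
      = -∑ i ∈ Finset.Icc 1 (q - 1), uVar n i p • A i q := by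
  rw [← Finset.sum_neg_distrib]
  refine Finset.sum_congr rfl fun i hi => ?_
  rw [Finset.mem_Icc] at hi
  rw [uEnt_of_lt (show i < p by omega), rowTail_of_lt A (by omega) (hpq.trans hp), neg_smul]

theorem sum_Icc_eq_sum_pred_add {O : Type*} [AddCommMonoid O] {p : ℕ} (hp : 1 ≤ p) (f : ℕ → O) :
    ∑ i ∈ Finset.Icc 1 p, f i = ∑ i ∈ Finset.Icc 1 (p - 1), f i + f p := by
  obtain ⟨p, rfl⟩ := Nat.exists_eq_add_of_le' hp
  exact Finset.sum_Icc_succ_top hp f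

theorem cellCurrent_single_self (p : Pos n) :
    cellCurrent κ A Φ (Matrix.single p p 1)
      = ∑ i ∈ Finset.Icc 1 ((p : ℕ) - 1), uVar n i p • A i p
        - ∑ j ∈ Finset.Icc ((p : ℕ) + 1) (n + 1), uVar n p j • A p j
        - ∑ r ∈ Finset.Icc (p : ℕ) n, Φ r := by
  have hp := Finset.mem_Icc.1 p.2
  have hcartan : ∑ r ∈ Finset.Icc 1 n, (∑ b ∈ Finset.Icc 1 r, vEnt n p b * uEnt n b p) • Φ r
      = ∑ r ∈ Finset.Icc (p : ℕ) n, Φ r := by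
    rw [← Finset.sum_subset (Finset.Icc_subset_Icc_left hp.1)]
    · refine Finset.sum_congr rfl fun r hr => ?_
      rw [Finset.mem_Icc] at hr
      rw [sum_vEnt_mul_uEnt_of_le p ⟨hp.1, hr.1⟩ (hr.2.trans n.le_succ), if_pos rfl, one_smul]
    · intro r hr hr'
      rw [Finset.mem_Icc] at hr hr'
      rw [sum_vEnt_of_lt (by omega), zero_smul]
  rw [cellCurrent_single, hcartan, sum_vEnt_smul_kappaDerivation_of_le le_rfl,
    sum_Icc_eq_sum_pred_add hp.1, sum_Icc_pred_uEnt_smul hp.1 le_rfl hp.2, uEnt_self, one_smul,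
    rowTail_self A p.2, neg_smul, one_smul]
  abel

theorem cellCurrent_single_succ {p q : Pos n} (hpq : (p : ℕ) = q + 1) :
    cellCurrent κ A Φ (Matrix.single p q 1)
      = ∑ i ∈ Finset.Icc 1 ((q : ℕ) - 1), uVar n i p • A i q
        + uVar n q p • ∑ j ∈ Finset.Icc (p : ℕ) (n + 1), uVar n q j • A q j
        - ∑ j ∈ Finset.Icc ((p : ℕ) + 1) (n + 1), uVar n q j • A p j
        - uVar n q p • ∑ j ∈ Finset.Icc ((p : ℕ) + 1) (n + 1), uVar n p j • A p j
        + uVar n q p • Φ q + kappaDerivation κ (uVar n q p) := by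
  have hp := Finset.mem_Icc.1 p.2
  have hq := Finset.mem_Icc.1 q.2
  have hqn : (q : ℕ) ≤ n := by omega
  have hcartan : ∑ r ∈ Finset.Icc 1 n, (∑ b ∈ Finset.Icc 1 r, vEnt n q b * uEnt n b p) • Φ r
      = -(uVar n q p • Φ q) := by
    rw [Finset.sum_eq_single_of_mem (q : ℕ) (Finset.mem_Icc.2 ⟨hq.1, hqn⟩), sum_vEnt_self q.2,
      uEnt_of_lt (by omega), neg_smul]
    intro r hr hrq
    rw [Finset.mem_Icc] at hr
    rcases lt_or_gt_of_ne hrq with hrq | hrq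
    · rw [sum_vEnt_of_lt hrq, zero_smul]
    · rw [sum_vEnt_mul_uEnt_of_le q ⟨hp.1, by omega⟩ (hr.2.trans n.le_succ), if_neg (by omega),
        zero_smul]
  rw [cellCurrent_single, hcartan, sum_Icc_eq_sum_pred_add hp.1, uEnt_self, one_smul]
  have hpred : (p : ℕ) - 1 = q := by omega
  rw [hpred, sum_Icc_eq_sum_pred_add hq.1, sum_Icc_pred_uEnt_smul hq.1 (by omega) hp.2, hpq,
    sum_vEnt_smul_kappaDerivation_succ q.2, rowTail_succ A ⟨hq.1, hqn⟩, rowTail_self A q.2,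
    uEnt_of_lt (Nat.lt_succ_self _)]
  module

theorem cellCurrent_single_corner {p q : Pos n} (hp : (p : ℕ) = n + 1) (hq : (q : ℕ) = 1) :
    cellCurrent κ A Φ (Matrix.single p q (-1))
      = -∑ r ∈ Finset.Icc 1 n, ∑ j ∈ Finset.Icc (r + 1) (n + 1),
          uVar n r (n + 1) • (∑ s ∈ Finset.Icc 1 r, vEnt n 1 s * uVar n s j) • A r j
        - ∑ r ∈ Finset.Icc 1 n, (∑ s ∈ Finset.Icc 1 r, vEnt n 1 s * uVar n s (n + 1)) • Φ r
        - ∑ r ∈ Finset.Icc 1 n, vEnt n 1 r • kappaDerivation κ (uVar n r (n + 1)) := by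
  have hvector : ∑ i ∈ Finset.Icc 1 (n + 1), uEnt n i (n + 1) • rowTail n A 1 i
      = -∑ r ∈ Finset.Icc 1 n, ∑ j ∈ Finset.Icc (r + 1) (n + 1),
          uVar n r (n + 1) • (∑ s ∈ Finset.Icc 1 r, vEnt n 1 s * uVar n s j) • A r j := by
    rw [Finset.sum_Icc_succ_top n.succ_pos, rowTail,
      Finset.Icc_eq_empty (Nat.not_succ_le_self (n + 1)), Finset.sum_empty, smul_zero, add_zero,
      ← Finset.sum_neg_distrib]
    refine Finset.sum_congr rfl fun r hr => ?_
    rw [Finset.mem_Icc] at hr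
    rw [uEnt_of_lt (Nat.lt_succ_of_le hr.2), neg_smul, rowTail, Finset.smul_sum]
    refine congrArg Neg.neg (Finset.sum_congr rfl fun j hj => ?_)
    rw [Finset.mem_Icc] at hj
    rw [vTail_eq_sum (by omega) (by omega)]
  have hcartan : ∑ r ∈ Finset.Icc 1 n, (∑ s ∈ Finset.Icc 1 r, vEnt n 1 s * uEnt n s (n + 1)) • Φ r
      = -∑ r ∈ Finset.Icc 1 n, (∑ s ∈ Finset.Icc 1 r, vEnt n 1 s * uVar n s (n + 1)) • Φ r := by
    rw [← Finset.sum_neg_distrib]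
    refine Finset.sum_congr rfl fun r hr => ?_
    rw [← neg_smul, ← Finset.sum_neg_distrib]
    refine congrArg (· • Φ r) (Finset.sum_congr rfl fun s hs => ?_)
    rw [Finset.mem_Icc] at hr hs
    rw [uEnt_of_lt (by omega), mul_neg]
  rw [cellCurrent_single, hp, hq, hvector, hcartan, Finset.sum_Icc_succ_top n.succ_pos,
    uVar_of_le le_rfl, map_zero, smul_zero, add_zero]
  module

end CellCurrent

section Chains

theorem mem_chains {j : ℕ} {q : Finset ℕ} :
    q ∈ chains j ↔ (∀ k ∈ q, 1 ≤ k ∧ k ≤ j) ∧ 1 ∈ q ∧ j ∈ q := by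
  simp only [chains, Finset.mem_filter, Finset.mem_powerset, Finset.subset_iff, Finset.mem_Icc]

theorem chains_one : chains 1 = {{1}} := by
  ext q
  rw [mem_chains, Finset.mem_singleton]
  refine ⟨fun h => Finset.eq_singleton_iff_unique_mem.2 ⟨h.2.1, fun k hk => ?_⟩, ?_⟩
  · exact le_antisymm (h.1 k hk).2 (h.1 k hk).1
  · rintro rfl
    simp

theorem notMem_of_mem_chains {t j : ℕ} {q : Finset ℕ} (hq : q ∈ chains t) (h : t < j) : j ∉ q :=
  fun hj => h.not_ge ((mem_chains.1 hq).1 j hj).2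

theorem eq_of_mem_chains {t t' : ℕ} {q : Finset ℕ} (h : q ∈ chains t) (h' : q ∈ chains t') :
    t = t' :=
  le_antisymm ((mem_chains.1 h').1 t (mem_chains.1 h).2.2).2
    ((mem_chains.1 h).1 t' (mem_chains.1 h').2.2).2

theorem insert_mem_chains {t j : ℕ} {q : Finset ℕ} (hq : q ∈ chains t) (h : t ≤ j) :
    insert j q ∈ chains j := by
  rw [mem_chains] at hq ⊢
  refine ⟨fun k hk => ?_, Finset.mem_insert_of_mem hq.2.1, Finset.mem_insert_self j q⟩
  have ht := hq.1 t hq.2.2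
  rcases Finset.mem_insert.1 hk with rfl | hk
  · omega
  · exact ⟨(hq.1 k hk).1, (hq.1 k hk).2.trans h⟩

theorem exists_erase_mem_chains {j : ℕ} {q : Finset ℕ} (hq : q ∈ chains j) (hj : 1 < j) :
    ∃ t ∈ q.erase j, q.erase j ∈ chains t := by
  rw [mem_chains] at hq
  have hone : 1 ∈ q.erase j := Finset.mem_erase.2 ⟨hj.ne, hq.2.1⟩
  have hmax := Finset.max'_mem (q.erase j) ⟨1, hone⟩
  exact ⟨_, hmax, mem_chains.2 ⟨fun k hk =>
    ⟨(hq.1 k (Finset.mem_of_mem_erase hk)).1, Finset.le_max' _ _ hk⟩, hone, hmax⟩⟩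

theorem sum_filter_chains {O : Type*} [AddCommMonoid O] {r j : ℕ} (hr : 1 ≤ r) (hj : r < j)
    (f : Finset ℕ → O) :
    ∑ q ∈ (chains j).filter (fun q => ∀ k ∈ q, k ≠ j → k ≤ r), f q
      = ∑ t ∈ Finset.Icc 1 r, ∑ q ∈ chains t, f (insert j q) := by
  rw [Finset.sum_sigma']
  symm
  refine Finset.sum_bij (fun x _ => insert j x.2) ?_ ?_ ?_ fun _ _ => rfl
  · rintro ⟨t, q⟩ h
    rw [Finset.mem_sigma, Finset.mem_Icc] at h
    refine Finset.mem_filter.2 ⟨insert_mem_chains h.2 (h.1.2.trans hj.le), fun k hk hkj => ?_⟩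
    exact ((mem_chains.1 h.2).1 k (Finset.mem_of_mem_insert_of_ne hk hkj)).2.trans h.1.2
  · rintro ⟨t, q⟩ h ⟨t', q'⟩ h' heq
    rw [Finset.mem_sigma, Finset.mem_Icc] at h h'
    dsimp only at h h' heq
    obtain rfl : q = q' := by
      rw [← Finset.erase_insert (notMem_of_mem_chains h.2 (h.1.2.trans_lt hj)),
        ← Finset.erase_insert (notMem_of_mem_chains h'.2 (h'.1.2.trans_lt hj))]
      exact congrArg (Finset.erase · j) heq
    obtain rfl := eq_of_mem_chains h.2 h'.2
    rfl
  · intro q hq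
    rw [Finset.mem_filter] at hq
    obtain ⟨t, ht, hqt⟩ := exists_erase_mem_chains hq.1 (hr.trans_lt hj)
    have htq := Finset.mem_erase.1 ht
    have htr := hq.2 t htq.2 htq.1
    exact ⟨⟨t, q.erase j⟩, Finset.mem_sigma.2
      ⟨Finset.mem_Icc.2 ⟨((mem_chains.1 hqt).1 t ht).1, htr⟩, hqt⟩,
      Finset.insert_erase (mem_chains.1 hq.1).2.2⟩

theorem sum_chains {O : Type*} [AddCommMonoid O] {j : ℕ} (hj : 1 < j) (f : Finset ℕ → O) :
    ∑ q ∈ chains j, f q = ∑ t ∈ Finset.Icc 1 (j - 1), ∑ q ∈ chains t, f (insert j q) := by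
  rw [← sum_filter_chains (by omega) (by omega), Finset.filter_true_of_mem]
  intro q hq k hk hkj
  have hkj' := ((mem_chains.1 hq).1 k hk).2
  omega

theorem sort_insert_of_forall_lt {q : Finset ℕ} {j : ℕ} (h : ∀ k ∈ q, k < j) :
    (insert j q).sort (· ≤ ·) = q.sort (· ≤ ·) ++ [j] := by
  have hj : j ∉ q := fun hj => lt_irrefl _ (h j hj)
  refine List.Perm.eq_of_pairwise' (r := (· ≤ ·)) (Finset.pairwise_sort _ _) ?_ ?_
  · refine List.pairwise_append.2
      ⟨Finset.pairwise_sort _ _, List.pairwise_singleton _ _, fun a ha b hb => ?_⟩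
    rw [List.mem_singleton.1 hb]
    exact (h a ((Finset.mem_sort _).1 ha)).le
  · refine (Finset.sort_perm_toList _ _).trans ((Finset.toList_insert hj).trans ?_)
    exact ((Finset.sort_perm_toList q _).symm.cons j).trans
      (List.perm_append_singleton j _).symm

theorem sort_insert_of_mem_chains {t j : ℕ} (htj : t < j) {q : Finset ℕ} (hq : q ∈ chains t) :
    (insert j q).sort (· ≤ ·) = q.sort (· ≤ ·) ++ [j] :=
  sort_insert_of_forall_lt fun k hk => ((mem_chains.1 hq).1 k hk).2.trans_lt htj

theorem sort_of_mem_chains {t : ℕ} {q : Finset ℕ} (hq : q ∈ chains t) :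
    q.sort (· ≤ ·) = (q.erase t).sort (· ≤ ·) ++ [t] := by
  rw [mem_chains] at hq
  conv_lhs => rw [← Finset.insert_erase hq.2.2]
  refine sort_insert_of_forall_lt fun k hk => ?_
  rw [Finset.mem_erase] at hk
  exact lt_of_le_of_ne (hq.1 k hk.2).2 hk.1

/-- The product `∏_l u_{q_l q_{l+1}}` over consecutive entries of a list, where `u_{ij}` is the
variable of `a^*_{ij}`. -/
def chainPoly (n : ℕ) : List ℕ → MvPolynomial (Pair n) ℂ
  | a :: b :: l => uVar n a b * chainPoly n (b :: l)
  | _ => 1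

variable {n : ℕ}

theorem chainPoly_append (l : List ℕ) (t j : ℕ) :
    chainPoly n (l ++ [t, j]) = chainPoly n (l ++ [t]) * uVar n t j := by
  induction l with
  | nil => simp [chainPoly]
  | cons a l ih =>
    cases l with
    | nil => simp [chainPoly]
    | cons b l =>
      simp only [List.cons_append, chainPoly] at ih ⊢
      rw [ih, mul_assoc]

theorem chainPoly_sort_append {t : ℕ} {q : Finset ℕ} (hq : q ∈ chains t) (j : ℕ) :
    chainPoly n (q.sort (· ≤ ·) ++ [j]) = chainPoly n (q.sort (· ≤ ·)) * uVar n t j := by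
  rw [sort_of_mem_chains hq, List.append_assoc]
  exact chainPoly_append _ t j

theorem sum_chains_chainPoly {j : ℕ} (hj : j ∈ Finset.Icc 1 (n + 1)) :
    ∑ q ∈ chains j, chainPoly n (q.sort (· ≤ ·)) = vEnt n 1 j := by
  induction j using Nat.strong_induction_on with
  | _ j ih =>
    have hj' := Finset.mem_Icc.1 hj
    rcases hj'.1.eq_or_lt with rfl | hj1
    · rw [chains_one, Finset.sum_singleton, Finset.sort_singleton, vEnt_self hj]
      rfl
    · rw [vEnt_rec (Finset.mem_Icc.2 ⟨le_rfl, n.succ_pos⟩) hj, if_neg hj1.ne, zero_add,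
        sum_chains hj1]
      refine Finset.sum_congr rfl fun t ht => ?_
      rw [Finset.mem_Icc] at ht
      rw [← ih t (by omega) (Finset.mem_Icc.2 (by omega)), Finset.sum_mul]
      refine Finset.sum_congr rfl fun q hq => ?_
      rw [sort_insert_of_mem_chains (by omega) hq, chainPoly_sort_append hq]

theorem sum_chains_chainPoly_append {t : ℕ} (ht : t ∈ Finset.Icc 1 (n + 1)) (j : ℕ) :
    ∑ q ∈ chains t, chainPoly n (q.sort (· ≤ ·) ++ [j]) = vEnt n 1 t * uVar n t j := by
  rw [← sum_chains_chainPoly ht, Finset.sum_mul]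
  exact Finset.sum_congr rfl fun q hq => chainPoly_sort_append hq j

theorem sum_filter_chains_chainPoly {r j : ℕ} (hr : 1 ≤ r) (hj : r < j) (hrn : r ≤ n) :
    ∑ q ∈ (chains j).filter (fun q => ∀ k ∈ q, k ≠ j → k ≤ r), chainPoly n (q.sort (· ≤ ·))
      = ∑ t ∈ Finset.Icc 1 r, vEnt n 1 t * uVar n t j := by
  rw [sum_filter_chains hr hj]
  refine Finset.sum_congr rfl fun t ht => ?_
  rw [Finset.mem_Icc] at ht
  rw [← sum_chains_chainPoly_append (Finset.mem_Icc.2 (by omega)) j]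
  refine Finset.sum_congr rfl fun q hq => ?_
  rw [sort_insert_of_mem_chains (by omega) hq]

end Chains

/-! ### Affinizations and the defining relations -/

section Presentation

/-- The projection onto the quotient by an ideal, as a morphism of Lie algebras. -/
def quotientHom {R L : Type*} [CommRing R] [LieRing L] [LieAlgebra R L] (I : LieIdeal R L) :
    L →ₗ⁅R⁆ L ⧸ I :=
  { I.toSubmodule.mkQ with map_lie' := fun {x y} => LieSubmodule.Quotient.mk_bracket I x y }

theorem existsUnique_comp_quotientHom {R L L' : Type*} [CommRing R] [LieRing L] [LieAlgebra R L]
    [LieRing L'] [LieAlgebra R L'] {I : LieIdeal R L} {f : L →ₗ⁅R⁆ L'} (hI : I ≤ f.ker) :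
    ∃! g : L ⧸ I →ₗ⁅R⁆ L', g.comp (quotientHom I) = f := by
  let g : L ⧸ I →ₗ⁅R⁆ L' :=
    { I.toSubmodule.liftQ (f : L →ₗ[R] L')
        fun x hx => LinearMap.mem_ker.2 (LieHom.mem_ker.1 (hI hx)) with
      map_lie' := by
        intro x y
        obtain ⟨x, rfl⟩ := LieSubmodule.Quotient.surjective_mk' I x
        obtain ⟨y, rfl⟩ := LieSubmodule.Quotient.surjective_mk' I y
        exact f.map_lie x y }
  refine ⟨g, LieHom.ext fun _ => rfl, fun g' hg' => LieHom.ext fun x => ?_⟩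
  obtain ⟨x, rfl⟩ := LieSubmodule.Quotient.surjective_mk' I x
  exact LieHom.congr_fun hg' x

theorem existsUnique_hom_of_relator {n N : ℕ} {L : Type*} [LieRing L] [LieAlgebra ℂ L]
    (g : Gen n N → L) (hg : ∀ x, Relator n N x → FreeLieAlgebra.lift ℂ g x = 0) :
    ∃! ρ : ToroidalLieAlgebra n N →ₗ⁅ℂ⁆ L, ∀ x, ρ (ToroidalLieAlgebra.of x) = g x := by
  have hker : relatorIdeal n N ≤ (FreeLieAlgebra.lift ℂ g).ker :=
    LieSubmodule.lieSpan_le.2 fun x hx => LieHom.mem_ker.2 (hg x hx)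
  have hiff (ρ : ToroidalLieAlgebra n N →ₗ⁅ℂ⁆ L) :
      (∀ x, ρ (ToroidalLieAlgebra.of x) = g x)
        ↔ ρ.comp (quotientHom (relatorIdeal n N)) = FreeLieAlgebra.lift ℂ g := by
    refine ⟨fun h => FreeLieAlgebra.hom_ext fun x => ?_, fun h x => ?_⟩
    · exact (h x).trans (FreeLieAlgebra.lift_of_apply g x).symm
    · exact (LieHom.congr_fun h (gen x)).trans (FreeLieAlgebra.lift_of_apply g x)
  simpa only [hiff] using existsUnique_comp_quotientHom hker

end Presentation

section ChevalleyGenerators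

variable {n : ℕ}

/-- The nodes of the affine diagram as matrix indices `1, …, n + 1`; node `0` becomes `n + 1`. -/
def nodePos (r : Fin (n + 1)) : Pos n :=
  ⟨if r = 0 then n + 1 else r, by
    have hr := r.2
    rw [Finset.mem_Icc]
    split_ifs with h
    · omega
    · rw [Fin.ext_iff, Fin.val_zero] at h
      omega⟩

theorem nodePos_zero : (nodePos (0 : Fin (n + 1)) : ℕ) = n + 1 := by
  simp only [nodePos, if_true]

theorem nodePos_of_ne_zero {r : Fin (n + 1)} (h : r ≠ 0) : (nodePos r : ℕ) = r := by
  simp only [nodePos, if_neg h]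

theorem nodePos_add_one (r : Fin (n + 1)) : (nodePos (r + 1) : ℕ) = r + 1 := by
  rcases eq_or_ne r (Fin.last n) with rfl | hr
  · rw [Fin.last_add_one, nodePos_zero, Fin.val_last]
  · have hval : ((r + 1 : Fin (n + 1)) : ℕ) = r + 1 :=
      Fin.val_add_one_of_lt (lt_of_le_of_ne (Fin.le_last r) hr)
    rw [nodePos_of_ne_zero, hval]
    rw [Ne, Fin.ext_iff, hval, Fin.val_zero]
    omega

theorem nodePos_injective : Function.Injective (nodePos (n := n)) := by
  intro r s h
  have hval : (nodePos r : ℕ) = nodePos s := congrArg _ h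
  simp only [nodePos, Fin.ext_iff, Fin.val_zero] at hval
  ext
  split_ifs at hval <;> omega

/-- Matrix units at the nodes of the affine diagram. -/
def nodeUnit (r s : Fin (n + 1)) : Matrix (Pos n) (Pos n) ℂ :=
  Matrix.single (nodePos r) (nodePos s) 1

theorem nodeUnit_mul_nodeUnit (r s r' s' : Fin (n + 1)) :
    nodeUnit r s * nodeUnit r' s' = if s = r' then nodeUnit r s' else 0 := by
  split_ifs with h
  · rw [nodeUnit, h, nodeUnit, Matrix.single_mul_single_same, one_mul, nodeUnit]
  · exact Matrix.single_mul_single_of_ne _ _ _ _ (fun h' => h (nodePos_injective h')) _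

theorem transpose_nodeUnit (r s : Fin (n + 1)) : (nodeUnit r s).transpose = nodeUnit s r :=
  Matrix.transpose_single _ _ _

theorem trace_nodeUnit (r s : Fin (n + 1)) :
    (nodeUnit r s).trace = if r = s then 1 else 0 := by
  split_ifs with h
  · rw [h]
    exact Matrix.trace_single_eq_same _ _
  · exact Matrix.trace_single_eq_of_ne _ _ _ fun h' => h (nodePos_injective h')

theorem trace_nodeUnit_mul_nodeUnit (r s r' s' : Fin (n + 1)) :
    (nodeUnit r s * nodeUnit r' s').trace = if s = r' ∧ r = s' then 1 else 0 := by
  rw [nodeUnit_mul_nodeUnit, ite_and]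
  split_ifs with h h'
  · rw [trace_nodeUnit, if_pos h']
  · rw [trace_nodeUnit, if_neg h']
  · exact Matrix.trace_zero _ _

theorem nodeUnit_self_mul (a r s : Fin (n + 1)) :
    nodeUnit a a * nodeUnit r s = (if a = r then (1 : ℂ) else 0) • nodeUnit r s := by
  rw [nodeUnit_mul_nodeUnit, ite_smul, one_smul, zero_smul]
  split_ifs with h
  · rw [h]
  · rfl

theorem mul_nodeUnit_self (a r s : Fin (n + 1)) :
    nodeUnit r s * nodeUnit a a = (if a = s then (1 : ℂ) else 0) • nodeUnit r s := by
  rw [nodeUnit_mul_nodeUnit, ite_smul, one_smul, zero_smul]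
  simp only [eq_comm (a := s)]
  split_ifs with h
  · rw [h]
  · rfl

/-- The matrix of `E_r`; for `r ≠ 0` it is lower triangular. -/
def eMat (r : Fin (n + 1)) : Matrix (Pos n) (Pos n) ℂ := nodeUnit (r + 1) r

/-- The matrix of `F_r`. -/
def fMat (r : Fin (n + 1)) : Matrix (Pos n) (Pos n) ℂ := -(eMat r).transpose

/-- The matrix of `H_r`. -/
def hMat (r : Fin (n + 1)) : Matrix (Pos n) (Pos n) ℂ := nodeUnit (r + 1) (r + 1) - nodeUnit r r

theorem fMat_eq (r : Fin (n + 1)) : fMat r = -nodeUnit r (r + 1) := by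
  rw [fMat, eMat, transpose_nodeUnit]

theorem transpose_hMat (r : Fin (n + 1)) : (hMat r).transpose = hMat r := by
  rw [hMat, Matrix.transpose_sub, transpose_nodeUnit, transpose_nodeUnit]

theorem fMat_mul_fMat (i j : Fin (n + 1)) : fMat i * fMat j = (eMat j * eMat i).transpose := by
  rw [fMat, fMat, neg_mul_neg, Matrix.transpose_mul]

theorem add_one_ne_self (hn : 1 ≤ n) (r : Fin (n + 1)) : r + 1 ≠ r := by
  rw [Ne, add_eq_left, Fin.ext_iff, Fin.val_one', Nat.mod_eq_of_lt (by omega), Fin.val_zero]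
  omega

theorem add_one_add_one_ne_self (hn : 2 ≤ n) (r : Fin (n + 1)) : r + 1 + 1 ≠ r := by
  rw [Ne, add_assoc, add_eq_left, Fin.ext_iff, Fin.val_add, Fin.val_one',
    Nat.mod_eq_of_lt (by omega : 1 < n + 1), Fin.val_zero, Nat.mod_eq_of_lt (by omega)]
  omega

theorem eq_add_one_imp_ne_add_one (hn : 2 ≤ n) {i j : Fin (n + 1)} (h : i = j + 1) :
    j ≠ i + 1 :=
  fun h' => add_one_add_one_ne_self hn j (by rw [← h, ← h'])

theorem affineCartan_eq (hn : 2 ≤ n) (i j : Fin (n + 1)) :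
    (affineCartan n i j : ℂ) = (if i = j then 2 else 0)
      - (if i + 1 = j then 1 else 0) - (if i = j + 1 then 1 else 0) := by
  rw [affineCartan]
  rcases eq_or_ne i j with rfl | hij
  · have hne := add_one_ne_self (one_le_two.trans hn) i
    rw [if_pos rfl, if_pos rfl, if_neg hne, if_neg hne.symm]
    norm_num
  · rw [if_neg hij, if_neg hij]
    by_cases hj : i + 1 = j
    · rw [if_pos (Or.inl hj), if_pos hj, if_neg (eq_add_one_imp_ne_add_one hn hj.symm)]
      norm_num
    · by_cases hi : i = j + 1
      · rw [if_pos (Or.inr hi.symm), if_neg hj, if_pos hi]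
        norm_num
      · rw [if_neg (not_or.2 ⟨hj, Ne.symm hi⟩), if_neg hj, if_neg hi]
        norm_num

theorem affineCartan_eq_zero_or_neg_one {i j : Fin (n + 1)} (hij : i ≠ j) :
    affineCartan n i j = 0 ∨ affineCartan n i j = -1 := by
  rw [affineCartan, if_neg hij]
  split_ifs
  · exact Or.inr rfl
  · exact Or.inl rfl

theorem add_one_ne_of_affineCartan_eq_zero {i j : Fin (n + 1)} (h : affineCartan n i j = 0) :
    i + 1 ≠ j ∧ j + 1 ≠ i := by
  refine not_or.1 fun hadj => ?_
  rw [affineCartan, if_pos hadj] at h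
  split_ifs at h
  norm_num at h

theorem trace_hMat (i : Fin (n + 1)) : (hMat i).trace = 0 := by
  rw [hMat, Matrix.trace_sub, trace_nodeUnit, trace_nodeUnit, if_pos rfl, if_pos rfl, sub_self]

theorem trace_eMat (hn : 1 ≤ n) (i : Fin (n + 1)) : (eMat i).trace = 0 := by
  rw [eMat, trace_nodeUnit, if_neg (add_one_ne_self hn i)]

theorem trace_fMat (hn : 1 ≤ n) (i : Fin (n + 1)) : (fMat i).trace = 0 := by
  rw [fMat, Matrix.trace_neg, Matrix.trace_transpose, trace_eMat hn, neg_zero]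

theorem hMat_commute (i j : Fin (n + 1)) : Commute (hMat i) (hMat j) := by
  have hunit (a b : Fin (n + 1)) : Commute (nodeUnit a a) (nodeUnit b b) := by
    rw [Commute, SemiconjBy, nodeUnit_self_mul, mul_nodeUnit_self]
  exact ((hunit _ _).sub_right (hunit _ _)).sub_left ((hunit _ _).sub_right (hunit _ _))

theorem trace_hMat_mul_hMat (hn : 2 ≤ n) (i j : Fin (n + 1)) :
    (hMat i * hMat j).trace = affineCartan n i j := by
  simp only [hMat, sub_mul, mul_sub, Matrix.trace_sub, trace_nodeUnit_mul_nodeUnit, and_self,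
    add_left_inj, affineCartan_eq hn]
  split_ifs <;> ring

theorem hMat_commutator_eMat (hn : 2 ≤ n) (i j : Fin (n + 1)) :
    hMat i * eMat j - eMat j * hMat i = (affineCartan n i j : ℂ) • eMat j := by
  rw [hMat, eMat, sub_mul, mul_sub, nodeUnit_self_mul, nodeUnit_self_mul, mul_nodeUnit_self,
    mul_nodeUnit_self, ← sub_smul, ← sub_smul, ← sub_smul, affineCartan_eq hn]
  simp only [add_left_inj]
  congr 1
  split_ifs <;> ring

theorem hMat_commutator_fMat (hn : 2 ≤ n) (i j : Fin (n + 1)) :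
    hMat i * fMat j - fMat j * hMat i = -((affineCartan n i j : ℂ) • fMat j) := by
  have h := congrArg Matrix.transpose (hMat_commutator_eMat hn i j)
  rw [Matrix.transpose_sub, Matrix.transpose_mul, Matrix.transpose_mul, Matrix.transpose_smul,
    transpose_hMat] at h
  rw [fMat, smul_neg, neg_neg, ← h, mul_neg, neg_mul, neg_sub_neg]

theorem trace_hMat_mul_eMat (hn : 1 ≤ n) (i j : Fin (n + 1)) : (hMat i * eMat j).trace = 0 := by
  have hj := add_one_ne_self hn j
  rw [hMat, eMat, sub_mul, nodeUnit_self_mul, nodeUnit_self_mul, Matrix.trace_sub,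
    Matrix.trace_smul, Matrix.trace_smul, trace_nodeUnit, if_neg hj, smul_zero, smul_zero, sub_zero]

theorem trace_hMat_mul_fMat (hn : 1 ≤ n) (i j : Fin (n + 1)) : (hMat i * fMat j).trace = 0 := by
  rw [fMat, mul_neg, Matrix.trace_neg, ← transpose_hMat, ← Matrix.transpose_mul,
    Matrix.trace_transpose, Matrix.trace_mul_comm, trace_hMat_mul_eMat hn, neg_zero]

theorem eMat_mul_fMat (i j : Fin (n + 1)) :
    eMat i * fMat j = if i = j then -nodeUnit (i + 1) (i + 1) else 0 := by
  rw [eMat, fMat_eq, mul_neg, nodeUnit_mul_nodeUnit]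
  split_ifs with h
  · rw [h]
  · exact neg_zero

theorem fMat_mul_eMat (i j : Fin (n + 1)) :
    fMat i * eMat j = if i = j then -nodeUnit i i else 0 := by
  rw [eMat, fMat_eq, neg_mul, nodeUnit_mul_nodeUnit]
  simp only [add_left_inj]
  split_ifs with h
  · rw [h]
  · exact neg_zero

theorem eMat_mul_self (hn : 1 ≤ n) (i : Fin (n + 1)) : eMat i * eMat i = 0 := by
  rw [eMat, nodeUnit_mul_nodeUnit, if_neg (add_one_ne_self hn i).symm]

theorem fMat_mul_self (hn : 1 ≤ n) (i : Fin (n + 1)) : fMat i * fMat i = 0 := by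
  rw [fMat_mul_fMat, eMat_mul_self hn, Matrix.transpose_zero]

theorem eMat_mul_mul_self (hn : 2 ≤ n) (i j : Fin (n + 1)) : eMat i * eMat j * eMat i = 0 := by
  rw [eMat, eMat, nodeUnit_mul_nodeUnit]
  split_ifs with h
  · rw [nodeUnit_mul_nodeUnit, if_neg (eq_add_one_imp_ne_add_one hn h)]
  · exact zero_mul _

theorem fMat_mul_mul_self (hn : 2 ≤ n) (i j : Fin (n + 1)) : fMat i * fMat j * fMat i = 0 := by
  rw [fMat_mul_fMat, fMat, mul_neg, ← Matrix.transpose_mul, ← mul_assoc, eMat_mul_mul_self hn,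
    Matrix.transpose_zero, neg_zero]

theorem trace_eMat_mul_eMat (hn : 2 ≤ n) (i j : Fin (n + 1)) : (eMat i * eMat j).trace = 0 := by
  rw [eMat, eMat, trace_nodeUnit_mul_nodeUnit,
    if_neg fun h => eq_add_one_imp_ne_add_one hn h.1 h.2.symm]

theorem trace_fMat_mul_fMat (hn : 2 ≤ n) (i j : Fin (n + 1)) : (fMat i * fMat j).trace = 0 := by
  rw [fMat_mul_fMat, Matrix.trace_transpose, trace_eMat_mul_eMat hn]

theorem eMat_mul_eMat_of_affineCartan_eq_zero {i j : Fin (n + 1)} (h : affineCartan n i j = 0) :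
    eMat i * eMat j = 0 ∧ eMat j * eMat i = 0 := by
  obtain ⟨hi, hj⟩ := add_one_ne_of_affineCartan_eq_zero h
  rw [eMat, eMat, nodeUnit_mul_nodeUnit, nodeUnit_mul_nodeUnit, if_neg hj.symm, if_neg hi.symm]
  exact ⟨rfl, rfl⟩

end ChevalleyGenerators

section Relations

open LieAlgebra

variable {n N : ℕ} {L : Type*} [LieRing L] [LieAlgebra ℂ L]

/-- The fields `C X`, with modes `C X m`, represent an affinization of the traceless matrices: they
satisfy the loop algebra relations up to the trace form, times the cocycle
`(m, k) ↦ ∑ p, m p * κ (-(m + k)) p`, times the central element `z`. -/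
structure IsAffinization {I : Type*} [Fintype I] (κ : Idx N → Fin (N + 1) → ℂ)
    (C : Matrix I I ℂ →+ (Idx N → L)) (z : L) : Prop where
  kappa : ∀ m : Idx N, ∑ p, (m p : ℂ) * κ m p = 0
  central : ∀ x : L, ⁅z, x⁆ = 0
  lie : ∀ X Y : Matrix I I ℂ, X.trace = 0 → Y.trace = 0 → ∀ m k : Idx N,
    ⁅C X m, C Y k⁆ = C (X * Y - Y * X) (m + k)
      - ((X * Y).trace * ∑ p, (m p : ℂ) * κ (-(m + k)) p) • z

variable {κ : Idx N → Fin (N + 1) → ℂ} {z : L}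

namespace IsAffinization

section

variable {I : Type*} [Fintype I] {C : Matrix I I ℂ →+ (Idx N → L)} (h : IsAffinization κ C z)
  {X Y : Matrix I I ℂ} (hX : X.trace = 0) (hY : Y.trace = 0)

include h hX hY

theorem lie_of_trace_eq_zero (ht : (X * Y).trace = 0) (m k : Idx N) :
    ⁅C X m, C Y k⁆ = C (X * Y - Y * X) (m + k) := by
  rw [h.lie X Y hX hY, ht, zero_mul, zero_smul, sub_zero]

theorem lie_eq_zero (hXY : X * Y - Y * X = 0) (ht : (X * Y).trace = 0) (m k : Idx N) :
    ⁅C X m, C Y k⁆ = 0 := by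
  rw [h.lie_of_trace_eq_zero hX hY ht, hXY, map_zero, Pi.zero_apply]

theorem lie_lie_eq_zero (hXX : X * X = 0) (hXYX : X * Y * X = 0) (ht : (X * Y).trace = 0)
    (m k : Idx N) : ⁅C X m, ⁅C X m, C Y k⁆⁆ = 0 := by
  have hleft : X * (X * Y - Y * X) = 0 := by
    rw [mul_sub, ← mul_assoc, ← mul_assoc, hXX, hXYX, zero_mul, sub_zero]
  have hright : (X * Y - Y * X) * X = 0 := by
    rw [sub_mul, hXYX, mul_assoc, hXX, mul_zero, sub_zero]
  rw [h.lie_of_trace_eq_zero hX hY ht]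
  refine h.lie_eq_zero hX ?_ ?_ ?_ _ _
  · rw [Matrix.trace_sub, Matrix.trace_mul_comm X Y, sub_self]
  · rw [hleft, hright, sub_zero]
  · rw [hleft, Matrix.trace_zero]

theorem ad_pow_affineCartan_eq_zero {i j : Fin (n + 1)} (hij : i ≠ j) (hXX : X * X = 0)
    (hXYX : X * Y * X = 0) (ht : (X * Y).trace = 0)
    (hXY : affineCartan n i j = 0 → X * Y - Y * X = 0) (m k : Idx N) :
    (ad ℂ L (C X m) ^ (-affineCartan n i j + 1).toNat) (C Y k) = 0 := by
  rcases affineCartan_eq_zero_or_neg_one hij with hA | hA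
  · have hpow : (-affineCartan n i j + 1).toNat = 1 := by rw [hA]; rfl
    rw [hpow, pow_one, ad_apply, h.lie_eq_zero hX hY (hXY hA) ht]
  · have hpow : (-affineCartan n i j + 1).toNat = 2 := by rw [hA]; rfl
    rw [hpow, pow_two, Module.End.mul_apply, ad_apply, ad_apply,
      h.lie_lie_eq_zero hX hY hXX hXYX ht]

end

variable {C : Matrix (Pos n) (Pos n) ℂ →+ (Idx N → L)} (h : IsAffinization κ C z) (hn : 2 ≤ n)

omit [LieAlgebra ℂ L] in
theorem map_intCast_smul [Module ℂ L] (c : ℤ) (X : Matrix (Pos n) (Pos n) ℂ) (m : Idx N) :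
    C ((c : ℂ) • X) m = (c : ℂ) • C X m := by
  rw [Int.cast_smul_eq_zsmul, Int.cast_smul_eq_zsmul, map_zsmul, Pi.smul_apply]

include h hn

theorem lie_hMat_hMat (i j : Fin (n + 1)) (m k : Idx N) :
    ⁅C (hMat i) m, C (hMat j) k⁆
      = -((affineCartan n i j : ℂ) • (∑ p, (m p : ℂ) * κ (-(m + k)) p) • z) := by
  rw [h.lie _ _ (trace_hMat i) (trace_hMat j), sub_eq_zero_of_eq (hMat_commute i j),
    trace_hMat_mul_hMat hn, map_zero, Pi.zero_apply, mul_smul, zero_sub]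

theorem lie_hMat_eMat (i j : Fin (n + 1)) (m k : Idx N) :
    ⁅C (hMat i) m, C (eMat j) k⁆ = (affineCartan n i j : ℂ) • C (eMat j) (m + k) := by
  have hn1 := one_le_two.trans hn
  rw [h.lie_of_trace_eq_zero (trace_hMat i) (trace_eMat hn1 j) (trace_hMat_mul_eMat hn1 i j),
    hMat_commutator_eMat hn, map_intCast_smul]

theorem lie_hMat_fMat (i j : Fin (n + 1)) (m k : Idx N) :
    ⁅C (hMat i) m, C (fMat j) k⁆ = -((affineCartan n i j : ℂ) • C (fMat j) (m + k)) := by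
  have hn1 := one_le_two.trans hn
  rw [h.lie_of_trace_eq_zero (trace_hMat i) (trace_fMat hn1 j) (trace_hMat_mul_fMat hn1 i j),
    hMat_commutator_fMat hn, map_neg, Pi.neg_apply, map_intCast_smul]

theorem ad_eMat_pow_eMat {i j : Fin (n + 1)} (hij : i ≠ j) (m k : Idx N) :
    (ad ℂ L (C (eMat i) m) ^ (-affineCartan n i j + 1).toNat) (C (eMat j) k) = 0 := by
  have hn1 := one_le_two.trans hn
  refine h.ad_pow_affineCartan_eq_zero (trace_eMat hn1 i) (trace_eMat hn1 j) hij
    (eMat_mul_self hn1 i) (eMat_mul_mul_self hn i j) (trace_eMat_mul_eMat hn i j) (fun hA => ?_) m k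
  obtain ⟨hij0, hji0⟩ := eMat_mul_eMat_of_affineCartan_eq_zero hA
  rw [hij0, hji0, sub_zero]

theorem ad_fMat_pow_fMat {i j : Fin (n + 1)} (hij : i ≠ j) (m k : Idx N) :
    (ad ℂ L (C (fMat i) m) ^ (-affineCartan n i j + 1).toNat) (C (fMat j) k) = 0 := by
  have hn1 := one_le_two.trans hn
  refine h.ad_pow_affineCartan_eq_zero (trace_fMat hn1 i) (trace_fMat hn1 j) hij
    (fMat_mul_self hn1 i) (fMat_mul_mul_self hn i j) (trace_fMat_mul_fMat hn i j) (fun hA => ?_) m k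
  obtain ⟨hij0, hji0⟩ := eMat_mul_eMat_of_affineCartan_eq_zero hA
  rw [fMat_mul_fMat, fMat_mul_fMat, hij0, hji0, sub_self]

omit hn

variable (hn1 : 1 ≤ n)

include hn1

theorem lie_eMat_fMat_self (i : Fin (n + 1)) (m k : Idx N) :
    ⁅C (eMat i) m, C (fMat i) k⁆
      = -(C (hMat i) (m + k) - (∑ p, (m p : ℂ) * κ (-(m + k)) p) • z) := by
  have hcomm : eMat i * fMat i - fMat i * eMat i = -hMat i := by
    rw [eMat_mul_fMat, fMat_mul_eMat, if_pos rfl, if_pos rfl, hMat, neg_sub_neg, neg_sub]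
  have htrace : (eMat i * fMat i).trace = -1 := by
    rw [eMat_mul_fMat, if_pos rfl, Matrix.trace_neg, trace_nodeUnit, if_pos rfl]
  rw [h.lie _ _ (trace_eMat hn1 i) (trace_fMat hn1 i), hcomm, htrace, map_neg, Pi.neg_apply,
    neg_one_mul, neg_smul, neg_sub, sub_neg_eq_add, neg_add_eq_sub]

theorem lie_eMat_fMat_of_ne {i j : Fin (n + 1)} (hij : i ≠ j) (m k : Idx N) :
    ⁅C (eMat i) m, C (fMat j) k⁆ = 0 := by
  refine h.lie_eq_zero (trace_eMat hn1 i) (trace_fMat hn1 j) ?_ ?_ m k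
  · rw [eMat_mul_fMat, fMat_mul_eMat, if_neg hij, if_neg hij.symm, sub_zero]
  · rw [eMat_mul_fMat, if_neg hij, Matrix.trace_zero]

theorem lie_eMat_self (i : Fin (n + 1)) (m k : Idx N) : ⁅C (eMat i) m, C (eMat i) k⁆ = 0 :=
  h.lie_eq_zero (trace_eMat hn1 i) (trace_eMat hn1 i) (sub_self _)
    (by rw [eMat_mul_self hn1, Matrix.trace_zero]) m k

theorem lie_fMat_self (i : Fin (n + 1)) (m k : Idx N) : ⁅C (fMat i) m, C (fMat i) k⁆ = 0 :=
  h.lie_eq_zero (trace_fMat hn1 i) (trace_fMat hn1 i) (sub_self _)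
    (by rw [fMat_mul_self hn1, Matrix.trace_zero]) m k

end IsAffinization

/-- The images of the generators of the toroidal Lie algebra under the representation given by the
currents `C` and the central element `z`. -/
def genImage (κ : Idx N → Fin (N + 1) → ℂ) (C : Matrix (Pos n) (Pos n) ℂ →+ (Idx N → L)) (z : L) :
    Gen n N → L
  | .K m l => (-κ (-m) l) • z
  | .H i m => C (hMat i) m
  | .E i m => C (eMat i) m
  | .F i m => C (fMat i) m

theorem lift_ad_pow {X : Type*} (g : X → L) (x y : FreeLieAlgebra ℂ X) (d : ℕ) :
    FreeLieAlgebra.lift ℂ g ((ad ℂ (FreeLieAlgebra ℂ X) x ^ d) y)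
      = (ad ℂ L (FreeLieAlgebra.lift ℂ g x) ^ d) (FreeLieAlgebra.lift ℂ g y) := by
  induction d with
  | zero => rfl
  | succ d ih =>
    rw [pow_succ', pow_succ', Module.End.mul_apply, Module.End.mul_apply, ad_apply, ad_apply,
      LieHom.map_lie, ih]

variable {C : Matrix (Pos n) (Pos n) ℂ →+ (Idx N → L)}

theorem lift_genImage_sumK (m k : Idx N) :
    FreeLieAlgebra.lift ℂ (genImage κ C z) (sumK m k) = -((∑ p, (m p : ℂ) * κ (-k) p) • z) := by
  rw [sumK, map_sum, Finset.sum_smul, ← Finset.sum_neg_distrib]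
  refine Finset.sum_congr rfl fun l _ => ?_
  rw [map_smul, FreeLieAlgebra.lift_of_apply, genImage, smul_smul, ← neg_smul, mul_neg]

theorem IsAffinization.lift_relator (hn : 2 ≤ n) (h : IsAffinization κ C z)
    {x : FreeLieAlgebra ℂ (Gen n N)} (hx : Relator n N x) :
    FreeLieAlgebra.lift ℂ (genImage κ C z) x = 0 := by
  have hn1 := one_le_two.trans hn
  cases hx with simp only [map_add, map_sub, map_smul, LieHom.map_lie, lift_ad_pow,
    lift_genImage_sumK, FreeLieAlgebra.lift_of_apply, genImage]
  | central m l g => rw [smul_lie, h.central, smul_zero]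
  | sumK m =>
    have hkappa := h.kappa (-m)
    simp only [Pi.neg_apply, Int.cast_neg, neg_mul, Finset.sum_neg_distrib, neg_eq_zero] at hkappa
    rw [hkappa, zero_smul, neg_zero]
  | HH i j m k => rw [h.lie_hMat_hMat hn, smul_neg, sub_self]
  | HE i j m k => rw [h.lie_hMat_eMat hn, sub_self]
  | HF i j m k => rw [h.lie_hMat_fMat hn, neg_add_cancel]
  | EF_same i m k =>
    have hA : 2 / (affineCartan n i i : ℂ) = 1 := by
      rw [affineCartan, if_pos rfl, Int.cast_ofNat, div_self two_ne_zero]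
    rw [h.lie_eMat_fMat_self hn1, hA, one_smul, ← sub_eq_add_neg, neg_add_cancel]
  | EF_ne i j hij m k => exact h.lie_eMat_fMat_of_ne hn1 hij m k
  | EE i m k => exact h.lie_eMat_self hn1 i m k
  | FF i m k => exact h.lie_fMat_self hn1 i m k
  | serreE i j hij m k => exact h.ad_eMat_pow_eMat hn hij m k
  | serreF i j hij m k => exact h.ad_fMat_pow_fMat hn hij m k

end Relations

/-! ### The realization -/

section DiagonalCurrent

/-- The current of the `p`-th diagonal matrix unit on the big cell, in terms of the products
`Q i j` of `a_{ij}` and `a^*_{ij}` and of the coroot fields `Φ r`. -/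
def diagonalCurrent {O : Type*} [AddCommGroup O] (n : ℕ) (Q : ℕ → ℕ → O) (Φ : ℕ → O) (p : ℕ) : O :=
  ∑ i ∈ Finset.Icc 1 (p - 1), Q i p - ∑ j ∈ Finset.Icc (p + 1) (n + 1), Q p j
    - ∑ r ∈ Finset.Icc p n, Φ r

variable {O : Type*} [AddCommGroup O] {n : ℕ} (Q : ℕ → ℕ → O) (Φ : ℕ → O)

theorem sum_Icc_eq_add_sum_succ {a b : ℕ} (hab : a ≤ b) (f : ℕ → O) :
    ∑ i ∈ Finset.Icc a b, f i = f a + ∑ i ∈ Finset.Icc (a + 1) b, f i := by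
  rw [Finset.Icc_add_one_left_eq_Ioc, Finset.add_sum_Ioc_eq_sum_Icc hab]

theorem diagonalCurrent_succ_sub (R : Type*) [Semiring R] [Module R O] {r : ℕ}
    (hr : r ∈ Finset.Icc 1 n) :
    diagonalCurrent n Q Φ (r + 1) - diagonalCurrent n Q Φ r
      = (2 : R) • Q r (r + 1) + ∑ i ∈ Finset.Icc 1 (r - 1), (Q i (r + 1) - Q i r)
        + ∑ j ∈ Finset.Icc (r + 2) (n + 1), (Q r j - Q (r + 1) j) + Φ r := by
  obtain ⟨hr1, hrn⟩ := Finset.mem_Icc.1 hr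
  rw [diagonalCurrent, diagonalCurrent, Nat.add_sub_cancel, sum_Icc_eq_sum_pred_add hr1,
    sum_Icc_eq_add_sum_succ (Nat.succ_le_succ hrn), sum_Icc_eq_add_sum_succ hrn,
    Finset.sum_sub_distrib, Finset.sum_sub_distrib, two_smul]
  abel

theorem diagonalCurrent_one_sub_last :
    diagonalCurrent n Q Φ 1 - diagonalCurrent n Q Φ (n + 1)
      = -∑ r ∈ Finset.Icc 1 n, Q r (n + 1) - ∑ r ∈ Finset.Icc 2 (n + 1), Q 1 r
        + -∑ r ∈ Finset.Icc 1 n, Φ r := by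
  have hempty (a : ℕ) : Finset.Icc (a + 1) a = ∅ := Finset.Icc_eq_empty a.not_succ_le_self
  rw [diagonalCurrent, diagonalCurrent, Nat.add_sub_cancel, Nat.sub_self, hempty, hempty, hempty]
  simp only [Finset.sum_empty]
  abel

theorem neg_sum_diagonalCurrent_succ_sub (n : ℕ) :
    -∑ r ∈ Finset.Icc 1 n, (diagonalCurrent n Q Φ (r + 1) - diagonalCurrent n Q Φ r)
      = diagonalCurrent n Q Φ 1 - diagonalCurrent n Q Φ (n + 1) := by
  rw [← neg_sub (diagonalCurrent n Q Φ (n + 1)), ← Finset.sum_Ico_sub _ n.succ_pos]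
  rfl

end DiagonalCurrent

section CurrentHom

variable {n N : ℕ} {W : Type*} [AddCommGroup W] [Module ℂ W] [CommutingFields (Pair n) N W]
  {κ : Idx N → Fin (N + 1) → ℂ} {A : ℕ → ℕ → OpSeries N W} {Φ : ℕ → OpSeries N W}

/-- The current on the big cell as an additive function of the matrix. -/
def currentHom (κ : Idx N → Fin (N + 1) → ℂ) (A : ℕ → ℕ → OpSeries N W) (Φ : ℕ → OpSeries N W) :
    Matrix (Pos n) (Pos n) ℂ →+ (Idx N → Module.End ℂ W) :=
  AddMonoidHom.ofMapSub (cellCurrent κ A Φ) cellCurrent_sub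

theorem isAffinization_currentHom {B : Pos n → Pos n → ℂ}
    (h : FreeFields κ (fun α : Pair n => A α.1.1 α.1.2)
      (fun b : Pos n => ∑ r ∈ Finset.Icc (b : ℕ) n, Φ r) B)
    {β γ : Pos n → ℂ} (hB : ∀ i j, B i j = (if i = j then 1 else 0) + β i + γ j) :
    IsAffinization κ (currentHom κ A Φ) (LinearMap.id : Module.End ℂ W) where
  kappa := h.kappa
  central := (Commute.one_left · |>.lie_eq)
  lie X Y hX hY m k := by
    have hmk := congrFun (h.adShift_matrixCurrent (cell n) hB X Y hX hY m) (m + k)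
    rw [adShift_apply, add_sub_cancel_left, Pi.sub_apply, Pi.smul_apply, kappaDot_apply,
      smul_smul] at hmk
    exact hmk

end CurrentHom

section ChainFields

variable {n N : ℕ} {W : Type*} [AddCommGroup W] [Module ℂ W] [CommutingFields (Pair n) N W]
  {κ : Idx N → Fin (N + 1) → ℂ} {A : ℕ → ℕ → OpSeries N W} {Φ : ℕ → OpSeries N W}
  {u : ℕ → ℕ → SummableFamily (Idx N) W} {P : List ℕ → SummableFamily (Idx N) W}

/-- The commuting fields, extended by zero to a family `u i j` indexed by all pairs of natural
numbers, together with the products `P l` of the `u a b` over consecutive entries `a, b` of `l`. -/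
structure ChainFields (u : ℕ → ℕ → SummableFamily (Idx N) W)
    (P : List ℕ → SummableFamily (Idx N) W) : Prop where
  field_eq : ∀ α : Pair n, CommutingFields.field α = u α.1.1 α.1.2
  eq_zero : ∀ i j, ¬ (0 < i ∧ i < j ∧ j ≤ n + 1) → u i j = 0
  nil : P [] = SummableFamily.one
  singleton : ∀ a, P [a] = SummableFamily.one
  cons_cons : ∀ a b l, P (a :: b :: l) = (u a b).mul (P (b :: l))

namespace ChainFields

theorem uVar_smul_eq_mul (h : ChainFields u P) (i j : ℕ) (F : OpSeries N W) :
    uVar n i j • F = F.mul (u i j) := by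
  by_cases hij : 0 < i ∧ i < j ∧ j ≤ n + 1
  · rw [uVar, dif_pos hij, X_smul, h.field_eq]
  · rw [uVar, dif_neg hij, zero_smul, h.eq_zero i j hij, OpSeries.mul_zero]

theorem kappaDerivation_uVar (h : ChainFields u P) (i j : ℕ) :
    kappaDerivation κ (uVar n i j) = kappaD κ (u i j) := by
  simp only [kappaDerivation_apply, h.uVar_smul_eq_mul, eulerSeries_mul, add_sub_cancel_left,
    kappaD]

theorem chainPoly_smul_eq_mul (h : ChainFields u P) (l : List ℕ) (F : OpSeries N W) :
    chainPoly n l • F = F.mul (P l) := by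
  induction l generalizing F with
  | nil => rw [h.nil, OpSeries.mul_one]; exact one_smul _ F
  | cons a l ih =>
    cases l with
    | nil => rw [h.singleton, OpSeries.mul_one]; exact one_smul _ F
    | cons b l =>
      rw [chainPoly, h.cons_cons, mul_comm, mul_smul, ih, h.uVar_smul_eq_mul, OpSeries.mul_assoc]

theorem sum_filter_chains_mul (h : ChainFields u P) {r j : ℕ} (hr : r ∈ Finset.Icc 1 n)
    (hj : j ∈ Finset.Icc (r + 1) (n + 1)) (F : OpSeries N W) :
    ∑ q ∈ (chains j).filter (fun q => ∀ k ∈ q, k ≠ j → k ≤ r),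
        F.mul ((P (q.sort (· ≤ ·))).mul (u r (n + 1)))
      = uVar n r (n + 1) • (∑ s ∈ Finset.Icc 1 r, vEnt n 1 s * uVar n s j) • F := by
  rw [Finset.mem_Icc] at hr
  simp only [← OpSeries.mul_assoc, ← h.chainPoly_smul_eq_mul, ← h.uVar_smul_eq_mul]
  rw [← Finset.smul_sum, ← Finset.sum_smul,
    sum_filter_chains_chainPoly hr.1 (Finset.mem_Icc.1 hj).1 hr.2]

theorem sum_chains_append_mul (h : ChainFields u P) {r : ℕ} (hr : r ∈ Finset.Icc 1 n)
    (F : OpSeries N W) :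
    ∑ t ∈ Finset.Icc 1 r, ∑ q ∈ chains t, F.mul (P (q.sort (· ≤ ·) ++ [n + 1]))
      = (∑ t ∈ Finset.Icc 1 r, vEnt n 1 t * uVar n t (n + 1)) • F := by
  rw [Finset.sum_smul]
  refine Finset.sum_congr rfl fun t ht => ?_
  rw [Finset.mem_Icc] at hr ht
  have ht' : t ∈ Finset.Icc 1 (n + 1) := Finset.mem_Icc.2 (by omega)
  simp only [← h.chainPoly_smul_eq_mul]
  rw [← Finset.sum_smul, sum_chains_chainPoly_append ht']

theorem sum_chains_mul (h : ChainFields u P) {r : ℕ} (hr : r ∈ Finset.Icc 1 (n + 1))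
    (F : OpSeries N W) :
    ∑ q ∈ chains r, F.mul (P (q.sort (· ≤ ·))) = vEnt n 1 r • F := by
  simp only [← h.chainPoly_smul_eq_mul]
  rw [← Finset.sum_smul, sum_chains_chainPoly hr]

end ChainFields

theorem cellCurrent_eMat_zero (hn : 1 ≤ n) : cellCurrent κ A Φ (eMat 0) = -A 1 (n + 1) := by
  have hone : (nodePos (0 + 1 : Fin (n + 1)) : ℕ) = 1 := nodePos_add_one 0
  have hlt : nodePos (0 + 1 : Fin (n + 1)) < nodePos 0 := by
    rw [← Subtype.coe_lt_coe, hone, nodePos_zero]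
    exact Nat.lt_succ_of_le hn
  rw [eMat, nodeUnit, cellCurrent_single_of_lt hlt, hone, nodePos_zero, Finset.Icc_self,
    Finset.sum_singleton, uEnt_self, one_smul, neg_one_smul]

variable {r : Fin (n + 1)}

theorem cellCurrent_eMat (h : ChainFields u P) (hr : r ≠ 0) :
    cellCurrent κ A Φ (eMat r)
      = (A r (r + 1)).mul ((u r (r + 1)).mul (u r (r + 1)))
        - ∑ j ∈ Finset.Icc ((r : ℕ) + 2) (n + 1), (A (r + 1) j).mul (u r j)
        + ∑ j ∈ Finset.Icc 1 ((r : ℕ) - 1), (A j r).mul (u j (r + 1))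
        + ∑ j ∈ Finset.Icc ((r : ℕ) + 2) (n + 1),
            ((A r j).mul (u r j) - (A (r + 1) j).mul (u (r + 1) j)).mul (u r (r + 1))
        + (Φ r).mul (u r (r + 1))
        + kappaD κ (u r (r + 1)) := by
  have hpq : (nodePos (r + 1) : ℕ) = nodePos r + 1 := by
    rw [nodePos_add_one, nodePos_of_ne_zero hr]
  rw [eMat, nodeUnit, cellCurrent_single_succ hpq, nodePos_add_one, nodePos_of_ne_zero hr,
    sum_Icc_eq_add_sum_succ (by omega) fun j => uVar n r j • A r j]
  simp only [← OpSeries.mul_assoc, ← h.uVar_smul_eq_mul, ← h.kappaDerivation_uVar, smul_add,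
    smul_sub, Finset.smul_sum, Finset.sum_sub_distrib]
  abel

theorem cellCurrent_fMat (h : ChainFields u P) (hr : r ≠ 0) :
    cellCurrent κ A Φ (fMat r)
      = A r (r + 1) - ∑ j ∈ Finset.Icc 1 ((r : ℕ) - 1), (A j (r + 1)).mul (u j r) := by
  have hlt : nodePos r < nodePos (r + 1) := by
    rw [← Subtype.coe_lt_coe, nodePos_of_ne_zero hr, nodePos_add_one]
    exact Nat.lt_succ_self _
  rw [fMat_eq, nodeUnit, Matrix.single_neg, cellCurrent_single_of_lt hlt, nodePos_of_ne_zero hr,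
    nodePos_add_one, neg_neg, one_smul, sum_Icc_eq_sum_pred_add (Fin.pos_iff_ne_zero.2 hr),
    uEnt_self, one_smul, add_comm, sub_eq_add_neg, ← Finset.sum_neg_distrib]
  refine congrArg _ (Finset.sum_congr rfl fun j hj => ?_)
  rw [Finset.mem_Icc] at hj
  rw [uEnt_of_lt (by omega), neg_smul, h.uVar_smul_eq_mul]

theorem cellCurrent_fMat_zero (h : ChainFields u P) :
    cellCurrent κ A Φ (fMat 0)
      = ∑ r ∈ Finset.Icc 1 n, ∑ j ∈ Finset.Icc (r + 1) (n + 1),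
          ∑ q ∈ (chains j).filter (fun q => ∀ k ∈ q, k ≠ j → k ≤ r),
            (-A r j).mul ((P (q.sort (· ≤ ·))).mul (u r (n + 1)))
        - ∑ r ∈ Finset.Icc 1 n, ∑ t ∈ Finset.Icc 1 r, ∑ q ∈ chains t,
            (Φ r).mul (P (q.sort (· ≤ ·) ++ [n + 1]))
        - ∑ r ∈ Finset.Icc 1 n, ∑ q ∈ chains r,
            (kappaD κ (u r (n + 1))).mul (P (q.sort (· ≤ ·))) := by
  have hsucc {r : ℕ} (hr : r ∈ Finset.Icc 1 n) : r ∈ Finset.Icc 1 (n + 1) :=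
    Finset.Icc_subset_Icc_right n.le_succ hr
  rw [fMat_eq, nodeUnit, Matrix.single_neg,
    cellCurrent_single_corner nodePos_zero (nodePos_add_one 0),
    Finset.sum_congr rfl fun r hr => Finset.sum_congr rfl fun j hj =>
      h.sum_filter_chains_mul hr hj (-A r j),
    Finset.sum_congr rfl fun r hr => h.sum_chains_append_mul hr (Φ r),
    Finset.sum_congr rfl fun r hr => h.sum_chains_mul (hsucc hr) (kappaD κ (u r (n + 1)))]
  simp only [smul_neg, Finset.sum_neg_distrib, h.kappaDerivation_uVar]

theorem cellCurrent_hMat (h : ChainFields u P) (r : Fin (n + 1)) :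
    cellCurrent κ A Φ (hMat r)
      = diagonalCurrent n (fun i j => (A i j).mul (u i j)) Φ (r + 1)
        - diagonalCurrent n (fun i j => (A i j).mul (u i j)) Φ (nodePos r) := by
  rw [hMat, cellCurrent_sub, nodeUnit, nodeUnit, cellCurrent_single_self, cellCurrent_single_self,
    nodePos_add_one]
  simp only [diagonalCurrent, h.uVar_smul_eq_mul]

end ChainFields

section FockRealization

variable {n N : ℕ} {S : SignDecomposition N} {κ : Idx N → Fin (N + 1) → ℂ} {lam : ℕ → ℂ}

theorem aS_eq_zero {i j : ℕ} (hij : ¬ (0 < i ∧ i < j ∧ j ≤ n + 1)) : aS n S i j = 0 := by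
  refine LinearMap.ext fun v => Finsupp.ext fun k => ?_
  change aStarMode n S i j k v = 0
  rw [aStarMode, derivX, dif_neg hij, LinearMap.rTensor_zero, LinearMap.zero_apply]

theorem chainFields_fock : ChainFields (aS n S) (chainProd n S) where
  field_eq _ := rfl
  eq_zero _ _ := aS_eq_zero
  nil := chainProd.eq_2 n S [] nofun
  singleton a := chainProd.eq_2 n S [a] nofun
  cons_cons a b l := chainProd.eq_1 n S a b l

theorem PhiF_zero (n : ℕ) (S : SignDecomposition N) (κ : Idx N → Fin (N + 1) → ℂ) (lam : ℕ → ℂ) :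
    PhiF n S κ lam 0 = -∑ r ∈ Finset.Icc 1 n, PhiF n S κ lam r := by
  funext m
  rw [Pi.neg_apply, Finset.sum_apply]
  change LinearMap.lTensorHom (R := ℂ) (CX n N) _ = _
  rw [heisAll, if_pos rfl, map_neg, map_sum]
  congr 1
  refine Finset.sum_congr rfl fun r hr => ?_
  rw [PhiF, heisAll, if_neg (Nat.one_le_iff_ne_zero.1 (Finset.mem_Icc.1 hr).1)]
  rfl

theorem rhoHpos_eq_diagonalCurrent_sub {r : ℕ} (hr : r ∈ Finset.Icc 1 n) :
    rhoHpos n S κ lam r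
      = diagonalCurrent n (fun i j => (aF n S i j).mul (aS n S i j)) (PhiF n S κ lam) (r + 1)
        - diagonalCurrent n (fun i j => (aF n S i j).mul (aS n S i j)) (PhiF n S κ lam) r := by
  rw [diagonalCurrent_succ_sub _ _ ℂ hr, rhoHpos]

theorem rhoH0_eq_diagonalCurrent_sub :
    rhoH0 n S κ lam
      = diagonalCurrent n (fun i j => (aF n S i j).mul (aS n S i j)) (PhiF n S κ lam) 1
        - diagonalCurrent n (fun i j => (aF n S i j).mul (aS n S i j)) (PhiF n S κ lam)
            (n + 1) := by
  rw [diagonalCurrent_one_sub_last, rhoH0, PhiF_zero]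

theorem rhoH0_eq_neg_sum_rhoHpos :
    rhoH0 n S κ lam = -∑ r ∈ Finset.Icc 1 n, rhoHpos n S κ lam r := by
  rw [Finset.sum_congr rfl fun r hr => rhoHpos_eq_diagonalCurrent_sub hr,
    neg_sum_diagonalCurrent_succ_sub, rhoH0_eq_diagonalCurrent_sub]

theorem currentHom_eMat (hn : 1 ≤ n) (r : Fin (n + 1)) :
    currentHom κ (aF n S) (PhiF n S κ lam) (eMat r) = rhoE n S κ lam r := by
  rw [rhoE]
  split_ifs with hr
  · rw [hr]
    exact cellCurrent_eMat_zero hn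
  · exact cellCurrent_eMat chainFields_fock hr

theorem currentHom_fMat (r : Fin (n + 1)) :
    currentHom κ (aF n S) (PhiF n S κ lam) (fMat r) = rhoF n S κ lam r := by
  rw [rhoF]
  split_ifs with hr
  · rw [hr]
    exact cellCurrent_fMat_zero chainFields_fock
  · exact cellCurrent_fMat chainFields_fock hr

theorem currentHom_hMat (r : Fin (n + 1)) :
    currentHom κ (aF n S) (PhiF n S κ lam) (hMat r) = rhoH n S κ lam r := by
  refine (cellCurrent_hMat chainFields_fock r).trans ?_
  rw [rhoH]
  split_ifs with hr
  · rw [hr, nodePos_zero, rhoH0_eq_diagonalCurrent_sub, Fin.val_zero]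
  · rw [nodePos_of_ne_zero hr, rhoHpos_eq_diagonalCurrent_sub
      (Finset.mem_Icc.2 ⟨Fin.pos_iff_ne_zero.2 hr, Nat.le_of_lt_succ r.2⟩)]

end FockRealization

end

end Toroidal

theorem mainTheorem1_general (n N : ℕ) (hn : 2 ≤ n)
    (S : Toroidal.SignDecomposition N)
    (κ : (Fin (N + 1) → ℤ) → Fin (N + 1) → ℂ) (lam : ℕ → ℂ)
    (eqn1 : ∀ m : Fin (N + 1) → ℤ, ∑ p, (m p : ℂ) * κ m p = 0)
    (eqn2 : ∀ m k : Fin (N + 1) → ℤ, m ∈ S.pos → k ∈ S.pos →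
      ∑ p, (m p : ℂ) * κ (-m - k) p = 0) :
    (∃! ρ : Toroidal.ToroidalLieAlgebra n N →ₗ⁅ℂ⁆ Module.End ℂ (Toroidal.Fock n S),
      (∀ (r : Fin (n + 1)) (m : Fin (N + 1) → ℤ),
        ρ (Toroidal.ToroidalLieAlgebra.of (.E r m)) = Toroidal.rhoE n S κ lam r m ∧
        ρ (Toroidal.ToroidalLieAlgebra.of (.F r m)) = Toroidal.rhoF n S κ lam r m ∧
        ρ (Toroidal.ToroidalLieAlgebra.of (.H r m)) = Toroidal.rhoH n S κ lam r m) ∧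
      (∀ (m : Fin (N + 1) → ℤ) (l : Fin (N + 1)),
        ρ (Toroidal.ToroidalLieAlgebra.of (.K m l)) = (-κ (-m) l) • LinearMap.id)) ∧
    Toroidal.rhoH0 n S κ lam = -∑ r ∈ Finset.Icc 1 n, Toroidal.rhoHpos n S κ lam r := by
  refine ⟨?_, Toroidal.rhoH0_eq_neg_sum_rhoHpos⟩
  have h := Toroidal.freeFields_fock (n := n) (S := S) lam eqn1 eqn2
  have hE := fun r => Toroidal.currentHom_eMat (S := S) (κ := κ) (lam := lam) (n := n) (by omega) r
  have hF := fun r => Toroidal.currentHom_fMat (S := S) (κ := κ) (lam := lam) (n := n) r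
  have hH := fun r => Toroidal.currentHom_hMat (S := S) (κ := κ) (lam := lam) (n := n) r
  obtain ⟨ρ, hρ, huniq⟩ := Toroidal.existsUnique_hom_of_relator _ fun x hx =>
    (Toroidal.isAffinization_currentHom h fun _ _ => rfl).lift_relator hn hx
  refine ⟨ρ, ⟨fun r m => ⟨?_, ?_, ?_⟩, fun m l => hρ _⟩, fun ρ' hρ' => huniq ρ' ?_⟩
  · exact (hρ _).trans (congrFun (hE r) m)
  · exact (hρ _).trans (congrFun (hF r) m)
  · exact (hρ _).trans (congrFun (hH r) m)
  · rintro (⟨m, l⟩ | ⟨i, m⟩ | ⟨i, m⟩ | ⟨i, m⟩)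
    · exact hρ'.2 m l
    · exact (hρ'.1 i m).2.2.trans (congrFun (hH i) m).symm
    · exact (hρ'.1 i m).1.trans (congrFun (hE i) m).symm
    · exact (hρ'.1 i m).2.1.trans (congrFun (hF i) m).symm

theorem mainTheorem1 (n N : ℕ) (hn : 2 ≤ n) (hN : 1 ≤ N)
    (S : Toroidal.SignDecomposition N)
    (κ : (Fin (N + 1) → ℤ) → Fin (N + 1) → ℂ) (lam : ℕ → ℂ)
    (eqn1 : ∀ m : Fin (N + 1) → ℤ, ∑ p, (m p : ℂ) * κ m p = 0)
    (eqn2 : ∀ m k : Fin (N + 1) → ℤ, m ∈ S.pos → k ∈ S.pos →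
      ∑ p, (m p : ℂ) * κ (-m - k) p = 0) :
    (∃! ρ : Toroidal.ToroidalLieAlgebra n N →ₗ⁅ℂ⁆ Module.End ℂ (Toroidal.Fock n S),
      (∀ (r : Fin (n + 1)) (m : Fin (N + 1) → ℤ),
        ρ (Toroidal.ToroidalLieAlgebra.of (.E r m)) = Toroidal.rhoE n S κ lam r m ∧
        ρ (Toroidal.ToroidalLieAlgebra.of (.F r m)) = Toroidal.rhoF n S κ lam r m ∧
        ρ (Toroidal.ToroidalLieAlgebra.of (.H r m)) = Toroidal.rhoH n S κ lam r m) ∧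
      (∀ (m : Fin (N + 1) → ℤ) (l : Fin (N + 1)),
        ρ (Toroidal.ToroidalLieAlgebra.of (.K m l)) = (-κ (-m) l) • LinearMap.id)) ∧
    Toroidal.rhoH0 n S κ lam = -∑ r ∈ Finset.Icc 1 n, Toroidal.rhoHpos n S κ lam r :=
  mainTheorem1_general n N hn S κ lam eqn1 eqn2
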